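/- Equip $\mathbb R^4=\mathbb C^2$ (coordinates $z_j=x_j+iy_j$) with $\omega=dx_1\wedge dy_1+dx_2\wedge dy_2$. A *Lagrangian self-isotopy* of an embedded Lagrangian torus $L\subset\mathbb R^4$ is a smooth path $\phi_s$, $0\le s\le 1$, of compactly supported diffeomorphisms of $\mathbb R^4$ (with supports in a common compact set) such that $\phi_0=\mathrm{id}$, $\phi_1(L)=L$ and $\phi_s(L)$ is Lagrangian for every $s\in[0,1]$. The *Lagrangian monodromy group* $\mathcal L(L)$ is the set of all automorphisms $(\phi_1)_*$ of $H_1(L;\mathbb Z)$ obtained from Lagrangian self-isotopies of $L$. The *Maslov class* $\mu_L\in H^1(L;\mathbb Z)=\mathrm{Hom}(H_1(L;\mathbb Z),\mathbb Z)$ is the homomorphism that sends the class of an immersed closed curve $C\subset L$ to the Maslov index of the loop of Lagrangian planes $t\mapsto T_{C(t)}L$. **Theorem.** Let $a,b>0$ and let $T=T_{a,b}=\{(z_1,z_2)\in\mathbb C^2 : |z_1|=a,\ |z_2|=b\}$ be a Clifford torus. The classes $\gamma_1,\gamma_2$ of the loops $t\mapsto(ae^{it},b)$ and $t\mapsto(a,be^{it})$,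 $t\in[0,2\pi]$, form a basis of $H_1(T;\mathbb Z)$, the Maslov class $\mu=\mu_T$ exists and is unique, and $\mu(\gamma_1)=\mu(\gamma_2)=2$. Moreover $$\mathcal L(T)=\{g\in \mathrm{Aut}(H_1(T;\mathbb Z)) : \mu\circ g=\mu\}.$$ Equivalently, in the basis $(\gamma_1,\gamma_2)$, $\mathcal L(T)$ is the subgroup $$G_\mu=\{g\in GL(2,\mathbb Z) : \begin{pmatrix}2&2\end{pmatrix}g=\begin{pmatrix}2&2\end{pmatrix}\}$$ of $GL(2,\mathbb Z)$. For $n\in\mathbb Z$ put $$g_n=\begin{pmatrix}1-n&-n\\ n&1+n\end{pmatrix},\qquad f_n=\begin{pmatrix}1-n&2-n\\ n&-1+n\end{pmatrix}.$$ Then the $g_n$ are pairwise distinct, and so are the $f_n$; $G_\mu$ is the disjoint union of $G_\mu^+=\{g_n : n\in\mathbb Z\}$, its elements of determinant $1$, and $G_\mu^-=\{f_n : n\in\mathbb Z\}$, its elements of determinant $-1$. For all $n,m\in\mathbb Z$, the element $f_n$ has order $2$ and maps $\gamma_0=-\gamma_1+\gamma_2$ to $-\gamma_0$, and $$g_n=(g_1)^n=(f_1f_0)^n,\qquad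 (f_0f_1)^n=g_{-n}=(g_n)^{-1},\qquad g_nf_m=f_{n+m}.$$ Finally, $G_\mu$ is freely generated by the two elements $f_0,f_1$ of order $2$, that is, $G_\mu=\langle f_0,f_1\mid f_0^2=e=f_1^2\rangle$, and it is isomorphic to the infinite dihedral group $D_\infty$. -/

import Mathlib

open CategoryTheory AlgebraicTopology
open scoped Manifold ContDiff Simplicial

noncomputable section

namespace LagMonodromy

/-! ### First singular homology with integer coefficients -/

/-- `H₁(X; ℤ)`, singular homology. -/
abbrev H1 (X : Type) [TopologicalSpace X] : ModuleCat.{0} ℤ :=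
  ((singularHomologyFunctor (ModuleCat.{0} ℤ) 1).obj (ModuleCat.of ℤ ℤ)).obj (TopCat.of X)

/-- The homomorphism `f_* : H₁(X; ℤ) → H₁(Y; ℤ)` induced by a continuous map. -/
def H1map {X Y : Type} [TopologicalSpace X] [TopologicalSpace Y] (f : C(X, Y)) :
    H1 X →ₗ[ℤ] H1 Y :=
  (((singularHomologyFunctor (ModuleCat.{0} ℤ) 1).obj (ModuleCat.of ℤ ℤ)).map
    (TopCat.ofHom f)).hom

/-- A path, as a morphism from the unit interval in the category of topological spaces. -/
def pathHom {X : Type} [TopologicalSpace X] {x y : X} (p : Path x y) :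
    TopCat.I.{0} ⟶ TopCat.of X :=
  TopCat.ofHom (p.toContinuousMap.comp (toContinuousMap TopCat.I.homeomorph))

/-- A path, seen as a singular `1`-simplex; the vertices `0` and `1` of the standard simplex
go to the source and to the target of the path. -/
def pathSimplex {X : Type} [TopologicalSpace X] {x y : X} (p : Path x y) :
    (TopCat.toSSet.obj (TopCat.of X)) _⦋1⦌ :=
  TopCat.toSSetObj₁Equiv.symm (pathHom p)

/-- The singular simplex of a loop is a cycle. -/
theorem pathSimplex_cycle {X : Type} [TopologicalSpace X] {x : X} (p : Path x x) :
    (TopCat.toSSet.obj (TopCat.of X)).ιChainComplex (R := ModuleCat.of ℤ ℤ) (pathSimplex p) ≫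
      ((TopCat.toSSet.obj (TopCat.of X)).chainComplex (ModuleCat.of ℤ ℤ)).d 1 0 = 0 := by
  have h : (TopCat.toSSet.obj (TopCat.of X)).δ 0 (pathSimplex p) =
      (TopCat.toSSet.obj (TopCat.of X)).δ 1 (pathSimplex p) := by
    unfold pathSimplex
    rw [TopCat.δ_zero_toSSetObj₁Equiv.symm, TopCat.δ_one_toSSetObj₁Equiv.symm]
    congr 1
    exact p.target.trans p.source.symm
  rw [SSet.ιChainComplex_d]
  simp [Fin.sum_univ_two, h]

/-- The class in `H₁(X; ℤ)` of a loop in `X`: the homology class of the singular `1`-simplex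
given by the loop. -/
def loopClass {X : Type} [TopologicalSpace X] {x : X} (p : Path x x) : H1 X :=
  (((TopCat.toSSet.obj (TopCat.of X)).chainComplex (ModuleCat.of ℤ ℤ)).liftCycles
      ((TopCat.toSSet.obj (TopCat.of X)).ιChainComplex (pathSimplex p)) 0 (by simp)
      (pathSimplex_cycle p) ≫
    ((TopCat.toSSet.obj (TopCat.of X)).chainComplex (ModuleCat.of ℤ ℤ)).homologyπ 1).hom (1 : ℤ)

/-! ### Symplectic geometry of `ℝ⁴ = ℂ²`, with `z_j = x_j + i y_j` -/

/-- The standard symplectic form `dx₁ ∧ dy₁ + dx₂ ∧ dy₂`. -/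
def omega (v w : ℂ × ℂ) : ℝ :=
  (v.1.re * w.1.im - v.1.im * w.1.re) + (v.2.re * w.2.im - v.2.im * w.2.re)

/-- The tangent space at `p` of a submanifold `L`, spanned by the velocities at `p` of the smooth
curves that lie in `L`. -/
def tangentSpaceAt (L : Set (ℂ × ℂ)) (p : ℂ × ℂ) : Submodule ℝ (ℂ × ℂ) :=
  Submodule.span ℝ {v | ∃ c : ℝ → ℂ × ℂ,
    ContDiff ℝ ∞ c ∧ (∀ t, c t ∈ L) ∧ c 0 = p ∧ deriv c 0 = v}

/-- Lagrangian planes of `(ℝ⁴, ω)`. -/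
def IsLagrangianPlane (Λ : Submodule ℝ (ℂ × ℂ)) : Prop :=
  Module.finrank ℝ Λ = 2 ∧ ∀ v ∈ Λ, ∀ w ∈ Λ, omega v w = 0

/-- A submanifold is Lagrangian if all its tangent spaces are Lagrangian planes.  (This is
used only for images of an embedded torus under diffeomorphisms.) -/
def IsLagrangian (L : Set (ℂ × ℂ)) : Prop :=
  ∀ p ∈ L, IsLagrangianPlane (tangentSpaceAt L p)

/-- The Clifford torus `T_{a,b} = {|z₁| = a, |z₂| = b}`. -/
def cliffordTorus (a b : ℝ) : Set (ℂ × ℂ) :=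
  {z | ‖z.1‖ = a ∧ ‖z.2‖ = b}

/-! ### The Maslov class -/

/-- `m` is the Maslov index of the closed path `Λ t`, `0 ≤ t ≤ 1`, of Lagrangian planes, that is,
the degree of `t ↦ det² (Λ t) ∈ S¹`.  For a real basis `v, w` of a Lagrangian plane
`det_ℂ (v, w)` is not zero, and `det_ℂ (v, w)² / |det_ℂ (v, w)|²` does not depend on the basis;
`θ` is a continuous choice of its argument. -/
def HasMaslovIndex (Λ : ℝ → Submodule ℝ (ℂ × ℂ)) (m : ℤ) : Prop :=
  (∀ t ∈ Set.Icc (0 : ℝ) 1, IsLagrangianPlane (Λ t)) ∧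
  ∃ θ : ℝ → ℝ, ContinuousOn θ (Set.Icc 0 1) ∧
    (∀ t ∈ Set.Icc (0 : ℝ) 1, ∃ v w : ℂ × ℂ,
      LinearIndependent ℝ ![v, w] ∧ Submodule.span ℝ {v, w} = Λ t ∧
      (v.1 * w.2 - v.2 * w.1) ^ 2 =
        ((‖v.1 * w.2 - v.2 * w.1‖ ^ 2 : ℝ) : ℂ) * Complex.exp ((θ t : ℂ) * Complex.I)) ∧
    θ 1 - θ 0 = 2 * Real.pi * m

/-- `μ ∈ H¹(L; ℤ) = Hom(H₁(L; ℤ), ℤ)` is the Maslov class of `L`: on the class of an immersed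
closed curve `C` in `L` it takes the Maslov index of the loop `t ↦ T_{C(t)} L` as its value. -/
def IsMaslovClass (L : Set (ℂ × ℂ)) (μ : H1 L →ₗ[ℤ] ℤ) : Prop :=
  ∀ (x : L) (p : Path x x) (C : ℝ → ℂ × ℂ),
    ContDiff ℝ ∞ C → Function.Periodic C 1 → (∀ t, deriv C t ≠ 0) →
    (∀ t : unitInterval, (p t : ℂ × ℂ) = C t) →
    HasMaslovIndex (fun t => tangentSpaceAt L (C t)) (μ (loopClass p))

/-! ### Isotopies and Lagrangian monodromies -/

/-- A smooth path `φ_s`, `0 ≤ s ≤ 1`, with `φ_0 = id`, in the group of compactly supported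
diffeomorphisms of `ℝ⁴`.  (Every `φ_s` preserves the orientation and is isotopic to the identity,
through `φ_{rs}`, `0 ≤ r ≤ 1`.  The values of `φ` outside `[0, 1]` play no role.) -/
structure CompactIsotopy where
  φ : ℝ → Diffeomorph 𝓘(ℝ, ℂ × ℂ) 𝓘(ℝ, ℂ × ℂ) (ℂ × ℂ) (ℂ × ℂ) ∞
  smooth : ContDiffOn ℝ ∞ (fun q : ℝ × (ℂ × ℂ) => φ q.1 q.2) (Set.Icc 0 1 ×ˢ Set.univ)
  zero : ∀ z, φ 0 z = z
  compactSupport : ∃ K : Set (ℂ × ℂ), IsCompact K ∧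
    ∀ s ∈ Set.Icc (0 : ℝ) 1, ∀ z, z ∉ K → φ s z = z

/-- The restriction `L → L` of a diffeomorphism `f` with `f(L) = L`. -/
def restrictSelf (L : Set (ℂ × ℂ))
    (f : Diffeomorph 𝓘(ℝ, ℂ × ℂ) 𝓘(ℝ, ℂ × ℂ) (ℂ × ℂ) (ℂ × ℂ) ∞) (h : f '' L = L) : C(L, L) :=
  ⟨Set.MapsTo.restrict f L L (Set.mapsTo_iff_image_subset.2 h.subset),
    f.continuous.restrict _⟩

/-- The Lagrangian monodromies of `L`: the automorphisms `(φ_1)_*` of `H₁(L; ℤ)` for the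
Lagrangian self-isotopies `φ_s` of `L`. -/
def lagrangianMonodromies (L : Set (ℂ × ℂ)) : Set (H1 L ≃ₗ[ℤ] H1 L) :=
  {h | ∃ (Φ : CompactIsotopy) (h1 : Φ.φ 1 '' L = L),
    (∀ s ∈ Set.Icc (0 : ℝ) 1, IsLagrangian (Φ.φ s '' L)) ∧
    (h : H1 L →ₗ[ℤ] H1 L) = H1map (restrictSelf L (Φ.φ 1) h1)}

/-- The group of the automorphisms `g` with `μ ∘ g = μ`. -/
def preserving {M : Type} [AddCommGroup M] [Module ℤ M] (μ : M →ₗ[ℤ] ℤ) :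
    Subgroup (M ≃ₗ[ℤ] M) where
  carrier := {g | ∀ x, μ (g x) = μ x}
  one_mem' := fun _ => rfl
  mul_mem' := fun {g h} hg hh x => (hg (h x)).trans (hh x)
  inv_mem' := fun {g} hg x => by
    have h := hg (g⁻¹ x)
    rw [← h]
    exact congrArg μ (g.apply_symm_apply x)

/-! ### The standard loops on the Clifford torus -/

/-- The base point `(a, b)`. -/
def torusBase (a b : ℝ) (ha : 0 < a) (hb : 0 < b) : cliffordTorus a b :=
  ⟨((a : ℂ), (b : ℂ)), by simp [cliffordTorus, abs_of_pos ha, abs_of_pos hb]⟩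

/-- The loop `t ↦ (a e^{2πit}, b)`, `0 ≤ t ≤ 1`. -/
def torusLoop₁ (a b : ℝ) (ha : 0 < a) (hb : 0 < b) :
    Path (torusBase a b ha hb) (torusBase a b ha hb) where
  toFun t := ⟨((a : ℂ) * Complex.exp ((2 * Real.pi * (t : ℝ) : ℝ) * Complex.I), (b : ℂ)), by
    simp only [cliffordTorus, Set.mem_ofPred_eq, norm_mul, Complex.norm_exp_ofReal_mul_I]
    simp [abs_of_pos ha, abs_of_pos hb]⟩
  continuous_toFun := by fun_prop
  source' := by simp [torusBase]
  target' := by simp [torusBase, Complex.exp_two_pi_mul_I]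

/-- The loop `t ↦ (a, b e^{2πit})`, `0 ≤ t ≤ 1`. -/
def torusLoop₂ (a b : ℝ) (ha : 0 < a) (hb : 0 < b) :
    Path (torusBase a b ha hb) (torusBase a b ha hb) where
  toFun t := ⟨((a : ℂ), (b : ℂ) * Complex.exp ((2 * Real.pi * (t : ℝ) : ℝ) * Complex.I)), by
    simp only [cliffordTorus, Set.mem_ofPred_eq, norm_mul, Complex.norm_exp_ofReal_mul_I]
    simp [abs_of_pos ha, abs_of_pos hb]⟩
  continuous_toFun := by fun_prop
  source' := by simp [torusBase]
  target' := by simp [torusBase, Complex.exp_two_pi_mul_I]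

/-! ### Matrices -/

/-- The matrix of an automorphism in a basis, as an isomorphism of groups. -/
def autMatrix {R M : Type} [CommRing R] [AddCommGroup M] [Module R M]
    (B : Module.Basis (Fin 2) R M) : (M ≃ₗ[R] M) ≃* GL (Fin 2) R :=
  (LinearMap.GeneralLinearGroup.generalLinearEquiv R M).symm.trans
    (Units.mapEquiv (LinearMap.toMatrixAlgEquiv B).toMulEquiv)

/-- `G_μ`: the matrices `g` in `GL(2, ℤ)` with `μ g = μ` for the row vector `μ = (2 2)`. -/
def Gmu : Subgroup (GL (Fin 2) ℤ) where
  carrier := {g | Matrix.vecMul ![2, 2] (g : Matrix (Fin 2) (Fin 2) ℤ) = ![2, 2]}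
  one_mem' := by simp
  mul_mem' := fun {g h} hg hh => by
    simp only [Set.mem_ofPred_eq] at hg hh ⊢
    rw [Units.val_mul, ← Matrix.vecMul_vecMul, hg, hh]
  inv_mem' := fun {g} hg => by
    simp only [Set.mem_ofPred_eq] at hg ⊢
    conv_lhs => rw [← hg]
    rw [Matrix.vecMul_vecMul, ← Units.val_mul, mul_inv_cancel, Units.val_one, Matrix.vecMul_one]

/-- The elements `g_n` of `GL(2, ℤ)`. -/
def gMat (n : ℤ) : GL (Fin 2) ℤ where
  val := !![1 - n, -n; n, 1 + n]
  inv := !![1 + n, n; -n, 1 - n]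
  val_inv := by ext i j; fin_cases i <;> fin_cases j <;> simp [Matrix.mul_apply] <;> ring
  inv_val := by ext i j; fin_cases i <;> fin_cases j <;> simp [Matrix.mul_apply] <;> ring

/-- The elements `f_n` of `GL(2, ℤ)`. -/
def fMat (n : ℤ) : GL (Fin 2) ℤ where
  val := !![1 - n, 2 - n; n, -1 + n]
  inv := !![1 - n, 2 - n; n, -1 + n]
  val_inv := by ext i j; fin_cases i <;> fin_cases j <;> simp [Matrix.mul_apply] <;> ring
  inv_val := by ext i j; fin_cases i <;> fin_cases j <;> simp [Matrix.mul_apply] <;> ring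

end LagMonodromy

end

namespace LagMonodromy

/-! ### The group `G_μ` -/

/-! The inclusion of the monodromy group in the stabilizer of `μ` is homotopy invariance of the
Maslov index. Along a Lagrangian self-isotopy the planes tangent to `φ_s(T)` over `φ_s(C)` form a
continuous family, framed by the images of the two coordinate directions of the torus. One lift of
the argument of `det²` over the whole `(s, t)`-plane shows that the index is an integer continuous
in `s`, hence constant (`exists_hasMaslovIndex_family`, `torusMaslov_H1map_loopClass`).

For the reverse inclusion every matrix of `G_μ` is realized by an isotopy. Since `g_1 = f_2 f_1`,
`g_{-1} = f_1 f_2` and `f_n = g_{n-1} f_1`, it is enough to realize `f_1` and `f_2`. All Clifford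
tori are connected by dilations (`realizes_dilation`), and a unitary rotation interchanges the two
factors, which gives `f_1` (`realizes_swap`). The essential isotopy leads from `T_{2,1}` to
`T_{1,2}` and acts by `g_{-1}` (`realizes_tube`): the fibre circles of `T_{2,1}` are turned around
the core circle `|z₁| = 2`, `z₂ = 0` by the angle `sπ`, while `ℝ⁴` is rotated by half that angle
along a conjugate-linear complex structure. The composite tori are Lagrangian for all `s`. Following
this isotopy by the swap gives `f_2`.

To read such isotopies on homology, `H₁(T)` is identified with `ℤ²` by winding numbers
(`exists_coords`). Winding numbers, corrected by a choice of angles for each point, form a cocycle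
on all paths; conversely each path equals, modulo boundaries, a standard loop plus a difference of
terms depending only on its endpoints (`pathClass_eq_segments`), and these terms vanish on cycles.

The algebra of `G_μ` rests on the four product formulas for the `g_n` and `f_n`. The presentation
follows from a normal form for words in two involutions, whose values are the pairwise distinct
elements `g_n` and `f_n`. -/

theorem mem_Gmu {g : GL (Fin 2) ℤ} : g ∈ Gmu ↔ g.1 0 0 + g.1 1 0 = 1 ∧ g.1 0 1 + g.1 1 1 = 1 := by
  change Matrix.vecMul ![2, 2] (g : Matrix (Fin 2) (Fin 2) ℤ) = ![2, 2] ↔ _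
  rw [funext_iff, Fin.forall_fin_two]
  simp only [Matrix.vecMul, dotProduct, Fin.sum_univ_two, Matrix.cons_val_zero, Matrix.cons_val_one]
  constructor <;> rintro ⟨h, h'⟩ <;> constructor <;> linarith

theorem gMat_mem (n : ℤ) : gMat n ∈ Gmu := by
  rw [mem_Gmu]; simp [gMat]

theorem fMat_mem (n : ℤ) : fMat n ∈ Gmu := by
  rw [mem_Gmu]; simp [fMat]

theorem det_gMat (n : ℤ) : (gMat n : Matrix (Fin 2) (Fin 2) ℤ).det = 1 := by
  simp [gMat, Matrix.det_fin_two]; ring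

theorem det_fMat (n : ℤ) : (fMat n : Matrix (Fin 2) (Fin 2) ℤ).det = -1 := by
  simp [fMat, Matrix.det_fin_two]; ring

theorem GL_ext {g h : GL (Fin 2) ℤ} (h00 : g.1 0 0 = h.1 0 0) (h01 : g.1 0 1 = h.1 0 1)
    (h10 : g.1 1 0 = h.1 1 0) (h11 : g.1 1 1 = h.1 1 1) : g = h := by
  apply Units.ext
  ext i j
  fin_cases i <;> fin_cases j <;> assumption

/-- Both columns have sum `1`, which makes the determinant linear: it is the difference of the two
entries of the second row. One entry and the determinant therefore fix the matrix. -/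
theorem eq_gMat_of_det {g : GL (Fin 2) ℤ} (hg : g ∈ Gmu)
    (hd : (g : Matrix (Fin 2) (Fin 2) ℤ).det = 1) : gMat (g.1 1 0) = g := by
  obtain ⟨h1, h2⟩ := mem_Gmu.1 hg
  rw [Matrix.det_fin_two] at hd
  have h00 : g.1 0 0 = 1 - g.1 1 0 := by linarith
  have h01 : g.1 0 1 = 1 - g.1 1 1 := by linarith
  rw [h00, h01] at hd
  have h11 : g.1 1 1 = 1 + g.1 1 0 := by linear_combination hd
  apply GL_ext <;> simp [gMat] <;> linarith

theorem eq_fMat_of_det {g : GL (Fin 2) ℤ} (hg : g ∈ Gmu)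
    (hd : (g : Matrix (Fin 2) (Fin 2) ℤ).det = -1) : fMat (g.1 1 0) = g := by
  obtain ⟨h1, h2⟩ := mem_Gmu.1 hg
  rw [Matrix.det_fin_two] at hd
  have h00 : g.1 0 0 = 1 - g.1 1 0 := by linarith
  have h01 : g.1 0 1 = 1 - g.1 1 1 := by linarith
  rw [h00, h01] at hd
  have h11 : g.1 1 1 = -1 + g.1 1 0 := by linear_combination hd
  apply GL_ext <;> simp [fMat] <;> linarith

theorem det_eq_one_or (g : GL (Fin 2) ℤ) :
    (g : Matrix (Fin 2) (Fin 2) ℤ).det = 1 ∨ (g : Matrix (Fin 2) (Fin 2) ℤ).det = -1 :=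
  Int.isUnit_iff.1 ((Matrix.isUnit_iff_isUnit_det _).1 g.isUnit)

theorem setOf_det_one :
    {g | g ∈ Gmu ∧ (g : Matrix (Fin 2) (Fin 2) ℤ).det = 1} = Set.range gMat := by
  ext g
  constructor
  · rintro ⟨hg, hd⟩
    exact ⟨_, eq_gMat_of_det hg hd⟩
  · rintro ⟨n, rfl⟩
    exact ⟨gMat_mem n, det_gMat n⟩

theorem setOf_det_neg_one :
    {g | g ∈ Gmu ∧ (g : Matrix (Fin 2) (Fin 2) ℤ).det = -1} = Set.range fMat := by
  ext g
  constructor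
  · rintro ⟨hg, hd⟩
    exact ⟨_, eq_fMat_of_det hg hd⟩
  · rintro ⟨n, rfl⟩
    exact ⟨fMat_mem n, det_fMat n⟩

theorem Gmu_eq_union : (Gmu : Set (GL (Fin 2) ℤ)) = Set.range gMat ∪ Set.range fMat := by
  rw [← setOf_det_one, ← setOf_det_neg_one]
  ext g
  constructor
  · intro hg
    exact (det_eq_one_or g).imp (⟨hg, ·⟩) (⟨hg, ·⟩)
  · rintro (h | h) <;> exact h.1

theorem disjoint_range : Disjoint (Set.range gMat) (Set.range fMat) := by
  rw [Set.disjoint_left]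
  rintro _ ⟨n, rfl⟩ ⟨m, hm⟩
  have := det_fMat m
  rw [hm, det_gMat] at this
  norm_num at this

theorem gMat_injective : Function.Injective gMat := fun n m h => by
  simpa [gMat] using congrArg (fun g : GL (Fin 2) ℤ => g.1 1 0) h

theorem fMat_injective : Function.Injective fMat := fun n m h => by
  simpa [fMat] using congrArg (fun g : GL (Fin 2) ℤ => g.1 1 0) h

theorem gMat_mul_gMat (n m : ℤ) : gMat n * gMat m = gMat (n + m) := by
  apply GL_ext <;> simp [gMat, Matrix.mul_apply] <;> ring

theorem gMat_mul_fMat (n m : ℤ) : gMat n * fMat m = fMat (n + m) := by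
  apply GL_ext <;> simp [gMat, fMat, Matrix.mul_apply] <;> ring

theorem fMat_mul_gMat (n m : ℤ) : fMat n * gMat m = fMat (n - m) := by
  apply GL_ext <;> simp [gMat, fMat, Matrix.mul_apply] <;> ring

theorem fMat_mul_fMat (n m : ℤ) : fMat n * fMat m = gMat (n - m) := by
  apply GL_ext <;> simp [gMat, fMat, Matrix.mul_apply] <;> ring

theorem gMat_zero : gMat 0 = 1 := by
  apply GL_ext <;> simp [gMat]

/-- The homomorphism `n ↦ g_n`. -/
def gHom : Multiplicative ℤ →* GL (Fin 2) ℤ where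
  toFun n := gMat n.toAdd
  map_one' := gMat_zero
  map_mul' _ _ := (gMat_mul_gMat _ _).symm

theorem gMat_zpow (m n : ℤ) : gMat m ^ n = gMat (n * m) := by
  have h := map_zpow gHom (Multiplicative.ofAdd m) n
  rw [← ofAdd_zsmul, smul_eq_mul] at h
  exact h.symm

theorem gMat_neg (n : ℤ) : gMat (-n) = (gMat n)⁻¹ := by
  rw [eq_inv_iff_mul_eq_one, gMat_mul_gMat, neg_add_cancel, gMat_zero]

theorem orderOf_fMat (n : ℤ) : orderOf (fMat n) = 2 := by
  apply orderOf_eq_prime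
  · rw [pow_two, fMat_mul_fMat, sub_self, gMat_zero]
  · intro h
    have := det_fMat n
    rw [h] at this
    simp at this

theorem fMat_mulVec (n : ℤ) :
    Matrix.mulVec (fMat n : Matrix (Fin 2) (Fin 2) ℤ) ![-1, 1] = -![-1, 1] := by
  ext i; fin_cases i <;> simp [fMat, Matrix.mulVec, dotProduct, Fin.sum_univ_two]

/-! ### The infinite dihedral group and the presentation by two involutions -/

theorem coe_mul_Gmu (g h : Gmu) : ((g * h : Gmu) : GL (Fin 2) ℤ) = g * h := rfl

/-- `r n ↦ g_n`, `s r^n ↦ f_{-n}`. -/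
def dihedralToGmu : DihedralGroup 0 →* Gmu where
  toFun
    | .r n => ⟨gMat n, gMat_mem n⟩
    -- The sign is forced by `sr i * sr j = r (j - i)`, whereas `f_i f_j = g_{i-j}`. `ZMod 0` is `ℤ`
    -- by definition.
    | .sr n => ⟨fMat (-(n : ℤ)), fMat_mem _⟩
  map_one' := Subtype.ext gMat_zero
  map_mul' := by
    rintro (n | n) (m | m)
    · exact Subtype.ext (gMat_mul_gMat n m).symm
    · refine Subtype.ext ((gMat_mul_fMat n (-(m : ℤ))).trans (congrArg fMat ?_)).symm
      exact (neg_sub (m : ℤ) n).symm ▸ (sub_eq_add_neg (n : ℤ) m).symm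
    · refine Subtype.ext ((fMat_mul_gMat (-(n : ℤ)) m).trans (congrArg fMat ?_)).symm
      exact (neg_add' (n : ℤ) m).symm
    · refine Subtype.ext ((fMat_mul_fMat (-(n : ℤ)) (-(m : ℤ))).trans (congrArg gMat ?_)).symm
      exact neg_sub_neg (n : ℤ) m

theorem dihedralToGmu_bijective : Function.Bijective dihedralToGmu := by
  constructor
  · rw [injective_iff_map_eq_one]
    rintro (n | n) h
    · have h2 : gMat n = gMat 0 := (congrArg Subtype.val h).trans gMat_zero.symm
      exact congrArg DihedralGroup.r (gMat_injective h2)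
    · have h2 : fMat (-(n : ℤ)) = gMat 0 := (congrArg Subtype.val h).trans gMat_zero.symm
      exact (Set.disjoint_left.1 disjoint_range ⟨0, rfl⟩ ⟨_, h2⟩).elim
  · rintro ⟨g, hg⟩
    rcases (Gmu_eq_union ▸ hg : g ∈ Set.range gMat ∪ Set.range fMat) with ⟨n, rfl⟩ | ⟨n, rfl⟩
    · exact ⟨.r n, rfl⟩
    · exact ⟨.sr (-n : ℤ), Subtype.ext (congrArg fMat (neg_neg n))⟩

/-- `G_μ` is the infinite dihedral group. -/
noncomputable def dihedralEquivGmu : DihedralGroup 0 ≃* Gmu :=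
  MulEquiv.ofBijective dihedralToGmu dihedralToGmu_bijective

/-- The group with two generators of order two and no other relation. -/
abbrev TwoInvolutions : Type :=
  PresentedGroup (Set.range fun i : Fin 2 => FreeGroup.of i ^ 2)

theorem TwoInvolutions.of_mul_self (i : Fin 2) :
    (PresentedGroup.of i : TwoInvolutions) * PresentedGroup.of i = 1 := by
  rw [← pow_two]
  exact (PresentedGroup.one_of_mem (rels := Set.range fun i : Fin 2 => FreeGroup.of i ^ 2) ⟨i, rfl⟩)

/-- Conjugation by the first involution inverts the product `q * p`. Hence the set of normal forms
contains `1` and is stable under left multiplication by both generators. -/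
theorem TwoInvolutions.exists_normal_form (x : TwoInvolutions) :
    ∃ n : ℤ, x = (PresentedGroup.of 1 * PresentedGroup.of 0) ^ n ∨
      x = (PresentedGroup.of 1 * PresentedGroup.of 0) ^ n * PresentedGroup.of 0 := by
  set p : TwoInvolutions := PresentedGroup.of 0 with hp
  set q : TwoInvolutions := PresentedGroup.of 1 with hq
  have hpp : p * p = 1 := of_mul_self 0
  have hqq : q * q = 1 := of_mul_self 1
  have hq' : q = q * p * p := by rw [mul_assoc, hpp, mul_one]
  have hp' : p = q * (q * p) := by rw [← mul_assoc, hqq, one_mul]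
  have hinv : (q * p)⁻¹ = p * q := by
    rw [mul_inv_rev, inv_eq_of_mul_eq_one_left hpp, inv_eq_of_mul_eq_one_left hqq]
  have key : ∀ n : ℤ, p * (q * p) ^ n = (q * p) ^ (-n) * p := by
    have hs : SemiconjBy p (q * p) (q * p)⁻¹ := by
      rw [hinv]; simp [SemiconjBy, mul_assoc]
    intro n
    rw [zpow_neg, ← inv_zpow]
    exact (hs.zpow_right n).eq
  let P : TwoInvolutions → Prop := fun x => ∃ n : ℤ, x = (q * p) ^ n ∨ x = (q * p) ^ n * p
  have hP : ∀ x, P x → P (p * x) := by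
    rintro _ ⟨n, rfl | rfl⟩
    · exact ⟨-n, Or.inr (key n)⟩
    · exact ⟨-n, Or.inl (by rw [← mul_assoc, key, mul_assoc, hpp, mul_one])⟩
  have hQ : ∀ x, P x → P (q * x) := by
    rintro _ ⟨n, rfl | rfl⟩
    · refine ⟨1 - n, Or.inr ?_⟩
      rw [sub_eq_add_neg, zpow_add, mul_assoc, ← key, zpow_one, ← mul_assoc, ← hq']
    · refine ⟨1 - n, Or.inl ?_⟩
      have h := key n
      rw [← mul_inv_eq_iff_eq_mul, inv_eq_of_mul_eq_one_left hpp] at h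
      rw [sub_eq_add_neg, zpow_add, zpow_one, ← h]
      simp only [← mul_assoc]
      rw [← hq']
  have hall : ∀ (i : Fin 2) (x), P x → P (PresentedGroup.of i * x) := by
    intro i
    fin_cases i
    · exact hP
    · exact hQ
  have hx : x ∈ Subgroup.closure (Set.range (PresentedGroup.of
      (rels := Set.range fun i : Fin 2 => FreeGroup.of i ^ 2))) := by
    rw [PresentedGroup.closure_range_of]; trivial
  change P x
  induction hx using Subgroup.closure_induction_left with
  | one => exact ⟨0, Or.inl (by simp)⟩
  | mul_left y hy z _ ih =>
    obtain ⟨i, rfl⟩ := hy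
    exact hall i _ ih
  | inv_mul_cancel y hy z _ ih =>
    obtain ⟨i, rfl⟩ := hy
    rw [inv_eq_of_mul_eq_one_left (of_mul_self i)]
    exact hall i _ ih

/-- The canonical map to `G_μ`. -/
def TwoInvolutions.toGmu : TwoInvolutions →* Gmu :=
  PresentedGroup.toGroup (f := ![⟨fMat 0, fMat_mem 0⟩, ⟨fMat 1, fMat_mem 1⟩]) (by
    rintro _ ⟨i, rfl⟩
    have h (n : ℤ) : (⟨fMat n, fMat_mem n⟩ : Gmu) ^ 2 = 1 :=
      Subtype.ext ((orderOf_fMat n) ▸ pow_orderOf_eq_one (fMat n) :)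
    fin_cases i
    · simpa using h 0
    · simpa using h 1)

theorem TwoInvolutions.toGmu_zero : (toGmu (PresentedGroup.of 0) : GL (Fin 2) ℤ) = fMat 0 :=
  congrArg Subtype.val (PresentedGroup.toGroup.of _)

theorem TwoInvolutions.toGmu_one : (toGmu (PresentedGroup.of 1) : GL (Fin 2) ℤ) = fMat 1 :=
  congrArg Subtype.val (PresentedGroup.toGroup.of _)

theorem TwoInvolutions.toGmu_zpow (n : ℤ) :
    (toGmu ((PresentedGroup.of 1 * PresentedGroup.of 0) ^ n) : GL (Fin 2) ℤ) = gMat n := by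
  rw [map_zpow, map_mul, Subgroup.coe_zpow, coe_mul_Gmu, toGmu_zero, toGmu_one, fMat_mul_fMat,
    gMat_zpow]
  norm_num

theorem TwoInvolutions.toGmu_zpow_mul (n : ℤ) :
    (toGmu ((PresentedGroup.of 1 * PresentedGroup.of 0) ^ n * PresentedGroup.of 0) :
      GL (Fin 2) ℤ) = fMat n := by
  rw [map_mul, coe_mul_Gmu, toGmu_zpow, toGmu_zero, gMat_mul_fMat, add_zero]

/-- The two kinds of normal forms are sent to `g_n` and `f_n`, which are pairwise distinct and
exhaust `G_μ`. -/
theorem TwoInvolutions.toGmu_bijective : Function.Bijective toGmu := by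
  constructor
  · rw [injective_iff_map_eq_one]
    intro x hx
    have hx' : (toGmu x : GL (Fin 2) ℤ) = gMat 0 := by rw [hx, gMat_zero]; rfl
    obtain ⟨n, rfl | rfl⟩ := x.exists_normal_form
    · rw [toGmu_zpow] at hx'
      rw [gMat_injective hx', zpow_zero]
    · rw [toGmu_zpow_mul] at hx'
      exact (Set.disjoint_left.1 disjoint_range ⟨0, rfl⟩ ⟨_, hx'⟩).elim
  · rintro ⟨g, hg⟩
    rcases (Gmu_eq_union ▸ hg : g ∈ Set.range gMat ∪ Set.range fMat) with ⟨n, rfl⟩ | ⟨n, rfl⟩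
    · exact ⟨_, Subtype.ext (toGmu_zpow n)⟩
    · exact ⟨_, Subtype.ext (toGmu_zpow_mul n)⟩

/-- The presentation of `G_μ`. -/
noncomputable def TwoInvolutions.equivGmu : TwoInvolutions ≃* Gmu :=
  MulEquiv.ofBijective toGmu toGmu_bijective

/-! ### Singular simplices of dimension at most two -/

section Simplices

variable {X : Type} [TopologicalSpace X]

/-- The singular `1`-simplex given by a continuous map from the unit interval. -/
noncomputable def edge (u : C(unitInterval, X)) : (TopCat.toSSet.obj (TopCat.of X)) _⦋1⦌ :=
  pathSimplex (⟨u, rfl, rfl⟩ : Path (u 0) (u 1))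

theorem edge_apply (u : C(unitInterval, X)) (z : stdSimplex ℝ (Fin 2)) :
    TopCat.toSSetObjEquiv (TopCat.of X) (.op ⦋1⦌) (edge u) z =
      u (stdSimplexHomeomorphUnitInterval z) := rfl

theorem edge_surjective (σ : (TopCat.toSSet.obj (TopCat.of X)) _⦋1⦌) : ∃ u, edge u = σ := by
  refine ⟨(TopCat.toSSetObjEquiv (TopCat.of X) (.op ⦋1⦌) σ).comp
    (toContinuousMap stdSimplexHomeomorphUnitInterval.symm), ?_⟩
  apply (TopCat.toSSetObjEquiv (TopCat.of X) (.op ⦋1⦌)).injective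
  ext z
  rw [edge_apply]
  simp

theorem edge_injective : Function.Injective (edge (X := X)) := by
  intro u v h
  ext t
  have := DFunLike.congr_fun (congrArg (TopCat.toSSetObjEquiv (TopCat.of X) (.op ⦋1⦌)) h)
    (stdSimplexHomeomorphUnitInterval.symm t)
  rw [edge_apply, edge_apply] at this
  simpa using this

/-- The singular `2`-simplex given by a continuous map from the plane. -/
noncomputable def triangle (Q : C(ℝ × ℝ, X)) : (TopCat.toSSet.obj (TopCat.of X)) _⦋2⦌ :=
  (TopCat.toSSetObjEquiv (TopCat.of X) (.op ⦋2⦌)).symm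
    ⟨fun z : stdSimplex ℝ (Fin 3) => Q (z.1 1, z.1 2), Q.continuous.comp
      (((continuous_apply 1).comp continuous_subtype_val).prodMk
        ((continuous_apply 2).comp continuous_subtype_val))⟩

theorem triangle_apply (Q : C(ℝ × ℝ, X)) (z : stdSimplex ℝ (Fin 3)) :
    TopCat.toSSetObjEquiv (TopCat.of X) (.op ⦋2⦌) (triangle Q) z = Q (z.1 1, z.1 2) := by
  rfl

/-- A retraction of the plane onto the standard `2`-simplex. -/
noncomputable def toStdSimplexTwo (q : ℝ × ℝ) : stdSimplex ℝ (Fin 3) :=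
  -- The first coordinate is clamped to `[0, 1]`, then the second to the interval that is left.
  ⟨![1 - max 0 (min 1 q.1) - max 0 (min (1 - max 0 (min 1 q.1)) q.2), max 0 (min 1 q.1),
      max 0 (min (1 - max 0 (min 1 q.1)) q.2)], by
    have h : 0 ≤ 1 - max 0 (min 1 q.1) := by simp
    refine ⟨fun i => ?_, by simp only [Fin.sum_univ_three, Matrix.cons_val]; ring⟩
    fin_cases i
    · simp [h]
    · simp
    · simp⟩

theorem continuous_toStdSimplexTwo : Continuous toStdSimplexTwo := by
  apply Continuous.subtype_mk
  refine continuous_pi fun i => ?_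
  fin_cases i
  · simp; fun_prop
  · simp; fun_prop
  · simp; fun_prop

theorem toStdSimplexTwo_apply (z : stdSimplex ℝ (Fin 3)) : toStdSimplexTwo (z.1 1, z.1 2) = z := by
  have h0 := z.2.1 0
  have h1 := z.2.1 1
  have h2 := z.2.1 2
  have h3 : z.1 0 + z.1 1 + z.1 2 = 1 := by simpa [Fin.sum_univ_three] using z.2.2
  have e1 : max 0 (min 1 (z.1 1)) = z.1 1 := by
    rw [min_eq_right (by linarith), max_eq_right h1]
  have e2 : max 0 (min (1 - z.1 1) (z.1 2)) = z.1 2 := by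
    rw [min_eq_right (by linarith), max_eq_right h2]
  apply Subtype.ext
  funext i
  fin_cases i
  · simp only [toStdSimplexTwo, e1, e2]; simp; linarith
  · simp [toStdSimplexTwo, e1]
  · simp [toStdSimplexTwo, e1, e2]

/-- Extending along the retraction allows all `2`-simplices to be treated as maps of the plane,
whose faces are given by plain formulas and which can be lifted to coverings directly. -/
theorem triangle_surjective (σ : (TopCat.toSSet.obj (TopCat.of X)) _⦋2⦌) : ∃ Q, triangle Q = σ := by
  refine ⟨(TopCat.toSSetObjEquiv (TopCat.of X) (.op ⦋2⦌) σ).comp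
    ⟨toStdSimplexTwo, continuous_toStdSimplexTwo⟩, ?_⟩
  apply (TopCat.toSSetObjEquiv (TopCat.of X) (.op ⦋2⦌)).injective
  ext z
  rw [triangle_apply]
  exact congrArg (TopCat.toSSetObjEquiv (TopCat.of X) (.op ⦋2⦌) σ) (toStdSimplexTwo_apply z)

theorem map_apply_fin_two (f : Fin 2 → Fin 3) (z : stdSimplex ℝ (Fin 2)) (j : Fin 3) :
    (stdSimplex.map f z).1 j = (if f 0 = j then z.1 0 else 0) + (if f 1 = j then z.1 1 else 0) := by
  change FunOnFinite.linearMap ℝ ℝ f z.1 j = _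
  rw [FunOnFinite.linearMap_apply_apply, Finset.sum_filter, Fin.sum_univ_two]

theorem fst_add_snd (z : stdSimplex ℝ (Fin 2)) : z.1 0 = 1 - z.1 1 := by
  have := z.2.2
  rw [Fin.sum_univ_two] at this
  exact eq_sub_of_add_eq this

/-- In the coordinates used by `triangle` the vertices `0, 1, 2` are `(0,0)`, `(1,0)`, `(0,1)`; the
face opposite to vertex `0` is the hypotenuse. -/
theorem triangle_δ_zero (Q : C(ℝ × ℝ, X)) :
    (TopCat.toSSet.obj (TopCat.of X)).δ 0 (triangle Q) =
      edge ⟨fun t => Q (1 - t, t), by fun_prop⟩ := by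
  apply (TopCat.toSSetObjEquiv (TopCat.of X) (.op ⦋1⦌)).injective
  ext z
  rw [edge_apply]
  refine (TopCat.toSSetObjEquiv_δ_apply (triangle Q) 0 z).trans ?_
  rw [triangle_apply, map_apply_fin_two, map_apply_fin_two]
  simp [fst_add_snd]

theorem triangle_δ_one (Q : C(ℝ × ℝ, X)) :
    (TopCat.toSSet.obj (TopCat.of X)).δ 1 (triangle Q) =
      edge ⟨fun t => Q (0, t), by fun_prop⟩ := by
  apply (TopCat.toSSetObjEquiv (TopCat.of X) (.op ⦋1⦌)).injective
  ext z
  rw [edge_apply]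
  refine (TopCat.toSSetObjEquiv_δ_apply (triangle Q) 1 z).trans ?_
  rw [triangle_apply, map_apply_fin_two, map_apply_fin_two]
  simp [Fin.succAbove]

theorem triangle_δ_two (Q : C(ℝ × ℝ, X)) :
    (TopCat.toSSet.obj (TopCat.of X)).δ 2 (triangle Q) =
      edge ⟨fun t => Q (t, 0), by fun_prop⟩ := by
  apply (TopCat.toSSetObjEquiv (TopCat.of X) (.op ⦋1⦌)).injective
  ext z
  rw [edge_apply]
  refine (TopCat.toSSetObjEquiv_δ_apply (triangle Q) 2 z).trans ?_
  rw [triangle_apply, map_apply_fin_two, map_apply_fin_two]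
  simp [Fin.succAbove]

/-- The singular `0`-simplex given by a point. -/
noncomputable def vertex (x : X) : (TopCat.toSSet.obj (TopCat.of X)) _⦋0⦌ :=
  TopCat.toSSetObj₀Equiv.symm x

theorem vertex_surjective (σ : (TopCat.toSSet.obj (TopCat.of X)) _⦋0⦌) : ∃ x, vertex x = σ :=
  TopCat.toSSetObj₀Equiv.symm.surjective σ

theorem vertex_injective : Function.Injective (vertex (X := X)) :=
  (TopCat.toSSetObj₀Equiv (X := TopCat.of X)).symm.injective

theorem edge_δ_zero (u : C(unitInterval, X)) :
    (TopCat.toSSet.obj (TopCat.of X)).δ 0 (edge u) = vertex (u 1) :=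
  TopCat.δ_zero_toSSetObj₁Equiv.symm _

theorem edge_δ_one (u : C(unitInterval, X)) :
    (TopCat.toSSet.obj (TopCat.of X)).δ 1 (edge u) = vertex (u 0) :=
  TopCat.δ_one_toSSetObj₁Equiv.symm _

theorem toSSet_map_edge {Y : Type} [TopologicalSpace Y] (f : C(X, Y)) (u : C(unitInterval, X)) :
    (TopCat.toSSet.map (TopCat.ofHom f)).app _ (edge u) = edge (f.comp u) := by
  apply (TopCat.toSSetObjEquiv (TopCat.of Y) (.op ⦋1⦌)).injective
  rfl

end Simplices

/-! ### Singular chains and chains modulo boundaries -/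

section Chains

variable (X : Type) [TopologicalSpace X]

/-- The singular chain complex with integer coefficients. -/
noncomputable abbrev chains : ChainComplex (ModuleCat.{0} ℤ) ℕ :=
  (TopCat.toSSet.obj (TopCat.of X)).chainComplex (ModuleCat.of ℤ ℤ)

/-- Singular `1`-chains modulo boundaries. -/
noncomputable abbrev H1Op : ModuleCat.{0} ℤ := (chains X).opcycles 1

variable {X}

/-- The chain consisting of one simplex. -/
noncomputable def single {n : ℕ} (σ : (TopCat.toSSet.obj (TopCat.of X)) _⦋n⦌) : (chains X).X n :=
  ((TopCat.toSSet.obj (TopCat.of X)).ιChainComplex (R := ModuleCat.of ℤ ℤ) σ).hom (1 : ℤ)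

theorem ιChainComplex_hom_ext {n : ℕ} {A : ModuleCat.{0} ℤ} {f g : (chains X).X n ⟶ A}
    (h : ∀ σ, f.hom (single σ) = g.hom (single σ)) : f = g := by
  apply SSet.chainComplex_hom_ext
  intro σ
  apply ModuleCat.hom_ext
  apply LinearMap.ext_ring
  exact h σ

/-- The homomorphism on chains with given values on simplices. -/
noncomputable def chainLift {n : ℕ} {A : ModuleCat.{0} ℤ}
    (f : (TopCat.toSSet.obj (TopCat.of X)) _⦋n⦌ → A) : (chains X).X n ⟶ A :=
  Limits.Cofan.IsColimit.desc
    ((TopCat.toSSet.obj (TopCat.of X)).isColimitChainComplexXCofan (ModuleCat.of ℤ ℤ) n)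
    (fun σ => ModuleCat.ofHom (LinearMap.toSpanSingleton ℤ A (f σ)))

theorem chainLift_single {n : ℕ} {A : ModuleCat.{0} ℤ}
    (f : (TopCat.toSSet.obj (TopCat.of X)) _⦋n⦌ → A) (σ) :
    (chainLift f).hom (single σ) = f σ := by
  have h := Limits.Cofan.IsColimit.fac
    ((TopCat.toSSet.obj (TopCat.of X)).isColimitChainComplexXCofan (ModuleCat.of ℤ ℤ) n)
    (fun σ => ModuleCat.ofHom (LinearMap.toSpanSingleton ℤ A (f σ))) σ
  have h2 := congrArg (fun k => k.hom (1 : ℤ)) h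
  exact h2.trans (LinearMap.toSpanSingleton_apply_one ℤ A (f σ))

theorem d_single_edge (u : C(unitInterval, X)) :
    ((chains X).d 1 0).hom (single (edge u)) = single (vertex (u 1)) - single (vertex (u 0)) := by
  have h := (TopCat.toSSet.obj (TopCat.of X)).ιChainComplex_d (R := ModuleCat.of ℤ ℤ) (edge u)
  have h2 := congrArg (fun k => k.hom (1 : ℤ)) h
  refine Eq.trans h2 ?_
  rw [Fin.sum_univ_two, edge_δ_zero, edge_δ_one]
  simp [single, sub_eq_add_neg]

theorem d_single_triangle (Q : C(ℝ × ℝ, X)) :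
    ((chains X).d 2 1).hom (single (triangle Q)) =
      single (edge ⟨fun t => Q (1 - t, t), by fun_prop⟩)
        - single (edge ⟨fun t => Q (0, t), by fun_prop⟩)
        + single (edge ⟨fun t => Q (t, 0), by fun_prop⟩) := by
  have h := (TopCat.toSSet.obj (TopCat.of X)).ιChainComplex_d (R := ModuleCat.of ℤ ℤ) (triangle Q)
  have h2 := congrArg (fun k => k.hom (1 : ℤ)) h
  refine Eq.trans h2 ?_
  rw [Fin.sum_univ_three, triangle_δ_zero, triangle_δ_one, triangle_δ_two]
  simp [single, sub_eq_add_neg]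

/-- The class of a path modulo boundaries. -/
noncomputable def pathClass (u : C(unitInterval, X)) : H1Op X :=
  ((chains X).pOpcycles 1).hom (single (edge u))

theorem pathClass_triangle (Q : C(ℝ × ℝ, X)) :
    pathClass ⟨fun t => Q (t, 0), by fun_prop⟩ + pathClass ⟨fun t => Q (1 - t, t), by fun_prop⟩ =
      pathClass ⟨fun t => Q (0, t), by fun_prop⟩ := by
  have h : (chains X).d 2 1 ≫ (chains X).pOpcycles 1 = 0 := HomologicalComplex.d_pOpcycles _ _ _
  have h2 := congrArg (fun k => k.hom (single (triangle Q))) h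
  have h3 : ((chains X).pOpcycles 1).hom (((chains X).d 2 1).hom (single (triangle Q))) = 0 := h2
  rw [d_single_triangle, map_add, map_sub] at h3
  simp only [pathClass]
  rw [← sub_eq_zero, ← h3]
  abel

/-- The inclusion of the homology in the chains modulo boundaries. -/
noncomputable def toH1Op : H1 X →ₗ[ℤ] H1Op X := ((chains X).homologyι 1).hom

/-- Equalities of homology classes can thus be checked modulo boundaries, where every path has a
class and not only loops. This permits cutting loops into pieces. -/
theorem toH1Op_injective : Function.Injective (toH1Op (X := X)) :=
  (ModuleCat.mono_iff_injective ((chains X).homologyι 1)).1 inferInstance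

theorem toH1Op_loopClass {x : X} (p : Path x x) :
    toH1Op (loopClass p) = pathClass p.toContinuousMap := by
  have h : ((chains X).liftCycles ((TopCat.toSSet.obj (TopCat.of X)).ιChainComplex
      (R := ModuleCat.of ℤ ℤ) (pathSimplex p)) 0 (by simp) (pathSimplex_cycle p) ≫
      (chains X).homologyπ 1) ≫ (chains X).homologyι 1 =
      (TopCat.toSSet.obj (TopCat.of X)).ιChainComplex (pathSimplex p) ≫ (chains X).pOpcycles 1 := by
    rw [Category.assoc, HomologicalComplex.homology_π_ι, HomologicalComplex.liftCycles_i_assoc]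
  exact congrArg (fun k => k.hom (1 : ℤ)) h

/-- The homomorphism on chains modulo boundaries given by a cocycle. -/
theorem exists_cocycle_lift {A : Type} [AddCommGroup A] (f : C(unitInterval, X) → A)
    (hf : ∀ Q : C(ℝ × ℝ, X), f ⟨fun t => Q (t, 0), by fun_prop⟩ +
      f ⟨fun t => Q (1 - t, t), by fun_prop⟩ = f ⟨fun t => Q (0, t), by fun_prop⟩) :
    ∃ F : H1Op X →ₗ[ℤ] A, ∀ u, F (pathClass u) = f u := by
  let g : (TopCat.toSSet.obj (TopCat.of X)) _⦋1⦌ → ModuleCat.of ℤ A :=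
    fun σ => f (edge_surjective σ).choose
  -- The chosen preimage is the right one because `edge` is injective.
  have hg : ∀ u, g (edge u) = f u := fun u =>
    congrArg f (edge_injective (edge_surjective (edge u)).choose_spec)
  have hk : (chains X).d 2 1 ≫ chainLift g = 0 := by
    apply ιChainComplex_hom_ext
    intro σ
    obtain ⟨Q, rfl⟩ := triangle_surjective σ
    change (chainLift g).hom (((chains X).d 2 1).hom (single (triangle Q))) = 0
    rw [d_single_triangle, map_add, map_sub, chainLift_single, chainLift_single,
      chainLift_single, hg, hg, hg]
    have h := hf Q
    change f _ - f _ + f _ = (0 : A)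
    rw [← h]; abel
  refine ⟨((chains X).descOpcycles (chainLift g) 2 (by simp) hk).hom, fun u => ?_⟩
  have h := (chains X).p_descOpcycles (chainLift g) 2 (by simp) hk
  have h2 := congrArg (fun k => k.hom (single (edge u))) h
  refine Eq.trans h2 ?_
  rw [chainLift_single, hg]

/-- The hypothesis decomposes the projection of `1`-chains as `φ` after `N` plus the coboundary of
`b`. The second term factors through the differential and so disappears on cycles. -/
theorem toH1Op_mem_range {A : Type} [AddCommGroup A] (N : C(unitInterval, X) → A)
    (φ : A →ₗ[ℤ] H1Op X) (b : X → H1Op X)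
    (h : ∀ u, pathClass u = φ (N u) + (b (u 1) - b (u 0))) (x : H1 X) :
    ∃ y, toH1Op x = φ y := by
  obtain ⟨z, rfl⟩ := (ModuleCat.epi_iff_surjective ((chains X).homologyπ 1)).1 inferInstance x
  let g : (TopCat.toSSet.obj (TopCat.of X)) _⦋1⦌ → ModuleCat.of ℤ A :=
    fun σ => N (edge_surjective σ).choose
  have hg : ∀ u, g (edge u) = N u := fun u =>
    congrArg N (edge_injective (edge_surjective (edge u)).choose_spec)
  let b' : (TopCat.toSSet.obj (TopCat.of X)) _⦋0⦌ → H1Op X :=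
    fun σ => b (vertex_surjective σ).choose
  have hb : ∀ x, b' (vertex x) = b x := fun x =>
    congrArg b (vertex_injective (vertex_surjective (vertex x)).choose_spec)
  have key : (chains X).pOpcycles 1 =
      chainLift g ≫ ModuleCat.ofHom φ + (chains X).d 1 0 ≫ chainLift b' := by
    apply ιChainComplex_hom_ext
    intro σ
    obtain ⟨u, rfl⟩ := edge_surjective σ
    change pathClass u = φ ((chainLift g).hom (single (edge u))) +
      (chainLift b').hom (((chains X).d 1 0).hom (single (edge u)))
    rw [d_single_edge, map_sub, chainLift_single, chainLift_single, chainLift_single, hg, hb, hb, h]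
  have key2 : (chains X).homologyπ 1 ≫ (chains X).homologyι 1 =
      (chains X).iCycles 1 ≫ chainLift g ≫ ModuleCat.ofHom φ := by
    rw [HomologicalComplex.homology_π_ι, key, Preadditive.comp_add,
      HomologicalComplex.iCycles_d_assoc, Limits.zero_comp, add_zero]
  exact ⟨_, congrArg (fun k => k.hom z) key2⟩

/-- Naturality of the maps from homology and from chains to chains modulo boundaries reduces the
claim to the image of a single simplex. -/
theorem H1map_loopClass {Y : Type} [TopologicalSpace Y] (f : C(X, Y)) {x : X} (p : Path x x) :
    H1map f (loopClass p) = loopClass (p.map f.continuous) := by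
  apply toH1Op_injective
  rw [toH1Op_loopClass]
  have h : (HomologicalComplex.homologyMap (SSet.chainComplexMap
      (TopCat.toSSet.map (TopCat.ofHom f)) (ModuleCat.of ℤ ℤ)) 1) ≫ (chains Y).homologyι 1 =
      (chains X).homologyι 1 ≫ HomologicalComplex.opcyclesMap (SSet.chainComplexMap
        (TopCat.toSSet.map (TopCat.ofHom f)) (ModuleCat.of ℤ ℤ)) 1 :=
    HomologicalComplex.homologyι_naturality _ _
  have h2 := congrArg (fun k => k.hom (loopClass p)) h
  refine Eq.trans h2 ?_
  change (HomologicalComplex.opcyclesMap (SSet.chainComplexMap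
        (TopCat.toSSet.map (TopCat.ofHom f)) (ModuleCat.of ℤ ℤ)) 1).hom
        (toH1Op (loopClass p)) = _
  rw [toH1Op_loopClass]
  have h3 := HomologicalComplex.p_opcyclesMap (SSet.chainComplexMap
        (TopCat.toSSet.map (TopCat.ofHom f)) (ModuleCat.of ℤ ℤ)) 1
  have h4 := congrArg (fun k => k.hom (single (edge p.toContinuousMap))) h3
  refine Eq.trans h4 ?_
  have h5 := SSet.ι_chainComplexMap_f _ _ (TopCat.toSSet.map (TopCat.ofHom f)) (ModuleCat.of ℤ ℤ)
    (edge p.toContinuousMap)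
  have h6 := congrArg (fun k => ((chains Y).pOpcycles 1).hom (k.hom (1 : ℤ))) h5
  refine Eq.trans h6 ?_
  rw [toSSet_map_edge]
  rfl

end Chains

/-! ### Classes of paths that factor through the plane -/

section Segments

variable {X : Type} [TopologicalSpace X]

/-- The restriction of a map from the plane to a segment. -/
noncomputable def segment (G : C(ℝ × ℝ, X)) (A B : ℝ × ℝ) : C(unitInterval, X) :=
  ⟨fun t => G (A + (t : ℝ) • (B - A)), by fun_prop⟩

theorem segment_apply (G : C(ℝ × ℝ, X)) (A B : ℝ × ℝ) (t : unitInterval) :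
    segment G A B t = G (A + (t : ℝ) • (B - A)) := rfl

/-- The relation is the boundary of the affine triangle `A`, `B`, `C`, mapped by `G`. -/
theorem pathClass_segment_add (G : C(ℝ × ℝ, X)) (A B C : ℝ × ℝ) :
    pathClass (segment G A B) + pathClass (segment G B C) = pathClass (segment G A C) := by
  have h := pathClass_triangle
    (⟨fun q => G (A + q.1 • (B - A) + q.2 • (C - A)), by fun_prop⟩ : C(ℝ × ℝ, X))
  convert! h using 2
  · congr 1; ext t; simp [segment_apply]
  · congr 1; ext t
    refine congrArg G ?_
    simp only
    module
  · ext t; simp [segment_apply]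

theorem pathClass_segment_self (G : C(ℝ × ℝ, X)) (A : ℝ × ℝ) :
    pathClass (segment G A A) = 0 := by
  simpa using pathClass_segment_add G A A A

theorem pathClass_const (x : X) : pathClass (ContinuousMap.const _ x) = 0 :=
  pathClass_segment_self (ContinuousMap.const _ x) 0

theorem pathClass_segment_symm (G : C(ℝ × ℝ, X)) (A B : ℝ × ℝ) :
    pathClass (segment G B A) = - pathClass (segment G A B) := by
  rw [eq_neg_iff_add_eq_zero, pathClass_segment_add, pathClass_segment_self]

/-- A path in the plane is homotopic to a segment. -/
theorem pathClass_comp_eq_segment (G : C(ℝ × ℝ, X)) (v : C(unitInterval, ℝ × ℝ)) :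
    pathClass (G.comp v) = pathClass (segment G (v 0) (v 1)) := by
  let e : ℝ → ℝ × ℝ := Set.IccExtend zero_le_one v
  have he : Continuous e := v.continuous.Icc_extend'
  have he' : ∀ t : unitInterval, e t = v t := fun t => Set.IccExtend_val _ _ _
  have e0 : e 0 = v 0 := he' 0
  have e1 : e 1 = v 1 := he' 1
  -- On the unit square `H` is the segment on the bottom side, the given path on the top side, and
  -- constant on the two vertical sides. Both ways around the square have the class of its diagonal.
  let H : C(ℝ × ℝ, X) :=
    ⟨fun q => G ((1 - q.2) • (v 0 + q.1 • (v 1 - v 0)) + q.2 • e q.1), by fun_prop⟩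
  have h1 := pathClass_segment_add H (0, 0) (0, 1) (1, 1)
  have h2 := pathClass_segment_add H (0, 0) (1, 0) (1, 1)
  have s1 : segment H (0, 0) (0, 1) = ContinuousMap.const _ (G (v 0)) := by
    ext t
    simp only [segment_apply, H, ContinuousMap.coe_mk, ContinuousMap.const_apply]
    simp [e0]
    rw [← add_smul, sub_add_cancel, one_smul]
  have s2 : segment H (1, 0) (1, 1) = ContinuousMap.const _ (G (v 1)) := by
    ext t
    simp only [segment_apply, H, ContinuousMap.coe_mk, ContinuousMap.const_apply]
    simp [e1]
    congr 1
    module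
  have s3 : segment H (0, 1) (1, 1) = G.comp v := by
    ext t
    simp [segment_apply, H, he']
  have s4 : segment H (0, 0) (1, 0) = segment G (v 0) (v 1) := by
    ext t
    simp [segment_apply, H]
  rw [s1, s3, pathClass_const, zero_add] at h1
  rw [s2, s4, pathClass_const, add_zero] at h2
  rw [h1, h2]

end Segments

/-! ### The universal covering of the torus -/

/-- This is the source of all rigidity below: differences of lifted angles, divided by `2π`, are
continuous and integer valued. -/
theorem eq_of_continuous_of_int {Y : Type*} [TopologicalSpace Y] [PreconnectedSpace Y] {f : Y → ℝ}
    (hf : Continuous f) (h : ∀ y, ∃ n : ℤ, f y = n) (x y : Y) : f x = f y := by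
  choose k hk using h
  have hk' : f = (fun n : ℤ => (n : ℝ)) ∘ k := funext hk
  have hc : Continuous k := by
    rw [Int.isClosedEmbedding_coe_real.isEmbedding.continuous_iff, ← hk']
    exact hf
  rw [hk, hk, PreconnectedSpace.constant inferInstance hc]

/-- The point with given angles. -/
noncomputable def angles (a b : ℝ) (q : ℝ × ℝ) : ℂ × ℂ :=
  ((a : ℂ) * Complex.exp ((q.1 : ℂ) * Complex.I), (b : ℂ) * Complex.exp ((q.2 : ℂ) * Complex.I))

@[fun_prop]
theorem continuous_angles (a b : ℝ) : Continuous (angles a b) := by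
  unfold angles; fun_prop

theorem angles_mem {a b : ℝ} (ha : 0 < a) (hb : 0 < b) (q : ℝ × ℝ) :
    angles a b q ∈ cliffordTorus a b := by
  constructor
  · simp [angles, Complex.norm_exp_ofReal_mul_I, abs_of_pos ha]
  · simp [angles, Complex.norm_exp_ofReal_mul_I, abs_of_pos hb]

theorem exp_mul_I_eq_iff {x y : ℝ} :
    Complex.exp ((x : ℂ) * Complex.I) = Complex.exp ((y : ℂ) * Complex.I) ↔
      ∃ n : ℤ, x = y + 2 * Real.pi * n := by
  rw [Complex.exp_eq_exp_iff_exists_int]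
  refine exists_congr fun n => ?_
  rw [show (y : ℂ) * Complex.I + n * (2 * Real.pi * Complex.I) =
    ((y + 2 * Real.pi * n : ℝ) : ℂ) * Complex.I by push_cast; ring]
  rw [mul_left_inj' Complex.I_ne_zero, Complex.ofReal_inj]

theorem angles_eq_iff {a b : ℝ} (ha : 0 < a) (hb : 0 < b) {q r : ℝ × ℝ} :
    angles a b q = angles a b r ↔
      (∃ n : ℤ, q.1 = r.1 + 2 * Real.pi * n) ∧ ∃ n : ℤ, q.2 = r.2 + 2 * Real.pi * n := by
  rw [angles, angles, Prod.mk.injEq, mul_right_inj' (by exact_mod_cast ha.ne'),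
    mul_right_inj' (by exact_mod_cast hb.ne'), exp_mul_I_eq_iff, exp_mul_I_eq_iff]

/-- The exponential `ℝ → S¹` is a covering, so maps from simply connected, locally path connected
spaces lift. -/
theorem exists_angle_lift {Y : Type} [TopologicalSpace Y] [SimplyConnectedSpace Y]
    [LocallyPathConnectedSpace Y] {f : Y → ℂ} (hf : Continuous f) (h : ∀ y, ‖f y‖ = 1) :
    ∃ θ : C(Y, ℝ), ∀ y, Complex.exp ((θ y : ℂ) * Complex.I) = f y := by
  let g : C(Y, Circle) := ⟨fun y => ⟨f y, by simp [Submonoid.unitSphere, h]⟩, by fun_prop⟩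
  obtain ⟨y₀⟩ : Nonempty Y := inferInstance
  obtain ⟨θ₀, hθ₀⟩ := Circle.exp_surjective (g y₀)
  obtain ⟨θ, ⟨-, hθ⟩, -⟩ := Circle.isCoveringMap_exp.existsUnique_continuousMap_lifts g y₀ θ₀ hθ₀
  refine ⟨θ, fun y => ?_⟩
  have := congrArg (fun z : Circle => (z : ℂ)) (congrFun hθ y)
  exact (Circle.coe_exp _).symm.trans this

theorem exists_lift {a b : ℝ} (ha : 0 < a) (hb : 0 < b) {Y : Type} [TopologicalSpace Y]
    [SimplyConnectedSpace Y] [LocallyPathConnectedSpace Y] (f : C(Y, cliffordTorus a b)) :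
    ∃ v : C(Y, ℝ × ℝ), ∀ y, angles a b (v y) = f y := by
  obtain ⟨α, hα⟩ := exists_angle_lift (f := fun y => (f y).1.1 / (a : ℂ)) (by fun_prop)
    (fun y => by
      rw [norm_div, (f y).2.1, Complex.norm_real, Real.norm_of_nonneg ha.le, div_self ha.ne'])
  obtain ⟨β, hβ⟩ := exists_angle_lift (f := fun y => (f y).1.2 / (b : ℂ)) (by fun_prop)
    (fun y => by
      rw [norm_div, (f y).2.2, Complex.norm_real, Real.norm_of_nonneg hb.le, div_self hb.ne'])
  refine ⟨α.prodMk β, fun y => ?_⟩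
  have ha' : (a : ℂ) ≠ 0 := by exact_mod_cast ha.ne'
  have hb' : (b : ℂ) ≠ 0 := by exact_mod_cast hb.ne'
  apply Prod.ext
  · change (a : ℂ) * Complex.exp ((α y : ℂ) * Complex.I) = _
    rw [hα]
    field_simp
  · change (b : ℂ) * Complex.exp ((β y : ℂ) * Complex.I) = _
    rw [hβ]
    field_simp

theorem exists_path_lift {a b : ℝ} (ha : 0 < a) (hb : 0 < b)
    (f : C(unitInterval, cliffordTorus a b)) :
    ∃ v : C(unitInterval, ℝ × ℝ), ∀ t, angles a b (v t) = f t := by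
  -- The path is extended to `ℝ` by constants, lifted there and restricted again.
  obtain ⟨v, hv⟩ := exists_lift ha hb (f.comp ⟨Set.projIcc (0 : ℝ) 1 zero_le_one,
    continuous_projIcc⟩)
  refine ⟨v.comp ⟨Subtype.val, continuous_subtype_val⟩, fun t => ?_⟩
  refine (hv t).trans ?_
  simp

/-- The covering map of the torus. -/
noncomputable def torusCover {a b : ℝ} (ha : 0 < a) (hb : 0 < b) : C(ℝ × ℝ, cliffordTorus a b) :=
  ⟨fun q => ⟨angles a b q, angles_mem ha hb q⟩, by fun_prop⟩

theorem torusCover_surjective {a b : ℝ} (ha : 0 < a) (hb : 0 < b) :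
    Function.Surjective (torusCover ha hb) := by
  intro x
  obtain ⟨v, hv⟩ := exists_path_lift ha hb (ContinuousMap.const _ x)
  exact ⟨v 0, Subtype.ext (hv 0)⟩

theorem lift_sub_eq {a b : ℝ} (ha : 0 < a) (hb : 0 < b) {v w : C(unitInterval, ℝ × ℝ)}
    (h : ∀ t, angles a b (v t) = angles a b (w t)) : v 1 - v 0 = w 1 - w 0 := by
  simp_rw [angles_eq_iff ha hb] at h
  have hpi : (2 * Real.pi) ≠ 0 := by positivity
  have h1 := eq_of_continuous_of_int (f := fun t => ((v t).1 - (w t).1) / (2 * Real.pi))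
    (by fun_prop) (fun t => by
      obtain ⟨n, hn⟩ := (h t).1
      exact ⟨n, by rw [hn]; field_simp; ring⟩) 0 1
  have h2 := eq_of_continuous_of_int (f := fun t => ((v t).2 - (w t).2) / (2 * Real.pi))
    (by fun_prop) (fun t => by
      obtain ⟨n, hn⟩ := (h t).2
      exact ⟨n, by rw [hn]; field_simp; ring⟩) 0 1
  rw [div_left_inj' hpi] at h1 h2
  apply Prod.ext
  · simp only [Prod.fst_sub]; linarith
  · simp only [Prod.snd_sub]; linarith

/-! ### The first homology of the torus by winding numbers -/

section TorusHomology

variable {a b : ℝ} (ha : 0 < a) (hb : 0 < b)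

/-- A choice of angles of a point of the torus. -/
noncomputable def torusSection (x : cliffordTorus a b) : ℝ × ℝ :=
  (torusCover_surjective ha hb x).choose

theorem torusCover_section (x : cliffordTorus a b) : torusCover ha hb (torusSection ha hb x) = x :=
  (torusCover_surjective ha hb x).choose_spec

/-- The vector of the lattice `2π ℤ²` with given coordinates. -/
noncomputable def period (n : ℤ × ℤ) : ℝ × ℝ := (2 * Real.pi * n.1, 2 * Real.pi * n.2)

theorem period_add (n m : ℤ × ℤ) : period (n + m) = period n + period m := by
  simp [period, mul_add]

theorem period_injective : Function.Injective period := by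
  rintro ⟨n, m⟩ ⟨n', m'⟩ h
  simpa [period, Real.pi_ne_zero] using h

theorem torusCover_eq_iff {q r : ℝ × ℝ} :
    torusCover ha hb q = torusCover ha hb r ↔ ∃ n, q = r + period n := by
  rw [Subtype.ext_iff]
  change angles a b q = angles a b r ↔ _
  rw [angles_eq_iff ha hb]
  constructor
  · rintro ⟨⟨n, hn⟩, m, hm⟩
    exact ⟨(n, m), Prod.ext hn hm⟩
  · rintro ⟨n, rfl⟩
    exact ⟨⟨n.1, rfl⟩, n.2, rfl⟩

theorem torusCover_add_period (q : ℝ × ℝ) (n : ℤ × ℤ) :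
    torusCover ha hb (q + period n) = torusCover ha hb q :=
  (torusCover_eq_iff ha hb).2 ⟨n, rfl⟩

/-- The increment of a lift is a period only for closed paths. Subtracting the increment of an
arbitrary, not necessarily continuous, section makes it a period for all paths. It does not depend
on the lift, since two lifts differ by a constant. -/
theorem exists_winding (u : C(unitInterval, cliffordTorus a b)) :
    ∃ n : ℤ × ℤ, ∀ v : C(unitInterval, ℝ × ℝ), (∀ t, torusCover ha hb (v t) = u t) →
      v 1 - v 0 = period n + (torusSection ha hb (u 1) - torusSection ha hb (u 0)) := by
  obtain ⟨w, hw⟩ := exists_path_lift ha hb u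
  have hw' : ∀ t, torusCover ha hb (w t) = u t := fun t => Subtype.ext (hw t)
  obtain ⟨n, hn⟩ := (torusCover_eq_iff ha hb).1
    ((hw' 0).trans (torusCover_section ha hb (u 0)).symm)
  obtain ⟨m, hm⟩ := (torusCover_eq_iff ha hb).1
    ((hw' 1).trans (torusCover_section ha hb (u 1)).symm)
  refine ⟨m - n, fun v hv => ?_⟩
  rw [lift_sub_eq ha hb (v := v) (w := w) fun t =>
    congrArg Subtype.val ((hv t).trans (hw' t).symm), hm, hn, eq_comm,
    show m = (m - n) + n by abel, period_add]
  simp only [sub_add_cancel]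
  abel

/-- The winding numbers of a path, with endpoints normalized by a section of the covering. -/
noncomputable def winding (u : C(unitInterval, cliffordTorus a b)) : ℤ × ℤ :=
  (exists_winding ha hb u).choose

theorem winding_spec (u : C(unitInterval, cliffordTorus a b)) (v : C(unitInterval, ℝ × ℝ))
    (hv : ∀ t, torusCover ha hb (v t) = u t) : v 1 - v 0 = period (winding ha hb u) +
      (torusSection ha hb (u 1) - torusSection ha hb (u 0)) :=
  (exists_winding ha hb u).choose_spec v hv

/-- A lift of `Q` to the plane lifts its three sides simultaneously; their increments add up and the
section terms telescope. -/
theorem winding_triangle (Q : C(ℝ × ℝ, cliffordTorus a b)) :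
    winding ha hb ⟨fun t => Q (t, 0), by fun_prop⟩ +
      winding ha hb ⟨fun t => Q (1 - t, t), by fun_prop⟩ =
    winding ha hb ⟨fun t => Q (0, t), by fun_prop⟩ := by
  obtain ⟨v, hv⟩ := exists_lift ha hb Q
  have hv' : ∀ q, torusCover ha hb (v q) = Q q := fun t => Subtype.ext (hv t)
  have h1 := winding_spec ha hb ⟨fun t => Q (t, 0), by fun_prop⟩
    ⟨fun t => v (t, 0), by fun_prop⟩ fun t => hv' _
  have h2 := winding_spec ha hb ⟨fun t => Q (1 - t, t), by fun_prop⟩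
    ⟨fun t => v (1 - t, t), by fun_prop⟩ fun t => hv' _
  have h3 := winding_spec ha hb ⟨fun t => Q (0, t), by fun_prop⟩
    ⟨fun t => v (0, t), by fun_prop⟩ fun t => hv' _
  simp only [ContinuousMap.coe_mk, Set.Icc.coe_zero, Set.Icc.coe_one, sub_zero, sub_self]
    at h1 h2 h3
  apply period_injective
  rw [period_add, eq_sub_of_add_eq h1.symm, eq_sub_of_add_eq h2.symm, eq_sub_of_add_eq h3.symm]
  abel

theorem segment_add_period (A B : ℝ × ℝ) (n : ℤ × ℤ) :
    segment (torusCover ha hb) (A + period n) (B + period n) = segment (torusCover ha hb) A B := by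
  ext1 t
  rw [segment_apply, segment_apply, add_sub_add_right_eq_sub, add_right_comm,
    torusCover_add_period]

/-- A lift of the path may be replaced by a straight segment and translated by a period so that it
starts at the chosen angles of its initial point. The segment is then exchanged for a polygon
through `0` and the period of the winding numbers; its last side is a translate of a segment
starting at `0`. -/
theorem pathClass_eq_segments (u : C(unitInterval, cliffordTorus a b)) :
    pathClass u = pathClass (segment (torusCover ha hb) 0 (period (winding ha hb u))) +
      (pathClass (segment (torusCover ha hb) 0 (torusSection ha hb (u 1))) -
        pathClass (segment (torusCover ha hb) 0 (torusSection ha hb (u 0)))) := by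
  obtain ⟨v, hv⟩ := exists_path_lift ha hb u
  have hv' : ∀ t, torusCover ha hb (v t) = u t := fun t => Subtype.ext (hv t)
  have hu : u = (torusCover ha hb).comp v := ContinuousMap.ext fun t => (hv' t).symm
  obtain ⟨n, hn⟩ := (torusCover_eq_iff ha hb).1
    ((hv' 0).trans (torusCover_section ha hb (u 0)).symm)
  have h1 : v 1 = (torusSection ha hb (u 1) + period (winding ha hb u)) + period n := by
    have := winding_spec ha hb u v hv'
    rw [hn, sub_eq_iff_eq_add] at this
    rw [this]; abel
  have h2 : segment (torusCover ha hb) (period (winding ha hb u))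
      (torusSection ha hb (u 1) + period (winding ha hb u)) =
      segment (torusCover ha hb) 0 (torusSection ha hb (u 1)) := by
    rw [← segment_add_period ha hb 0 _ (winding ha hb u), zero_add]
  have h3 : pathClass u = pathClass (segment (torusCover ha hb) (v 0) (v 1)) := by
    conv_lhs => rw [hu, pathClass_comp_eq_segment]
  rw [h3, hn, h1, segment_add_period, ← h2,
    ← pathClass_segment_add _ (torusSection ha hb (u 0)) 0, pathClass_segment_symm,
    ← pathClass_segment_add _ 0 (period (winding ha hb u))
      (torusSection ha hb (u 1) + period (winding ha hb u))]
  abel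

theorem periodClass_add (n m : ℤ × ℤ) :
    pathClass (segment (torusCover ha hb) 0 (period (n + m))) =
      pathClass (segment (torusCover ha hb) 0 (period n)) +
        pathClass (segment (torusCover ha hb) 0 (period m)) := by
  rw [period_add, ← pathClass_segment_add _ 0 (period n)]
  have h := segment_add_period ha hb 0 (period m) n
  rw [zero_add, add_comm] at h
  rw [h]

/-- The class of the loops with given winding numbers. -/
noncomputable def periodClass : ℤ × ℤ →ₗ[ℤ] H1Op (cliffordTorus a b) where
  toFun n := pathClass (segment (torusCover ha hb) 0 (period n))
  map_add' := periodClass_add ha hb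
  map_smul' k n := by
    have h := map_intCast_smul (AddMonoidHom.mk'
      (fun n => pathClass (segment (torusCover ha hb) 0 (period n)))
      (periodClass_add ha hb)) ℤ ℤ k n
    simpa using h

/-- The two winding numbers of a homology class. -/
theorem exists_coords : ∃ F : H1 (cliffordTorus a b) ≃ₗ[ℤ] ℤ × ℤ,
    ∀ (x : cliffordTorus a b) (p : Path x x),
      F (loopClass p) = winding ha hb p.toContinuousMap := by
  obtain ⟨F, hF⟩ := exists_cocycle_lift (winding ha hb) (winding_triangle ha hb)
  have hF' : ∀ n, F (periodClass ha hb n) = n := by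
    intro n
    refine (hF _).trans (period_injective ?_)
    let v : C(unitInterval, ℝ × ℝ) := ⟨fun t => 0 + (t : ℝ) • (period n - 0), by fun_prop⟩
    have h := winding_spec ha hb (segment (torusCover ha hb) 0 (period n)) v fun t => rfl
    have h0 : segment (torusCover ha hb) 0 (period n) 1 =
        segment (torusCover ha hb) 0 (period n) 0 := by
      rw [segment_apply, segment_apply]
      simpa using torusCover_add_period ha hb 0 n
    rw [h0, sub_self, add_zero] at h
    rw [← h]
    simp [v]
  have hR := toH1Op_mem_range (winding ha hb) (periodClass ha hb)
    (fun x => pathClass (segment (torusCover ha hb) 0 (torusSection ha hb x)))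
    (pathClass_eq_segments ha hb)
  -- By `hR` the homology lies in the image of `periodClass`, on which `F` is injective by `hF'`.
  -- Surjectivity comes from the standard loops.
  refine ⟨LinearEquiv.ofBijective (F ∘ₗ toH1Op) ⟨?_, ?_⟩, fun x p => ?_⟩
  · rw [injective_iff_map_eq_zero]
    intro x hx
    obtain ⟨y, hy⟩ := hR x
    rw [LinearMap.comp_apply, hy, hF'] at hx
    apply toH1Op_injective
    rw [hy, hx, map_zero, map_zero]
  · intro n
    have hl : torusCover ha hb (0 + (1 : ℝ) • (period n - 0)) = torusCover ha hb 0 := by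
      simpa using torusCover_add_period ha hb 0 n
    let p : Path (torusCover ha hb 0) (torusCover ha hb 0) :=
      ⟨segment (torusCover ha hb) 0 (period n), by simp [segment_apply], hl⟩
    refine ⟨loopClass p, ?_⟩
    rw [LinearMap.comp_apply, toH1Op_loopClass]
    exact hF' n
  · exact (congrArg F (toH1Op_loopClass p)).trans (hF _)

/-- The isomorphism of the first homology of the torus with `ℤ²`. -/
noncomputable def coords : H1 (cliffordTorus a b) ≃ₗ[ℤ] ℤ × ℤ := (exists_coords ha hb).choose

/-- For a loop the section terms cancel, so the coordinates can be read off from any lift. -/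
theorem coords_loopClass {x : cliffordTorus a b} (p : Path x x) (v : C(unitInterval, ℝ × ℝ))
    (hv : ∀ t, angles a b (v t) = p t) (n : ℤ × ℤ) (hn : v 1 - v 0 = period n) :
    coords ha hb (loopClass p) = n := by
  refine ((exists_coords ha hb).choose_spec x p).trans (period_injective ?_)
  have h := winding_spec ha hb p.toContinuousMap v fun t => Subtype.ext (hv t)
  have h0 : p.toContinuousMap 1 = p.toContinuousMap 0 := p.target.trans p.source.symm
  rw [h0, sub_self, add_zero] at h
  rw [← h, hn]

theorem coords_torusLoop₁ : coords ha hb (loopClass (torusLoop₁ a b ha hb)) = (1, 0) := by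
  refine coords_loopClass ha hb _ ⟨fun t => (2 * Real.pi * t, 0), by fun_prop⟩ (fun t => ?_) _ ?_
  · simp [angles, torusLoop₁]
  · simp [period]

theorem coords_torusLoop₂ : coords ha hb (loopClass (torusLoop₂ a b ha hb)) = (0, 1) := by
  refine coords_loopClass ha hb _ ⟨fun t => (0, 2 * Real.pi * t), by fun_prop⟩ (fun t => ?_) _ ?_
  · simp [angles, torusLoop₂]
  · simp [period]

/-- The basis `γ₁, γ₂` of the first homology of the torus. -/
noncomputable def torusBasis : Module.Basis (Fin 2) ℤ (H1 (cliffordTorus a b)) :=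
  .ofEquivFun ((coords ha hb).trans (LinearEquiv.finTwoArrow ℤ ℤ).symm)

theorem torusBasis_zero : torusBasis ha hb 0 = loopClass (torusLoop₁ a b ha hb) := by
  apply (coords ha hb).injective
  rw [coords_torusLoop₁]
  simp [torusBasis]

theorem torusBasis_one : torusBasis ha hb 1 = loopClass (torusLoop₂ a b ha hb) := by
  apply (coords ha hb).injective
  rw [coords_torusLoop₂]
  simp [torusBasis]

end TorusHomology

/-! ### Lagrangian planes -/

/-- Diffeomorphisms of `ℝ⁴`. -/
abbrev Diffeo : Type := Diffeomorph 𝓘(ℝ, ℂ × ℂ) 𝓘(ℝ, ℂ × ℂ) (ℂ × ℂ) (ℂ × ℂ) ∞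

/-- The complex determinant. -/
noncomputable def cdet (v w : ℂ × ℂ) : ℂ := v.1 * w.2 - v.2 * w.1

theorem omega_self (v : ℂ × ℂ) : omega v v = 0 := by simp [omega]; ring

theorem omega_add_left (u v w : ℂ × ℂ) : omega (u + v) w = omega u w + omega v w := by
  simp [omega]; ring

theorem omega_smul_left (r : ℝ) (v w : ℂ × ℂ) : omega (r • v) w = r * omega v w := by
  simp [omega]; ring

theorem omega_swap (v w : ℂ × ℂ) : omega v w = - omega w v := by
  simp [omega]; ring

theorem omega_add_right (u v w : ℂ × ℂ) : omega w (u + v) = omega w u + omega w v := by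
  simp [omega]; ring

theorem omega_smul_right (r : ℝ) (v w : ℂ × ℂ) : omega w (r • v) = r * omega w v := by
  simp [omega]; ring

theorem isLagrangianPlane_span {v w : ℂ × ℂ} (h : LinearIndependent ℝ ![v, w])
    (h0 : omega v w = 0) : IsLagrangianPlane (Submodule.span ℝ {v, w}) := by
  constructor
  · have := finrank_span_eq_card h
    rwa [Matrix.range_cons_cons_empty, Fintype.card_fin] at this
  · intro x hx y hy
    obtain ⟨r, s, rfl⟩ := Submodule.mem_span_pair.1 hx
    obtain ⟨r', s', rfl⟩ := Submodule.mem_span_pair.1 hy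
    simp [omega_add_left, omega_smul_left, omega_add_right, omega_smul_right, omega_self, h0,
      omega_swap w v]

/-- If the determinant vanished, `w` would be a complex multiple `l • v`. As `omega v w = 0`, the
factor `l` would be real, against real independence. -/
theorem cdet_ne_zero {v w : ℂ × ℂ} (h : LinearIndependent ℝ ![v, w]) (h0 : omega v w = 0) :
    cdet v w ≠ 0 := by
  intro hd
  rw [LinearIndependent.pair_iff] at h
  have hv : v ≠ 0 := by
    rintro rfl
    have := h 1 0 (by simp)
    simp at this
  obtain ⟨l, hl⟩ : ∃ l : ℂ, w = l • v := by
    unfold cdet at hd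
    by_cases h1 : v.1 = 0
    · have h2 : v.2 ≠ 0 := fun h2 => hv (Prod.ext h1 h2)
      refine ⟨w.2 / v.2, Prod.ext ?_ ?_⟩
      · rw [h1, zero_mul, zero_sub, neg_eq_zero, mul_eq_zero] at hd
        simp [h1, hd.resolve_left h2]
      · simp [h2]
    · refine ⟨w.1 / v.1, Prod.ext ?_ ?_⟩
      · simp [h1]
      · simp only [Prod.smul_snd, smul_eq_mul]
        field_simp
        linear_combination hd
  have hn : (v.1.re ^ 2 + v.1.im ^ 2) + (v.2.re ^ 2 + v.2.im ^ 2) ≠ 0 := by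
    intro hn
    apply hv
    have e1 : v.1.re = 0 := by
      nlinarith [sq_nonneg v.1.re, sq_nonneg v.1.im, sq_nonneg v.2.re, sq_nonneg v.2.im]
    have e2 : v.1.im = 0 := by
      nlinarith [sq_nonneg v.1.re, sq_nonneg v.1.im, sq_nonneg v.2.re, sq_nonneg v.2.im]
    have e3 : v.2.re = 0 := by
      nlinarith [sq_nonneg v.1.re, sq_nonneg v.1.im, sq_nonneg v.2.re, sq_nonneg v.2.im]
    have e4 : v.2.im = 0 := by
      nlinarith [sq_nonneg v.1.re, sq_nonneg v.1.im, sq_nonneg v.2.re, sq_nonneg v.2.im]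
    exact Prod.ext (Complex.ext e1 e2) (Complex.ext e3 e4)
  -- `omega v (l • v)` is the imaginary part of `l` times the squared Euclidean norm of `v`.
  have hl0 : l.im = 0 := by
    rw [hl] at h0
    simp only [omega, Prod.smul_fst, Prod.smul_snd, smul_eq_mul, Complex.mul_re,
      Complex.mul_im] at h0
    refine (mul_eq_zero.1 (?_ : l.im * _ = 0)).resolve_right hn
    linear_combination h0
  have := h l.re (-1) (by
    rw [hl]
    apply Prod.ext <;> apply Complex.ext <;> simp [hl0])
  simp at this

theorem cdet_combination (v w : ℂ × ℂ) (r s r' s' : ℝ) :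
    cdet (r • v + s • w) (r' • v + s' • w) = ((r * s' - s * r' : ℝ) : ℂ) * cdet v w := by
  simp [cdet]; ring

/-! ### Tangent spaces -/

theorem fderiv_symm_comp (φ : Diffeo) (z : ℂ × ℂ) :
    (fderiv ℝ φ.symm (φ z)).comp (fderiv ℝ φ z) = ContinuousLinearMap.id ℝ (ℂ × ℂ) := by
  have h1 : DifferentiableAt ℝ φ.symm (φ z) :=
    (φ.symm.contMDiff.contDiff).contDiffAt.differentiableAt (by simp)
  have h2 : DifferentiableAt ℝ φ z :=
    (φ.contMDiff.contDiff).contDiffAt.differentiableAt (by simp)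
  rw [← fderiv_comp z h1 h2]
  have : φ.symm ∘ φ = id := funext φ.symm_apply_apply
  rw [this, fderiv_id]

theorem fderiv_injective (φ : Diffeo) (z : ℂ × ℂ) : Function.Injective (fderiv ℝ φ z) :=
  Function.LeftInverse.injective (g := fderiv ℝ φ.symm (φ z)) fun v =>
    DFunLike.congr_fun (fderiv_symm_comp φ z) v

theorem deriv_comp_diffeo (φ : Diffeo) {c : ℝ → ℂ × ℂ} (hc : ContDiff ℝ ∞ c) (t : ℝ) :
    HasDerivAt (fun s => φ (c s)) (fderiv ℝ φ (c t) (deriv c t)) t := by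
  have h2 : DifferentiableAt ℝ φ (c t) :=
    (φ.contMDiff.contDiff).contDiffAt.differentiableAt (by simp)
  exact h2.hasFDerivAt.comp_hasDerivAt t (hc.contDiffAt.differentiableAt (by simp)).hasDerivAt

theorem tangentSpaceAt_image_le (φ : Diffeo) (L : Set (ℂ × ℂ)) (z : ℂ × ℂ) :
    (tangentSpaceAt L z).map (fderiv ℝ φ z : ℂ × ℂ →ₗ[ℝ] ℂ × ℂ) ≤
      tangentSpaceAt (φ '' L) (φ z) := by
  rw [tangentSpaceAt, Submodule.map_span]
  apply Submodule.span_mono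
  rintro _ ⟨v, ⟨c, hc, hL, rfl, rfl⟩, rfl⟩
  exact ⟨fun t => φ (c t), φ.contMDiff.contDiff.comp hc, fun t => ⟨_, hL t, rfl⟩, rfl,
    (deriv_comp_diffeo φ hc 0).deriv⟩

/-- The reverse inclusion is obtained by pulling curves back with `φ.symm`. -/
theorem tangentSpaceAt_image (φ : Diffeo) (L : Set (ℂ × ℂ)) (z : ℂ × ℂ) :
    tangentSpaceAt (φ '' L) (φ z) =
      (tangentSpaceAt L z).map (fderiv ℝ φ z : ℂ × ℂ →ₗ[ℝ] ℂ × ℂ) := by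
  refine le_antisymm ?_ (tangentSpaceAt_image_le φ L z)
  apply Submodule.span_le.2
  rintro _ ⟨c, hc, hL, h0, rfl⟩
  have hc' : ContDiff ℝ ∞ fun t => φ.symm (c t) := φ.symm.contMDiff.contDiff.comp hc
  refine ⟨deriv (fun t => φ.symm (c t)) 0, Submodule.subset_span ⟨_, hc', fun t => ?_, ?_, rfl⟩, ?_⟩
  · obtain ⟨y, hy, hy'⟩ := hL t
    rw [← hy', φ.symm_apply_apply]
    exact hy
  · rw [h0, φ.symm_apply_apply]
  · have h := (deriv_comp_diffeo φ hc' 0).deriv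
    simp only [φ.apply_symm_apply, h0, φ.symm_apply_apply] at h
    exact h.symm

/-- The first coordinate direction of the torus through a point. -/
noncomputable def rot₁ (p : ℂ × ℂ) : ℂ × ℂ := (Complex.I * p.1, 0)

/-- The second coordinate direction of the torus through a point. -/
noncomputable def rot₂ (p : ℂ × ℂ) : ℂ × ℂ := (0, Complex.I * p.2)

theorem contDiff_angles (a b : ℝ) : ContDiff ℝ ∞ (angles a b) := by
  have h : ContDiff ℝ ∞ (fun x : ℝ => (x : ℂ)) := Complex.ofRealCLM.contDiff
  unfold angles
  exact (contDiff_const.mul (((h.comp contDiff_fst).mul contDiff_const).cexp)).prodMk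
    (contDiff_const.mul (((h.comp contDiff_snd).mul contDiff_const).cexp))

theorem hasDerivAt_exp_mul_I (r x : ℝ) :
    HasDerivAt (fun t : ℝ => (r : ℂ) * Complex.exp ((t : ℂ) * Complex.I))
      (Complex.I * ((r : ℂ) * Complex.exp ((x : ℂ) * Complex.I))) x := by
  have h := (((Complex.ofRealCLM.hasDerivAt (x := x)).mul_const Complex.I).cexp).const_mul (r : ℂ)
  convert! h using 1
  simp; ring

theorem hasDerivAt_angles_fst (a b : ℝ) (q : ℝ × ℝ) :
    HasDerivAt (fun t => angles a b (t, q.2)) (rot₁ (angles a b q)) q.1 :=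
  (hasDerivAt_exp_mul_I a q.1).prodMk
    (hasDerivAt_const q.1 ((b : ℂ) * Complex.exp ((q.2 : ℂ) * Complex.I)))

theorem hasDerivAt_angles_snd (a b : ℝ) (q : ℝ × ℝ) :
    HasDerivAt (fun t => angles a b (q.1, t)) (rot₂ (angles a b q)) q.2 :=
  (hasDerivAt_const q.2 ((a : ℂ) * Complex.exp ((q.1 : ℂ) * Complex.I))).prodMk
    (hasDerivAt_exp_mul_I b q.2)

theorem tangent_circle {r : ℝ} (hr : 0 < r) {c : ℝ → ℂ} {v : ℂ} (hc : HasDerivAt c v 0)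
    (h : ∀ t, ‖c t‖ = r) : ∃ l : ℝ, v = l • (Complex.I * c 0) := by
  have hre : HasDerivAt (fun t => (c t).re) v.re 0 := Complex.reCLM.hasFDerivAt.comp_hasDerivAt 0 hc
  have him : HasDerivAt (fun t => (c t).im) v.im 0 := Complex.imCLM.hasFDerivAt.comp_hasDerivAt 0 hc
  have h2 : ∀ t, (c t).re ^ 2 + (c t).im ^ 2 = r ^ 2 := fun t => by
    rw [← h t, Complex.sq_norm, Complex.normSq_apply]; ring
  have h3 := (hre.fun_pow 2).add (him.fun_pow 2)
  have h4 : ((fun t => (c t).re ^ 2) + fun t => (c t).im ^ 2) = fun _ => r ^ 2 := funext h2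
  rw [h4] at h3
  have h5 := h3.unique (hasDerivAt_const _ _)
  have h6 : (c 0).re * v.re + (c 0).im * v.im = 0 := by
    simp at h5; linarith
  have h7 := h2 0
  -- The coefficient is the component of `v` along `i c(0)`; by `h6` the radial component is zero.
  refine ⟨((c 0).re * v.im - (c 0).im * v.re) / r ^ 2, ?_⟩
  have hr' : r ^ 2 ≠ 0 := by positivity
  rw [div_eq_inv_mul, mul_smul, eq_inv_smul_iff₀ hr', ← h7]
  apply Complex.ext
  · simp only [Complex.smul_re, smul_eq_mul, Complex.mul_re, Complex.I_re, Complex.I_im]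
    linear_combination (c 0).re * h6
  · simp only [Complex.smul_im, smul_eq_mul, Complex.mul_im, Complex.I_re, Complex.I_im]
    linear_combination (c 0).im * h6

section Torus

variable {a b : ℝ} (ha : 0 < a) (hb : 0 < b)
include ha hb

theorem exists_angles {p : ℂ × ℂ} (hp : p ∈ cliffordTorus a b) : ∃ q, angles a b q = p := by
  obtain ⟨q, hq⟩ := torusCover_surjective ha hb ⟨p, hp⟩
  exact ⟨q, congrArg Subtype.val hq⟩

theorem tangentSpaceAt_cliffordTorus {p : ℂ × ℂ} (hp : p ∈ cliffordTorus a b) :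
    tangentSpaceAt (cliffordTorus a b) p = Submodule.span ℝ {rot₁ p, rot₂ p} := by
  apply le_antisymm
  · apply Submodule.span_le.2
    rintro _ ⟨c, hc, hL, rfl, rfl⟩
    have h := (hc.contDiffAt.differentiableAt (x := 0) (by simp)).hasDerivAt
    have h1 : HasDerivAt (fun t => (c t).1) (deriv c 0).1 0 :=
      (ContinuousLinearMap.fst ℝ ℂ ℂ).hasFDerivAt.comp_hasDerivAt 0 h
    have h2 : HasDerivAt (fun t => (c t).2) (deriv c 0).2 0 :=
      (ContinuousLinearMap.snd ℝ ℂ ℂ).hasFDerivAt.comp_hasDerivAt 0 h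
    obtain ⟨r, hr⟩ := tangent_circle ha h1 fun t => (hL t).1
    obtain ⟨s, hs⟩ := tangent_circle hb h2 fun t => (hL t).2
    refine Submodule.mem_span_pair.2 ⟨r, s, ?_⟩
    apply Prod.ext
    · rw [hr]; simp [rot₁, rot₂]
    · rw [hs]; simp [rot₁, rot₂]
  · obtain ⟨q, rfl⟩ := exists_angles ha hb hp
    apply Submodule.span_mono
    rintro v (rfl | rfl)
    · refine ⟨fun t => angles a b (q.1 + t, q.2), ?_, fun t => angles_mem ha hb _, by simp, ?_⟩
      · exact (contDiff_angles a b).comp ((contDiff_const.add contDiff_id).prodMk contDiff_const)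
      · have h := hasDerivAt_angles_fst a b q
        rw [← add_zero q.1] at h
        exact (h.comp_const_add q.1 0).deriv.trans (by simp)
    · refine ⟨fun t => angles a b (q.1, q.2 + t), ?_, fun t => angles_mem ha hb _, by simp, ?_⟩
      · exact (contDiff_angles a b).comp (contDiff_const.prodMk (contDiff_const.add contDiff_id))
      · have h := hasDerivAt_angles_snd a b q
        rw [← add_zero q.2] at h
        exact (h.comp_const_add q.2 0).deriv.trans (by simp)

theorem linearIndependent_rot {p : ℂ × ℂ} (hp : p ∈ cliffordTorus a b) :
    LinearIndependent ℝ ![rot₁ p, rot₂ p] := by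
  have h1 : p.1 ≠ 0 := norm_pos_iff.1 (hp.1 ▸ ha)
  have h2 : p.2 ≠ 0 := norm_pos_iff.1 (hp.2 ▸ hb)
  rw [LinearIndependent.pair_iff]
  intro r s h
  have e1 := congrArg Prod.fst h
  have e2 := congrArg Prod.snd h
  simp [rot₁, rot₂, h1] at e1
  simp [rot₁, rot₂, h2] at e2
  exact ⟨e1, e2⟩

theorem linearIndependent_fderiv_rot (φ : Diffeo) {p : ℂ × ℂ} (hp : p ∈ cliffordTorus a b) :
    LinearIndependent ℝ ![fderiv ℝ φ p (rot₁ p), fderiv ℝ φ p (rot₂ p)] := by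
  have h := (linearIndependent_rot ha hb hp).map' (fderiv ℝ φ p : ℂ × ℂ →ₗ[ℝ] ℂ × ℂ)
    (LinearMap.ker_eq_bot.2 (fderiv_injective φ p))
  have e : ![fderiv ℝ φ p (rot₁ p), fderiv ℝ φ p (rot₂ p)] =
      (fderiv ℝ φ p : ℂ × ℂ →ₗ[ℝ] ℂ × ℂ) ∘ ![rot₁ p, rot₂ p] := by
    funext i; fin_cases i <;> rfl
  rw [e]
  exact h

theorem tangentSpaceAt_image_cliffordTorus (φ : Diffeo) {p : ℂ × ℂ} (hp : p ∈ cliffordTorus a b) :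
    tangentSpaceAt (φ '' cliffordTorus a b) (φ p) =
      Submodule.span ℝ {fderiv ℝ φ p (rot₁ p), fderiv ℝ φ p (rot₂ p)} := by
  rw [tangentSpaceAt_image, tangentSpaceAt_cliffordTorus ha hb hp, Submodule.map_span,
    Set.image_pair]
  rfl

/-- The two coordinate velocities of the parametrization by angles span each tangent plane, so one
value of `omega` decides. Independence is automatic for a diffeomorphism. -/
theorem isLagrangian_image_cliffordTorus (φ : Diffeo) (h : ∀ q : ℝ × ℝ, ∃ v w : ℂ × ℂ,
    HasDerivAt (fun t => φ (angles a b (t, q.2))) v q.1 ∧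
    HasDerivAt (fun t => φ (angles a b (q.1, t))) w q.2 ∧ omega v w = 0) :
    IsLagrangian (φ '' cliffordTorus a b) := by
  rintro _ ⟨p, hp, rfl⟩
  rw [tangentSpaceAt_image_cliffordTorus ha hb φ hp]
  refine isLagrangianPlane_span (linearIndependent_fderiv_rot ha hb φ hp) ?_
  obtain ⟨q, rfl⟩ := exists_angles ha hb hp
  obtain ⟨v, w, hv, hw, h0⟩ := h q
  have hd : HasFDerivAt φ (fderiv ℝ φ (angles a b q)) (angles a b q) :=
    ((φ.contMDiff.contDiff).contDiffAt.differentiableAt (by simp)).hasFDerivAt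
  have hv' := HasFDerivAt.comp_hasDerivAt (f := fun t => angles a b (t, q.2)) q.1 hd
    (hasDerivAt_angles_fst a b q)
  have hw' := HasFDerivAt.comp_hasDerivAt (f := fun t => angles a b (q.1, t)) q.2 hd
    (hasDerivAt_angles_snd a b q)
  rw [← hv'.unique hv, ← hw'.unique hw] at h0
  exact h0

end Torus

/-! ### The Maslov index -/

/-- A change of basis multiplies the complex determinant by a nonzero real number, so its normalized
square is unchanged. Two continuous arguments of it differ by a constant multiple of `2π`. -/
theorem HasMaslovIndex.unique {Λ : ℝ → Submodule ℝ (ℂ × ℂ)} {m n : ℤ} (hm : HasMaslovIndex Λ m)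
    (hn : HasMaslovIndex Λ n) : m = n := by
  obtain ⟨hL, θ, hθ, h, hd⟩ := hm
  obtain ⟨-, θ', hθ', h', hd'⟩ := hn
  have key : ∀ t ∈ Set.Icc (0 : ℝ) 1, ∃ k : ℤ, θ t = θ' t + 2 * Real.pi * k := by
    intro t ht
    obtain ⟨v, w, hi, hs, he⟩ := h t ht
    obtain ⟨v', w', hi', hs', he'⟩ := h' t ht
    have mem : ∀ x ∈ ({v', w'} : Set (ℂ × ℂ)), ∃ r s : ℝ, r • v + s • w = x := fun x hx => by
      rw [← Submodule.mem_span_pair, hs, ← hs']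
      exact Submodule.subset_span hx
    have hω : omega v w = 0 := (hL t ht).2 v (hs ▸ Submodule.subset_span (by simp)) w
      (hs ▸ Submodule.subset_span (by simp))
    have hω' : omega v' w' = 0 := (hL t ht).2 v' (hs' ▸ Submodule.subset_span (by simp)) w'
      (hs' ▸ Submodule.subset_span (by simp))
    have hD := cdet_ne_zero hi hω
    have hD' := cdet_ne_zero hi' hω'
    obtain ⟨r, s, hrs⟩ := mem v' (by simp)
    obtain ⟨r', s', hrs'⟩ := mem w' (by simp)
    have hc : cdet v' w' = ((r * s' - s * r' : ℝ) : ℂ) * cdet v w := by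
      rw [← hrs, ← hrs', cdet_combination]
    set l : ℝ := r * s' - s * r' with hl
    have hl0 : (l : ℂ) ≠ 0 := by
      intro h0
      rw [hc, h0, zero_mul] at hD'
      exact hD' rfl
    change cdet v w ^ 2 = ((‖cdet v w‖ ^ 2 : ℝ) : ℂ) * _ at he
    change cdet v' w' ^ 2 = ((‖cdet v' w'‖ ^ 2 : ℝ) : ℂ) * _ at he'
    rw [hc, mul_pow, he, norm_mul, Complex.norm_real, mul_pow, Real.norm_eq_abs, sq_abs,
      Complex.ofReal_mul, Complex.ofReal_pow l, mul_assoc,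
      mul_right_inj' (pow_ne_zero 2 hl0), mul_right_inj'] at he'
    · exact exp_mul_I_eq_iff.1 he'
    · have := norm_ne_zero_iff.2 hD
      exact_mod_cast pow_ne_zero 2 this
  have hpi : (2 * Real.pi) ≠ 0 := by positivity
  have hc : Continuous fun t : unitInterval => (θ t - θ' t) / (2 * Real.pi) :=
    ((continuousOn_iff_continuous_domRestrict.1 hθ).sub
      (continuousOn_iff_continuous_domRestrict.1 hθ')).div_const _
  have h01 := eq_of_continuous_of_int hc (fun t => by
      obtain ⟨k, hk⟩ := key t t.2
      exact ⟨k, by rw [hk]; field_simp; ring⟩) 0 1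
  rw [div_left_inj' hpi] at h01
  have : 2 * Real.pi * (m : ℝ) = 2 * Real.pi * n := by
    rw [← hd, ← hd']
    simp only [Set.Icc.coe_zero, Set.Icc.coe_one] at h01
    linarith
  exact_mod_cast mul_left_cancel₀ hpi this

/-- The Maslov index is constant in a continuous family of loops of Lagrangian planes. -/
theorem exists_hasMaslovIndex_family (Λ : ℝ → ℝ → Submodule ℝ (ℂ × ℂ))
    (V W : unitInterval × unitInterval → ℂ × ℂ) (hV : Continuous V) (hW : Continuous W)
    (hV01 : ∀ s, V (s, 0) = V (s, 1)) (hW01 : ∀ s, W (s, 0) = W (s, 1))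
    (hL : ∀ s ∈ Set.Icc (0 : ℝ) 1, ∀ t ∈ Set.Icc (0 : ℝ) 1, IsLagrangianPlane (Λ s t))
    (hi : ∀ s t, LinearIndependent ℝ ![V (s, t), W (s, t)])
    (hspan : ∀ s t : unitInterval, Submodule.span ℝ {V (s, t), W (s, t)} = Λ s t) :
    ∃ m : ℤ, ∀ s ∈ Set.Icc (0 : ℝ) 1, HasMaslovIndex (Λ s) m := by
  let c : ℝ → unitInterval := Set.projIcc 0 1 zero_le_one
  have hc : Continuous c := continuous_projIcc
  let D : unitInterval × unitInterval → ℂ := fun q => cdet (V q) (W q)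
  have hD : Continuous D := by unfold D cdet; fun_prop
  have hD0 : ∀ q, D q ≠ 0 := by
    rintro ⟨s, t⟩
    refine cdet_ne_zero (hi s t) ((hL s s.2 t t.2).2 _ ?_ _ ?_)
    · rw [← hspan]; exact Submodule.subset_span (by simp)
    · rw [← hspan]; exact Submodule.subset_span (by simp)
  -- Both parameters are projected to `[0, 1]`, so that the normalized `det²` is defined on the
  -- whole plane and has a single argument `θ` for all `s` at once.
  let f : ℝ × ℝ → ℂ := fun q => D (c q.1, c q.2) ^ 2 / ((‖D (c q.1, c q.2)‖ ^ 2 : ℝ) : ℂ)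
  have hn : ∀ q, ((‖D q‖ ^ 2 : ℝ) : ℂ) ≠ 0 := fun q => by
    exact_mod_cast pow_ne_zero 2 (norm_ne_zero_iff.2 (hD0 q))
  have hf : Continuous f := by
    refine Continuous.div (by fun_prop) ?_ fun q => hn _
    fun_prop
  obtain ⟨θ, hθ⟩ := exists_angle_lift hf fun q => by
    simp only [f]
    rw [norm_div, norm_pow, Complex.norm_real, norm_pow, norm_norm, div_self]
    exact pow_ne_zero 2 (norm_ne_zero_iff.2 (hD0 _))
  have hpi : (2 * Real.pi) ≠ 0 := by positivity
  have hk : ∀ s, ∃ k : ℤ, θ (s, 1) = θ (s, 0) + 2 * Real.pi * k := fun s => by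
    rw [← exp_mul_I_eq_iff, hθ, hθ]
    have h : D (c s, c 1) = D (c s, c 0) := by
      have h0 : c 0 = 0 := Set.projIcc_left _
      have h1 : c 1 = 1 := Set.projIcc_right _
      simp only [D, h0, h1, hV01, hW01]
    simp only [f, h]
  -- The number of turns is an integer for each `s`, because the frame closes up, and it is
  -- continuous in `s`.
  have hconst := eq_of_continuous_of_int
    (f := fun s : ℝ => (θ (s, 1) - θ (s, 0)) / (2 * Real.pi)) (by fun_prop) fun s => by
      obtain ⟨k, hk⟩ := hk s
      exact ⟨k, by rw [hk]; field_simp; ring⟩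
  obtain ⟨m, hm⟩ := hk 0
  refine ⟨m, fun s hs => ⟨hL s hs, fun t => θ (s, t), by fun_prop, fun t ht => ?_, ?_⟩⟩
  · have hs' : c s = ⟨s, hs⟩ := Set.projIcc_of_mem _ hs
    have ht' : c t = ⟨t, ht⟩ := Set.projIcc_of_mem _ ht
    refine ⟨V (c s, c t), W (c s, c t), hi _ _, ?_, ?_⟩
    · rw [hspan, hs', ht']
    · rw [hθ]
      exact (mul_div_cancel₀ _ (hn _)).symm
  · have h := hconst s 0
    simp only [div_left_inj' hpi] at h
    rw [h, hm]; ring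

/-- Joint smoothness is given only on `[0, 1] × ℝ⁴`. The derivative within this set, restricted to
spatial directions, is the derivative of `φ_s`; this yields its continuity in `s` as well. -/
theorem deriv_isotopy (Φ : CompactIsotopy) {s : ℝ} (hs : s ∈ Set.Icc (0 : ℝ) 1) (z v : ℂ × ℂ) :
    fderivWithin ℝ (fun q : ℝ × (ℂ × ℂ) => Φ.φ q.1 q.2) (Set.Icc 0 1 ×ˢ Set.univ) (s, z) (0, v) =
      fderiv ℝ (Φ.φ s) z v := by
  have hd : HasFDerivWithinAt (fun q : ℝ × (ℂ × ℂ) => Φ.φ q.1 q.2) _ (Set.Icc 0 1 ×ˢ Set.univ)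
      (s, z) := ((Φ.smooth.differentiableOn (by simp)) (s, z) ⟨hs, trivial⟩).hasFDerivWithinAt
  have hi : HasFDerivWithinAt (fun z : ℂ × ℂ => (s, z)) (ContinuousLinearMap.inr ℝ ℝ (ℂ × ℂ))
      Set.univ z := (hasFDerivAt_prodMk_right s z).hasFDerivWithinAt
  have h := hd.comp z hi fun y _ => ⟨hs, trivial⟩
  rw [hasFDerivWithinAt_univ] at h
  have h2 : fderiv ℝ (Φ.φ s) z = _ := h.fderiv
  rw [h2]
  rfl

theorem continuous_deriv_isotopy (Φ : CompactIsotopy) {Y : Type*} [TopologicalSpace Y]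
    {s : Y → ℝ} {z v : Y → ℂ × ℂ} (hs : Continuous s) (hz : Continuous z) (hv : Continuous v)
    (h : ∀ y, s y ∈ Set.Icc (0 : ℝ) 1) :
    Continuous fun y => fderiv ℝ (Φ.φ (s y)) (z y) (v y) := by
  have hu : UniqueDiffOn ℝ ((Set.Icc (0 : ℝ) 1) ×ˢ (Set.univ : Set (ℂ × ℂ))) :=
    (uniqueDiffOn_Icc zero_lt_one).prod uniqueDiffOn_univ
  have hc := Φ.smooth.continuousOn_fderivWithin hu (by simp)
  have hc' : Continuous fun y => fderivWithin ℝ (fun q : ℝ × (ℂ × ℂ) => Φ.φ q.1 q.2)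
      (Set.Icc 0 1 ×ˢ Set.univ) (s y, z y) :=
    hc.comp_continuous (hs.prodMk hz) fun y => ⟨h y, trivial⟩
  simp_rw [← fun y => deriv_isotopy Φ (h y) (z y) (v y)]
  exact hc'.clm_apply (continuous_const.prodMk hv)

section Torus

variable {a b : ℝ} (ha : 0 < a) (hb : 0 < b)

include ha hb in
theorem isLagrangianPlane_torus {p : ℂ × ℂ} (hp : p ∈ cliffordTorus a b) :
    IsLagrangianPlane (Submodule.span ℝ {rot₁ p, rot₂ p}) :=
  isLagrangianPlane_span (linearIndependent_rot ha hb hp) (by simp [omega, rot₁, rot₂])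

/-- The Maslov class of the torus. -/
noncomputable def torusMaslov : H1 (cliffordTorus a b) →ₗ[ℤ] ℤ :=
  ((2 : ℤ) • (LinearMap.fst ℤ ℤ ℤ + LinearMap.snd ℤ ℤ ℤ)) ∘ₗ (coords ha hb : _ →ₗ[ℤ] ℤ × ℤ)

theorem torusMaslov_apply (x : H1 (cliffordTorus a b)) :
    torusMaslov ha hb x = 2 * ((coords ha hb x).1 + (coords ha hb x).2) := by
  simp [torusMaslov, mul_add]

include ha hb in
theorem exists_lift_loop {x : cliffordTorus a b} (p : Path x x) :
    ∃ (v : C(unitInterval, ℝ × ℝ)) (n : ℤ × ℤ),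
      (∀ t, angles a b (v t) = p t) ∧ v 1 - v 0 = period n := by
  obtain ⟨v, hv⟩ := exists_path_lift ha hb p.toContinuousMap
  have h : torusCover ha hb (v 1) = torusCover ha hb (v 0) :=
    Subtype.ext ((hv 1).trans (Eq.trans (by simp) (hv 0).symm))
  obtain ⟨n, hn⟩ := (torusCover_eq_iff ha hb).1 h
  exact ⟨v, n, hv, by rw [hn]; abel⟩

theorem isMaslovClass_torusMaslov : IsMaslovClass (cliffordTorus a b) (torusMaslov ha hb) := by
  intro x p C hC hper himm hp
  have hmem : ∀ t ∈ Set.Icc (0 : ℝ) 1, C t ∈ cliffordTorus a b := fun t ht => by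
    rw [← hp ⟨t, ht⟩]; exact (p ⟨t, ht⟩).2
  obtain ⟨v, n, hv, hn⟩ := exists_lift_loop ha hb p
  refine ⟨fun t ht => ?_, Set.IccExtend zero_le_one fun t => 2 * ((v t).1 + (v t).2), ?_, ?_, ?_⟩
  · simp only
    rw [tangentSpaceAt_cliffordTorus ha hb (hmem t ht)]
    exact isLagrangianPlane_torus ha hb (hmem t ht)
  · exact (Continuous.Icc_extend' (by fun_prop)).continuousOn
  · intro t ht
    -- In this frame the determinant is `(i z₁)(i z₂)`, whose square is `z₁² z₂²`, with argument
    -- twice the sum of the angles.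
    refine ⟨rot₁ (C t), rot₂ (C t), linearIndependent_rot ha hb (hmem t ht),
      (tangentSpaceAt_cliffordTorus ha hb (hmem t ht)).symm, ?_⟩
    have e : angles a b (v ⟨t, ht⟩) = C t := (hv ⟨t, ht⟩).trans (hp ⟨t, ht⟩)
    have h1 := (hmem t ht).1
    have h2 := (hmem t ht).2
    rw [Set.IccExtend_of_mem _ _ ht]
    simp only [rot₁, rot₂, zero_mul, sub_zero, norm_mul, Complex.norm_I, one_mul, h1, h2]
    rw [← e]
    simp only [angles]
    have e2 : Complex.exp (((2 * ((v ⟨t, ht⟩).1 + (v ⟨t, ht⟩).2) : ℝ) : ℂ) * Complex.I) =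
        Complex.exp (((v ⟨t, ht⟩).1 : ℂ) * Complex.I) ^ 2 *
        Complex.exp (((v ⟨t, ht⟩).2 : ℂ) * Complex.I) ^ 2 := by
      rw [← Complex.exp_nat_mul, ← Complex.exp_nat_mul, ← Complex.exp_add]
      congr 1
      push_cast
      ring
    rw [e2]
    push_cast
    linear_combination ((a : ℂ) * Complex.exp (((v ⟨t, ht⟩).1 : ℂ) * Complex.I) * b *
      Complex.exp (((v ⟨t, ht⟩).2 : ℂ) * Complex.I)) ^ 2 * (Complex.I ^ 2 - 1) * Complex.I_sq
  · have e0 := congrArg Prod.fst hn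
    have e1 := congrArg Prod.snd hn
    simp only [Prod.fst_sub, Prod.snd_sub, period] at e0 e1
    rw [Set.IccExtend_right, Set.IccExtend_left, torusMaslov_apply,
      coords_loopClass ha hb p v hv n hn]
    change 2 * ((v 1).1 + (v 1).2) - 2 * ((v 0).1 + (v 0).2) = _
    push_cast
    linear_combination 2 * e0 + 2 * e1

/-- A loop of the torus with constant speed. -/
noncomputable def linearLoop (n : ℤ × ℤ) (t : ℝ) : ℂ × ℂ := angles a b (t • period n)

theorem contDiff_linearLoop (n : ℤ × ℤ) : ContDiff ℝ ∞ (linearLoop (a := a) (b := b) n) :=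
  (contDiff_angles a b).comp (contDiff_id.smul contDiff_const)

include ha hb in
theorem linearLoop_periodic (n : ℤ × ℤ) : Function.Periodic (linearLoop (a := a) (b := b) n) 1 := by
  intro t
  have h := torusCover_add_period ha hb (t • period n) n
  unfold linearLoop
  rw [add_smul, one_smul]
  exact congrArg Subtype.val h

include ha hb in
theorem deriv_linearLoop_ne_zero {n : ℤ × ℤ} (hn : n ≠ 0) (t : ℝ) :
    deriv (linearLoop (a := a) (b := b) n) t ≠ 0 := by
  have h1 : HasDerivAt (fun t : ℝ => angles a b (t • period n))
      ((2 * Real.pi * n.1) • (Complex.I * (angles a b (t • period n)).1),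
       (2 * Real.pi * n.2) • (Complex.I * (angles a b (t • period n)).2)) t := by
    refine HasDerivAt.prodMk ?_ ?_
    · exact HasDerivAt.scomp t (hasDerivAt_exp_mul_I a _) (by
        simpa [period] using (hasDerivAt_id t).mul_const (2 * Real.pi * n.1))
    · exact HasDerivAt.scomp t (hasDerivAt_exp_mul_I b _) (by
        simpa [period] using (hasDerivAt_id t).mul_const (2 * Real.pi * n.2))
  intro h0
  rw [show deriv (linearLoop (a := a) (b := b) n) t = _ from h1.deriv] at h0
  apply hn
  have e1 := congrArg Prod.fst h0
  have e2 := congrArg Prod.snd h0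
  simp [angles, Complex.exp_ne_zero, ha.ne', hb.ne', Real.pi_ne_zero] at e1 e2
  exact Prod.ext e1 e2

theorem torusLoop₁_eq (t : unitInterval) :
    (torusLoop₁ a b ha hb t : ℂ × ℂ) = linearLoop (a := a) (b := b) (1, 0) t := by
  simp [torusLoop₁, linearLoop, angles, period, mul_comm]

theorem torusLoop₂_eq (t : unitInterval) :
    (torusLoop₂ a b ha hb t : ℂ × ℂ) = linearLoop (a := a) (b := b) (0, 1) t := by
  simp [torusLoop₂, linearLoop, angles, period, mul_comm]

/-- The defining property tests only immersed curves, but `γ₁` and `γ₂` are immersed and form a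
basis. -/
theorem IsMaslovClass.eq_torusMaslov {μ : H1 (cliffordTorus a b) →ₗ[ℤ] ℤ}
    (h : IsMaslovClass (cliffordTorus a b) μ) : μ = torusMaslov ha hb := by
  have key : ∀ (n : ℤ × ℤ), n ≠ 0 → ∀ (x : cliffordTorus a b) (p : Path x x),
      (∀ t, (p t : ℂ × ℂ) = linearLoop (a := a) (b := b) n t) →
      μ (loopClass p) = torusMaslov ha hb (loopClass p) := fun n hn x p hp =>
    (h x p _ (contDiff_linearLoop n) (linearLoop_periodic ha hb n)
      (deriv_linearLoop_ne_zero ha hb hn) hp).unique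
    (isMaslovClass_torusMaslov ha hb x p _ (contDiff_linearLoop n) (linearLoop_periodic ha hb n)
      (deriv_linearLoop_ne_zero ha hb hn) hp)
  refine (torusBasis ha hb).ext fun i => ?_
  fin_cases i
  · simp only [Fin.zero_eta, torusBasis_zero]
    exact key (1, 0) (by simp) _ _ (torusLoop₁_eq ha hb)
  · simp only [Fin.mk_one, torusBasis_one]
    exact key (0, 1) (by simp) _ _ (torusLoop₂_eq ha hb)

/-- Lagrangian self-isotopies preserve the Maslov index of loops. -/
theorem torusMaslov_H1map_loopClass (Φ : CompactIsotopy)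
    (h1 : Φ.φ 1 '' cliffordTorus a b = cliffordTorus a b)
    (hL : ∀ s ∈ Set.Icc (0 : ℝ) 1, IsLagrangian (Φ.φ s '' cliffordTorus a b))
    {n : ℤ × ℤ} (hn : n ≠ 0) {x : cliffordTorus a b} (p : Path x x)
    (hp : ∀ t, (p t : ℂ × ℂ) = linearLoop (a := a) (b := b) n t) :
    torusMaslov ha hb (H1map (restrictSelf (cliffordTorus a b) (Φ.φ 1) h1) (loopClass p)) =
      torusMaslov ha hb (loopClass p) := by
  set C := linearLoop (a := a) (b := b) n with hCdef
  have hC : ContDiff ℝ ∞ C := contDiff_linearLoop n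
  have hper := linearLoop_periodic ha hb n
  have himm := deriv_linearLoop_ne_zero ha hb hn
  have hmem : ∀ t, C t ∈ cliffordTorus a b := fun t => angles_mem ha hb _
  have hC01 : C 0 = C 1 := by simpa using (hper 0).symm
  -- The derivative of `φ_s` carries the coordinate directions along `C` to a frame of the tangent
  -- planes of the moving torus.
  obtain ⟨m, hm⟩ := exists_hasMaslovIndex_family
    (fun s t => tangentSpaceAt (Φ.φ s '' cliffordTorus a b) (Φ.φ s (C t)))
    (fun q => fderiv ℝ (Φ.φ q.1) (C q.2) (rot₁ (C q.2)))
    (fun q => fderiv ℝ (Φ.φ q.1) (C q.2) (rot₂ (C q.2)))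
    (continuous_deriv_isotopy Φ (by fun_prop) (hC.continuous.comp (by fun_prop))
      (by unfold rot₁; have := hC.continuous; fun_prop) fun q => q.1.2)
    (continuous_deriv_isotopy Φ (by fun_prop) (hC.continuous.comp (by fun_prop))
      (by unfold rot₂; have := hC.continuous; fun_prop) fun q => q.1.2)
    (fun s => by simp [hC01]) (fun s => by simp [hC01])
    (fun s hs t _ => hL s hs _ ⟨_, hmem t, rfl⟩)
    (fun s t => linearIndependent_fderiv_rot ha hb (Φ.φ s) (hmem t))
    (fun s t => (tangentSpaceAt_image_cliffordTorus ha hb (Φ.φ s) (hmem t)).symm)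
  have hm0 := hm 0 (by simp)
  have hm1 := hm 1 (by simp)
  have hid : Φ.φ 0 '' cliffordTorus a b = cliffordTorus a b := by
    rw [show (Φ.φ 0 : ℂ × ℂ → ℂ × ℂ) = id from funext Φ.zero, Set.image_id]
  simp only [hid, h1] at hm0 hm1
  simp only [Φ.zero] at hm0
  have e0 : torusMaslov ha hb (loopClass p) = m :=
    (isMaslovClass_torusMaslov ha hb x p C hC hper himm hp).unique hm0
  rw [e0, H1map_loopClass]
  -- The image loop is again immersed in the torus, so its class can be evaluated by the same index.
  refine (isMaslovClass_torusMaslov ha hb _ _ (fun t => Φ.φ 1 (C t))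
    ((Φ.φ 1).contMDiff.contDiff.comp hC) (fun t => congrArg (Φ.φ 1) (hper t))
    (fun t => ?_) (fun t => ?_)).unique hm1
  · rw [(deriv_comp_diffeo (Φ.φ 1) hC t).deriv]
    intro h0
    exact himm t (fderiv_injective (Φ.φ 1) (C t) (h0.trans (map_zero _).symm))
  · rw [← hp t]
    rfl

theorem mem_preserving_of_isotopy {h : H1 (cliffordTorus a b) ≃ₗ[ℤ] H1 (cliffordTorus a b)}
    (hh : h ∈ lagrangianMonodromies (cliffordTorus a b)) : h ∈ preserving (torusMaslov ha hb) := by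
  obtain ⟨Φ, h1, hL, he⟩ := hh
  have key : torusMaslov ha hb ∘ₗ (h : H1 (cliffordTorus a b) →ₗ[ℤ] H1 (cliffordTorus a b)) =
      torusMaslov ha hb := by
    rw [he]
    refine (torusBasis ha hb).ext fun i => ?_
    fin_cases i
    · simp only [Fin.zero_eta, torusBasis_zero]
      exact torusMaslov_H1map_loopClass ha hb Φ h1 hL (n := (1, 0)) (by simp) _
        (torusLoop₁_eq ha hb)
    · simp only [Fin.mk_one, torusBasis_one]
      exact torusMaslov_H1map_loopClass ha hb Φ h1 hL (n := (0, 1)) (by simp) _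
        (torusLoop₂_eq ha hb)
  exact fun x => LinearMap.congr_fun key x

end Torus

/-! ### Operations on isotopies -/

namespace CompactIsotopy

/-- The isotopy given by a family of diffeomorphisms that is defined for all times. -/
noncomputable def ofFamily (f g : ℝ → ℂ × ℂ → ℂ × ℂ)
    (hf : ContDiff ℝ ∞ fun q : ℝ × (ℂ × ℂ) => f q.1 q.2)
    (hg : ContDiff ℝ ∞ fun q : ℝ × (ℂ × ℂ) => g q.1 q.2)
    (hgf : ∀ s z, g s (f s z) = z) (hfg : ∀ s z, f s (g s z) = z)
    (h0 : ∀ z, f 0 z = z)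
    (hK : ∃ K : Set (ℂ × ℂ), IsCompact K ∧ ∀ s z, z ∉ K → f s z = z) : CompactIsotopy where
  φ s :=
    { toFun := f s
      invFun := g s
      left_inv := hgf s
      right_inv := hfg s
      contMDiff_toFun := (hf.comp (contDiff_const.prodMk contDiff_id)).contMDiff
      contMDiff_invFun := (hg.comp (contDiff_const.prodMk contDiff_id)).contMDiff }
  smooth := hf.contDiffOn
  zero := h0
  compactSupport := by
    obtain ⟨K, hK, h⟩ := hK
    exact ⟨K, hK, fun s _ z hz => h s z hz⟩

theorem ofFamily_apply (f g : ℝ → ℂ × ℂ → ℂ × ℂ) (hf hg hgf hfg h0 hK) (s : ℝ) (z : ℂ × ℂ) :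
    (ofFamily f g hf hg hgf hfg h0 hK).φ s z = f s z := rfl

/-- Reparametrization of an isotopy. -/
noncomputable def reparam (Φ : CompactIsotopy) (τ : ℝ → ℝ) (hτ : ContDiff ℝ ∞ τ)
    (hmem : ∀ s, τ s ∈ Set.Icc (0 : ℝ) 1) (h0 : τ 0 = 0) : CompactIsotopy where
  φ s := Φ.φ (τ s)
  smooth := (Φ.smooth.comp_contDiff (f := fun q : ℝ × (ℂ × ℂ) => (τ q.1, q.2))
    ((hτ.comp contDiff_fst).prodMk contDiff_snd) fun q => ⟨hmem q.1, trivial⟩).contDiffOn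
  zero z := by rw [h0, Φ.zero]
  compactSupport := by
    obtain ⟨K, hK, h⟩ := Φ.compactSupport
    exact ⟨K, hK, fun s _ z hz => h _ (hmem s) z hz⟩

/-- Composition of the diffeomorphisms of two isotopies at each time. -/
noncomputable def comp (Ψ Φ : CompactIsotopy) : CompactIsotopy where
  φ s := (Φ.φ s).trans (Ψ.φ s)
  smooth := Ψ.smooth.comp (f := fun q : ℝ × (ℂ × ℂ) => (q.1, Φ.φ q.1 q.2))
    (contDiff_fst.contDiffOn.prodMk Φ.smooth) fun _ hq => ⟨hq.1, trivial⟩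
  zero z := by
    change Ψ.φ 0 (Φ.φ 0 z) = z
    rw [Φ.zero, Ψ.zero]
  compactSupport := by
    obtain ⟨K, hK, h⟩ := Φ.compactSupport
    obtain ⟨K', hK', h'⟩ := Ψ.compactSupport
    refine ⟨K ∪ K', hK.union hK', fun s hs z hz => ?_⟩
    rw [Set.mem_union, not_or] at hz
    change Ψ.φ s (Φ.φ s z) = z
    rw [h s hs z hz.1, h' s hs z hz.2]

theorem comp_apply (Ψ Φ : CompactIsotopy) (s : ℝ) (z : ℂ × ℂ) :
    (Ψ.comp Φ).φ s z = Ψ.φ s (Φ.φ s z) := rfl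

/-- The isotopy that first runs through `Φ` and then through `Ψ`. -/
noncomputable def concat (Φ Ψ : CompactIsotopy) : CompactIsotopy :=
  -- The clock of `Φ` stops at `s = 1/3` and that of `Ψ` starts at `s = 2/3`; the two motions never
  -- overlap.
  (Ψ.reparam (fun s => Real.smoothTransition (3 * s - 2))
    (Real.smoothTransition.contDiff.comp ((contDiff_const.mul contDiff_id).sub contDiff_const))
    (fun _ => ⟨Real.smoothTransition.nonneg _, Real.smoothTransition.le_one _⟩)
    (Real.smoothTransition.zero_of_nonpos (by norm_num))).comp
  (Φ.reparam (fun s => Real.smoothTransition (3 * s))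
    (Real.smoothTransition.contDiff.comp (contDiff_const.mul contDiff_id))
    (fun _ => ⟨Real.smoothTransition.nonneg _, Real.smoothTransition.le_one _⟩)
    (Real.smoothTransition.zero_of_nonpos (by norm_num)))

theorem concat_apply (Φ Ψ : CompactIsotopy) (s : ℝ) (z : ℂ × ℂ) :
    (Φ.concat Ψ).φ s z = Ψ.φ (Real.smoothTransition (3 * s - 2))
      (Φ.φ (Real.smoothTransition (3 * s)) z) := rfl

theorem concat_one (Φ Ψ : CompactIsotopy) (z : ℂ × ℂ) :
    (Φ.concat Ψ).φ 1 z = Ψ.φ 1 (Φ.φ 1 z) := by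
  rw [concat_apply, Real.smoothTransition.one_of_one_le (by norm_num),
    Real.smoothTransition.one_of_one_le (by norm_num)]

theorem isLagrangian_concat {Φ Ψ : CompactIsotopy} {L : Set (ℂ × ℂ)}
    (hΦ : ∀ s ∈ Set.Icc (0 : ℝ) 1, IsLagrangian (Φ.φ s '' L))
    (hΨ : ∀ s ∈ Set.Icc (0 : ℝ) 1, IsLagrangian (Ψ.φ s '' (Φ.φ 1 '' L))) (s : ℝ) :
    IsLagrangian ((Φ.concat Ψ).φ s '' L) := by
  have h : (Φ.concat Ψ).φ s '' L = Ψ.φ (Real.smoothTransition (3 * s - 2)) ''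
      (Φ.φ (Real.smoothTransition (3 * s)) '' L) := by
    rw [Set.image_image]; rfl
  rw [h]
  rcases le_total s (1 / 2) with hs | hs
  · rw [Real.smoothTransition.zero_of_nonpos (x := 3 * s - 2) (by linarith),
      show (Ψ.φ 0 : ℂ × ℂ → ℂ × ℂ) = id from funext Ψ.zero, Set.image_id]
    exact hΦ _ ⟨Real.smoothTransition.nonneg _, Real.smoothTransition.le_one _⟩
  · rw [Real.smoothTransition.one_of_one_le (x := 3 * s) (by linarith)]
    exact hΨ _ ⟨Real.smoothTransition.nonneg _, Real.smoothTransition.le_one _⟩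

end CompactIsotopy

/-! ### Isotopies between tori -/

/-- The linear action on angles. -/
def actAngles (M : GL (Fin 2) ℤ) (q : ℝ × ℝ) : ℝ × ℝ :=
  (M.1 0 0 * q.1 + M.1 0 1 * q.2, M.1 1 0 * q.1 + M.1 1 1 * q.2)

theorem actAngles_mul (N M : GL (Fin 2) ℤ) (q : ℝ × ℝ) :
    actAngles (N * M) q = actAngles N (actAngles M q) := by
  simp [actAngles, Matrix.mul_apply, Fin.sum_univ_two]
  constructor <;> ring

theorem actAngles_one (q : ℝ × ℝ) : actAngles 1 q = q := by
  simp [actAngles]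

theorem actAngles_add (M : GL (Fin 2) ℤ) (q r : ℝ × ℝ) :
    actAngles M (q + r) = actAngles M q + actAngles M r := by
  simp [actAngles]
  constructor <;> ring

/-- There is an isotopy of Lagrangian tori from `T_{a,b}` to `T_{a',b'}` whose end is given by an
integer matrix and a translation of the angles. -/
def Realizes (a b a' b' : ℝ) (M : GL (Fin 2) ℤ) : Prop :=
  ∃ Φ : CompactIsotopy, (∀ s ∈ Set.Icc (0 : ℝ) 1, IsLagrangian (Φ.φ s '' cliffordTorus a b)) ∧
    ∃ c : ℝ × ℝ, ∀ q, Φ.φ 1 (angles a b q) = angles a' b' (actAngles M q + c)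

theorem image_eq_of_angles {a b a' b' : ℝ} (ha : 0 < a) (hb : 0 < b) (ha' : 0 < a') (hb' : 0 < b')
    {M : GL (Fin 2) ℤ} {c : ℝ × ℝ} {f : ℂ × ℂ → ℂ × ℂ}
    (h : ∀ q, f (angles a b q) = angles a' b' (actAngles M q + c)) :
    f '' cliffordTorus a b = cliffordTorus a' b' := by
  apply Set.Subset.antisymm
  · rintro _ ⟨p, hp, rfl⟩
    obtain ⟨q, rfl⟩ := exists_angles ha hb hp
    rw [h]
    exact angles_mem ha' hb' _
  · intro p hp
    obtain ⟨q, rfl⟩ := exists_angles ha' hb' hp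
    refine ⟨_, angles_mem ha hb (actAngles M⁻¹ (q - c)), ?_⟩
    rw [h, ← actAngles_mul, mul_inv_cancel, actAngles_one, sub_add_cancel]

theorem Realizes.trans {a b a' b' a'' b'' : ℝ} (ha : 0 < a) (hb : 0 < b) (ha' : 0 < a')
    (hb' : 0 < b') {M N : GL (Fin 2) ℤ} (h : Realizes a b a' b' M)
    (h' : Realizes a' b' a'' b'' N) : Realizes a b a'' b'' (N * M) := by
  obtain ⟨Φ, hL, c, hc⟩ := h
  obtain ⟨Ψ, hL', c', hc'⟩ := h'
  refine ⟨Φ.concat Ψ, fun s _ => CompactIsotopy.isLagrangian_concat hL ?_ s,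
    actAngles N c + c', fun q => ?_⟩
  · rw [image_eq_of_angles ha hb ha' hb' hc]
    exact hL'
  · rw [CompactIsotopy.concat_one, hc, hc', actAngles_add, actAngles_mul, add_assoc]

/-! ### From matrices acting on angles to automorphisms of homology -/

section Monodromy

variable {a b : ℝ} (ha : 0 < a) (hb : 0 < b)

/-- The translation `c` cancels in the increment of a lifted loop, so only the matrix acts on
winding numbers. -/
theorem coords_H1map {M : GL (Fin 2) ℤ} {c : ℝ × ℝ} (f : C(cliffordTorus a b, cliffordTorus a b))
    (h : ∀ q, (f (torusCover ha hb q) : ℂ × ℂ) = angles a b (actAngles M q + c))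
    (x : H1 (cliffordTorus a b)) :
    coords ha hb (H1map f x) =
      (M.1 0 0 * (coords ha hb x).1 + M.1 0 1 * (coords ha hb x).2,
        M.1 1 0 * (coords ha hb x).1 + M.1 1 1 * (coords ha hb x).2) := by
  have key : ∀ (n : ℤ × ℤ) (y : cliffordTorus a b) (p : Path y y),
      (∀ t, (p t : ℂ × ℂ) = linearLoop (a := a) (b := b) n t) →
      coords ha hb (H1map f (loopClass p)) = (M.1 0 0 * n.1 + M.1 0 1 * n.2,
        M.1 1 0 * n.1 + M.1 1 1 * n.2) := by
    intro n y p hp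
    rw [H1map_loopClass]
    refine coords_loopClass ha hb _ ⟨fun t => actAngles M ((t : ℝ) • period n) + c, by
      unfold actAngles; fun_prop⟩ (fun t => ?_) _ ?_
    · refine (h _).symm.trans ?_
      exact congrArg (fun z => (f z : ℂ × ℂ)) (Subtype.ext (hp t).symm)
    · simp [actAngles, period]
      constructor <;> ring
  let F : H1 (cliffordTorus a b) →ₗ[ℤ] ℤ × ℤ := (coords ha hb : _ →ₗ[ℤ] ℤ × ℤ) ∘ₗ H1map f
  let A : ℤ × ℤ →ₗ[ℤ] ℤ × ℤ :=
    (M.1 0 0 • LinearMap.fst ℤ ℤ ℤ + M.1 0 1 • LinearMap.snd ℤ ℤ ℤ).prod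
      (M.1 1 0 • LinearMap.fst ℤ ℤ ℤ + M.1 1 1 • LinearMap.snd ℤ ℤ ℤ)
  have hFA : F = A ∘ₗ (coords ha hb : _ →ₗ[ℤ] ℤ × ℤ) := by
    refine (torusBasis ha hb).ext fun i => ?_
    fin_cases i
    · simp only [Fin.zero_eta, torusBasis_zero]
      refine (key (1, 0) _ _ (torusLoop₁_eq ha hb)).trans ?_
      simp [A, coords_torusLoop₁]
    · simp only [Fin.mk_one, torusBasis_one]
      refine (key (0, 1) _ _ (torusLoop₂_eq ha hb)).trans ?_
      simp [A, coords_torusLoop₂]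
  refine (LinearMap.congr_fun hFA x).trans ?_
  simp [A]

theorem torusBasis_repr (x : H1 (cliffordTorus a b)) :
    (torusBasis ha hb).repr x 0 = (coords ha hb x).1 ∧
      (torusBasis ha hb).repr x 1 = (coords ha hb x).2 := by
  constructor <;> simp [torusBasis]

theorem autMatrix_apply (g : H1 (cliffordTorus a b) ≃ₗ[ℤ] H1 (cliffordTorus a b)) (i j : Fin 2) :
    (autMatrix (torusBasis ha hb) g).1 i j =
      (torusBasis ha hb).repr (g (torusBasis ha hb j)) i := by
  change LinearMap.toMatrix (torusBasis ha hb) (torusBasis ha hb)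
    (g : H1 (cliffordTorus a b) →ₗ[ℤ] H1 (cliffordTorus a b)) i j = _
  rw [LinearMap.toMatrix_apply]
  rfl

theorem Realizes.mem_lagrangianMonodromies {M : GL (Fin 2) ℤ} (h : Realizes a b a b M)
    {g : H1 (cliffordTorus a b) ≃ₗ[ℤ] H1 (cliffordTorus a b)}
    (hg : autMatrix (torusBasis ha hb) g = M) : g ∈ lagrangianMonodromies (cliffordTorus a b) := by
  obtain ⟨Φ, hL, c, hc⟩ := h
  have h1 := image_eq_of_angles ha hb ha hb hc
  refine ⟨Φ, h1, hL, (torusBasis ha hb).ext fun j => (coords ha hb).injective ?_⟩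
  rw [coords_H1map ha hb _ (M := M) (c := c) fun q => hc q]
  have e0 := (torusBasis_repr ha hb (g (torusBasis ha hb j))).1
  have e1 := (torusBasis_repr ha hb (g (torusBasis ha hb j))).2
  rw [← autMatrix_apply, hg] at e0 e1
  have hj : coords ha hb (torusBasis ha hb j) =
      (if j = 0 then 1 else 0, if j = 1 then 1 else 0) := by
    fin_cases j
    · simp [torusBasis_zero, coords_torusLoop₁]
    · simp [torusBasis_one, coords_torusLoop₂]
  rw [hj]
  apply Prod.ext
  · refine e0.symm.trans ?_
    fin_cases j <;> simp
  · refine e1.symm.trans ?_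
    fin_cases j <;> simp

theorem mem_preserving_iff (g : H1 (cliffordTorus a b) ≃ₗ[ℤ] H1 (cliffordTorus a b)) :
    g ∈ preserving (torusMaslov ha hb) ↔ autMatrix (torusBasis ha hb) g ∈ Gmu := by
  have h : g ∈ preserving (torusMaslov ha hb) ↔
      torusMaslov ha hb ∘ₗ (g : H1 (cliffordTorus a b) →ₗ[ℤ] H1 (cliffordTorus a b)) =
        torusMaslov ha hb := ⟨fun h => LinearMap.ext h, fun h x => LinearMap.congr_fun h x⟩
  rw [h, mem_Gmu, autMatrix_apply, autMatrix_apply, autMatrix_apply, autMatrix_apply,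
    (torusBasis_repr ha hb _).1, (torusBasis_repr ha hb _).1,
    (torusBasis_repr ha hb _).2, (torusBasis_repr ha hb _).2]
  have e : ∀ j, torusMaslov ha hb (torusBasis ha hb j) = 2 := by
    intro j
    rw [torusMaslov_apply]
    fin_cases j
    · simp [torusBasis_zero, coords_torusLoop₁]
    · simp [torusBasis_one, coords_torusLoop₂]
  constructor
  · intro h
    have h' : ∀ j, _ := fun j => LinearMap.congr_fun h (torusBasis ha hb j)
    simp only [LinearMap.comp_apply, LinearEquiv.coe_coe, e, torusMaslov_apply] at h'
    constructor
    · linarith [h' 0]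
    · linarith [h' 1]
  · rintro ⟨h0, h1⟩
    refine (torusBasis ha hb).ext fun j => ?_
    simp only [LinearMap.comp_apply, LinearEquiv.coe_coe, e, torusMaslov_apply]
    fin_cases j
    · simp only [Fin.zero_eta]; linarith
    · simp only [Fin.mk_one]; linarith

end Monodromy

/-! ### Rotations -/

/-- The square of the Euclidean norm. -/
def sqNorm (z : ℂ × ℂ) : ℝ := z.1.re ^ 2 + z.1.im ^ 2 + (z.2.re ^ 2 + z.2.im ^ 2)

theorem contDiff_sqNorm : ContDiff ℝ ∞ sqNorm := by
  have h1 : ContDiff ℝ ∞ fun z : ℂ × ℂ => z.1.re := Complex.reCLM.contDiff.comp contDiff_fst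
  have h2 : ContDiff ℝ ∞ fun z : ℂ × ℂ => z.1.im := Complex.imCLM.contDiff.comp contDiff_fst
  have h3 : ContDiff ℝ ∞ fun z : ℂ × ℂ => z.2.re := Complex.reCLM.contDiff.comp contDiff_snd
  have h4 : ContDiff ℝ ∞ fun z : ℂ × ℂ => z.2.im := Complex.imCLM.contDiff.comp contDiff_snd
  exact ((h1.pow 2).add (h2.pow 2)).add ((h3.pow 2).add (h4.pow 2))

theorem sqNorm_eq (z : ℂ × ℂ) : sqNorm z = ‖z.1‖ ^ 2 + ‖z.2‖ ^ 2 := by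
  rw [Complex.sq_norm, Complex.sq_norm, Complex.normSq_apply, Complex.normSq_apply, sqNorm]
  ring

theorem sqNorm_of_mem {a b : ℝ} {p : ℂ × ℂ} (hp : p ∈ cliffordTorus a b) :
    sqNorm p = a ^ 2 + b ^ 2 := by
  rw [sqNorm_eq, hp.1, hp.2]

theorem norm_sq_le_sqNorm (z : ℂ × ℂ) : ‖z‖ ^ 2 ≤ sqNorm z := by
  rw [sqNorm_eq, Prod.norm_def]
  rcases max_choice ‖z.1‖ ‖z.2‖ with h | h <;> rw [h] <;>
    nlinarith [sq_nonneg ‖z.1‖, sq_nonneg ‖z.2‖]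

theorem rotate_rotate {E : Type*} [AddCommGroup E] [Module ℝ E] {K : E →ₗ[ℝ] E}
    (hK : ∀ z, K (K z) = -z) (t : ℝ) (z : E) :
    Real.cos (-t) • (Real.cos t • z + Real.sin t • K z) +
      Real.sin (-t) • K (Real.cos t • z + Real.sin t • K z) = z := by
  have h3 := Real.cos_sq_add_sin_sq t
  rw [Real.cos_neg, Real.sin_neg, map_add, map_smul, map_smul, hK]
  have h : ∀ x y : ℝ, x • (x • z + y • K z) + (-y) • (x • K z + y • -z) = (x ^ 2 + y ^ 2) • z := by
    intro x y; module
  rw [h, h3, one_smul]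

/-- The angle of a rotation that is cut off outside of a ball. -/
noncomputable def cutoffAngle (R s : ℝ) (z : ℂ × ℂ) : ℝ :=
  s * (Real.pi / 2) * Real.smoothTransition (R + 1 - sqNorm z)

/-- The rotations in the direction of a complex structure `K`, cut off outside of a ball. -/
noncomputable def rotation (K : ℂ × ℂ →L[ℝ] ℂ × ℂ) (R s : ℝ) (z : ℂ × ℂ) : ℂ × ℂ :=
  Real.cos (cutoffAngle R s z) • z + Real.sin (cutoffAngle R s z) • K z

theorem contDiff_rotation (K : ℂ × ℂ →L[ℝ] ℂ × ℂ) (R : ℝ) :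
    ContDiff ℝ ∞ fun q : ℝ × (ℂ × ℂ) => rotation K R q.1 q.2 := by
  have hθ : ContDiff ℝ ∞ fun q : ℝ × (ℂ × ℂ) => cutoffAngle R q.1 q.2 :=
    (contDiff_fst.mul contDiff_const).mul (Real.smoothTransition.contDiff.comp
      (contDiff_const.sub (contDiff_sqNorm.comp contDiff_snd)))
  exact (hθ.cos.fun_smul contDiff_snd).add (hθ.sin.fun_smul (K.contDiff.comp contDiff_snd))

theorem rotation_of_le {K : ℂ × ℂ →L[ℝ] ℂ × ℂ} {R s : ℝ} {z : ℂ × ℂ} (hz : sqNorm z ≤ R) :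
    rotation K R s z = Real.cos (s * (Real.pi / 2)) • z + Real.sin (s * (Real.pi / 2)) • K z := by
  rw [rotation, cutoffAngle, Real.smoothTransition.one_of_one_le (by linarith), mul_one]

theorem rotation_of_notMem {K : ℂ × ℂ →L[ℝ] ℂ × ℂ} {R s : ℝ} {z : ℂ × ℂ}
    (hz : z ∉ Metric.closedBall 0 (abs R + 1)) : rotation K R s z = z := by
  have h1 : abs R + 1 < ‖z‖ := by simpa using hz
  have h2 := norm_sq_le_sqNorm z
  have h3 : R + 1 - sqNorm z ≤ 0 := by nlinarith [abs_nonneg R, le_abs_self R]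
  rw [rotation, cutoffAngle, Real.smoothTransition.zero_of_nonpos h3]
  simp

/-- The cutoff depends only on `sqNorm`, which the rotation preserves. On each sphere the angle is
therefore constant, and reversing it gives the inverse. -/
theorem rotation_neg_rotation {K : ℂ × ℂ →L[ℝ] ℂ × ℂ} (hK : ∀ z, K (K z) = -z)
    (hN : ∀ (x y : ℝ) (z), sqNorm (x • z + y • K z) = (x ^ 2 + y ^ 2) * sqNorm z) (R s : ℝ)
    (z : ℂ × ℂ) : rotation K R (-s) (rotation K R s z) = z := by
  have h1 : sqNorm (rotation K R s z) = sqNorm z := by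
    rw [rotation, hN, Real.cos_sq_add_sin_sq, one_mul]
  have h : cutoffAngle R (-s) (rotation K R s z) = - cutoffAngle R s z := by
    rw [cutoffAngle, cutoffAngle, h1]; ring
  rw [rotation, h]
  exact rotate_rotate (K := (K : ℂ × ℂ →ₗ[ℝ] ℂ × ℂ)) hK (cutoffAngle R s z) z

theorem exists_rotation (K : ℂ × ℂ →L[ℝ] ℂ × ℂ) (hK : ∀ z, K (K z) = -z)
    (hN : ∀ (x y : ℝ) (z), sqNorm (x • z + y • K z) = (x ^ 2 + y ^ 2) * sqNorm z) (R : ℝ) :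
    ∃ Φ : CompactIsotopy, ∀ s z, sqNorm z ≤ R →
      Φ.φ s z = Real.cos (s * (Real.pi / 2)) • z + Real.sin (s * (Real.pi / 2)) • K z := by
  have h1 : ContDiff ℝ ∞ fun q : ℝ × (ℂ × ℂ) => rotation K R (-q.1) q.2 :=
    (contDiff_rotation K R).comp (f := fun q : ℝ × (ℂ × ℂ) => (-q.1, q.2))
      (contDiff_fst.neg.prodMk contDiff_snd)
  have h2 : ∀ s z, rotation K R s (rotation K R (-s) z) = z := fun s z => by
    simpa only [neg_neg] using rotation_neg_rotation hK hN R (-s) z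
  have h3 : ∀ z, rotation K R 0 z = z := fun z => by simp [rotation, cutoffAngle]
  have h4 : ∃ C : Set (ℂ × ℂ), IsCompact C ∧ ∀ s z, z ∉ C → rotation K R s z = z :=
    ⟨_, isCompact_closedBall _ _, fun s z hz => rotation_of_notMem hz⟩
  refine ⟨.ofFamily (rotation K R) (fun s => rotation K R (-s)) (contDiff_rotation K R) h1
    (rotation_neg_rotation hK hN R) h2 h3 h4, fun s z hz => ?_⟩
  rw [CompactIsotopy.ofFamily_apply]
  exact rotation_of_le hz

/-- The complex structure that interchanges the coordinates complex linearly. -/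
noncomputable def swapRotation : ℂ × ℂ →L[ℝ] ℂ × ℂ :=
  (-(ContinuousLinearMap.snd ℝ ℂ ℂ)).prod (ContinuousLinearMap.fst ℝ ℂ ℂ)

theorem swapRotation_apply (z : ℂ × ℂ) : swapRotation z = (-z.2, z.1) := rfl

theorem actAngles_fMat_one (q : ℝ × ℝ) : actAngles (fMat 1) q = (q.2, q.1) := by
  simp [actAngles, fMat]

theorem exp_add_pi_mul_I (x : ℝ) : Complex.exp (((x + Real.pi : ℝ) : ℂ) * Complex.I) =
    -Complex.exp ((x : ℂ) * Complex.I) := by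
  rw [Complex.ofReal_add, add_mul, Complex.exp_add, Complex.exp_pi_mul_I, mul_neg_one]

/-- The rotation is unitary where the cutoff is `1`, hence keeps the torus Lagrangian. Its end is
`(z₁, z₂) ↦ (-z₂, z₁)`, and the sign is the translation by `π`. -/
theorem realizes_swap {a b : ℝ} (ha : 0 < a) (hb : 0 < b) : Realizes a b b a (fMat 1) := by
  obtain ⟨Φ, hΦ⟩ := exists_rotation swapRotation
    (fun z => by simp [swapRotation_apply, Prod.ext_iff])
    (fun x y z => by
      simp only [swapRotation_apply, sqNorm, Prod.fst_add, Prod.snd_add, Prod.smul_fst,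
        Prod.smul_snd, Complex.add_re, Complex.add_im, Complex.smul_re, Complex.smul_im,
        Complex.neg_re, Complex.neg_im, smul_eq_mul]
      ring) (a ^ 2 + b ^ 2)
  have h : ∀ s q, Φ.φ s (angles a b q) = Real.cos (s * (Real.pi / 2)) • angles a b q +
      Real.sin (s * (Real.pi / 2)) • swapRotation (angles a b q) := fun s q =>
    hΦ s _ (sqNorm_of_mem (angles_mem ha hb q)).le
  refine ⟨Φ, fun s _ => isLagrangian_image_cliffordTorus ha hb _ fun q => ?_, (Real.pi, 0),
    fun q => ?_⟩
  · simp only [h]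
    have h1 := hasDerivAt_angles_fst a b q
    have h2 := hasDerivAt_angles_snd a b q
    refine ⟨_, _, (h1.const_smul (Real.cos (s * (Real.pi / 2)))).add
      ((swapRotation.hasFDerivAt.comp_hasDerivAt _ h1).const_smul (Real.sin (s * (Real.pi / 2)))),
      (h2.const_smul (Real.cos (s * (Real.pi / 2)))).add
      ((swapRotation.hasFDerivAt.comp_hasDerivAt _ h2).const_smul (Real.sin (s * (Real.pi / 2)))),
      ?_⟩
    generalize Real.cos (s * (Real.pi / 2)) = x
    generalize Real.sin (s * (Real.pi / 2)) = y
    simp [omega, swapRotation_apply, rot₁, rot₂]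
    ring
  · rw [h, one_mul, Real.cos_pi_div_two, Real.sin_pi_div_two, zero_smul, zero_add, one_smul,
      swapRotation_apply, actAngles_fMat_one]
    simp only [angles, Prod.mk_add_mk, add_zero, exp_add_pi_mul_I, mul_neg]

/-! ### Dilations -/

/-- A perturbation of the identity with Lipschitz constant below `1` is a homeomorphism. Its
derivative is injective since that of `u` has norm at most `k`, so the inverse is smooth. -/
theorem exists_diffeo_id_add {u : ℂ × ℂ → ℂ × ℂ} (hu : ContDiff ℝ ∞ u) {k : NNReal}
    (hk : LipschitzWith k u) (hk1 : k < 1) : ∃ φ : Diffeo, ∀ z, φ z = z + u z := by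
  have happ : ApproximatesLinearOn (fun z => z + u z)
      (ContinuousLinearEquiv.refl ℝ (ℂ × ℂ) : (ℂ × ℂ) →L[ℝ] (ℂ × ℂ))
      Set.univ k := by
    rw [ApproximatesLinearOn.approximatesLinearOn_iff_lipschitzOnWith, lipschitzOnWith_univ]
    have h : (fun z => z + u z) - ⇑(ContinuousLinearEquiv.refl ℝ (ℂ × ℂ) :
        (ℂ × ℂ) →L[ℝ] (ℂ × ℂ)) = u := by
      funext z
      simp
    rw [h]
    exact hk
  have hN : Subsingleton (ℂ × ℂ) ∨ k < ‖((ContinuousLinearEquiv.refl ℝ (ℂ × ℂ)).symm :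
      ℂ × ℂ →L[ℝ] ℂ × ℂ)‖₊⁻¹ := by
    right
    have : ‖((ContinuousLinearEquiv.refl ℝ (ℂ × ℂ)).symm : ℂ × ℂ →L[ℝ] ℂ × ℂ)‖₊ = 1 := by
      apply NNReal.eq
      exact ContinuousLinearMap.norm_id
    rwa [this, inv_one]
  let e := happ.toHomeomorph _ hN
  have he : ∀ z, e z = z + u z := fun z => rfl
  have hsm : ContDiff ℝ ∞ fun z => z + u z := contDiff_id.add hu
  have hinj : ∀ z, Function.Injective (ContinuousLinearMap.id ℝ (ℂ × ℂ) + fderiv ℝ u z) := by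
    intro z
    rw [injective_iff_map_eq_zero]
    intro v hv
    have h1 : v = - fderiv ℝ u z v := eq_neg_of_add_eq_zero_left hv
    have h2 : ‖v‖ ≤ k * ‖v‖ := by
      conv_lhs => rw [h1, norm_neg]
      exact (fderiv ℝ u z).le_of_opNorm_le (norm_fderiv_le_of_lipschitz ℝ hk) v
    have h3 : (k : ℝ) < 1 := by exact_mod_cast hk1
    by_contra h0
    have := norm_pos_iff.2 h0
    nlinarith
  let f' : ∀ z : ℂ × ℂ, (ℂ × ℂ) ≃L[ℝ] (ℂ × ℂ) := fun z =>
    (LinearEquiv.ofInjectiveEndo ((ContinuousLinearMap.id ℝ (ℂ × ℂ) + fderiv ℝ u z :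
      ℂ × ℂ →L[ℝ] ℂ × ℂ) : ℂ × ℂ →ₗ[ℝ] ℂ × ℂ) (hinj z)).toContinuousLinearEquiv
  have hd : ∀ z, HasFDerivAt e (f' z : ℂ × ℂ →L[ℝ] ℂ × ℂ) z := by
    intro z
    have h1 : HasFDerivAt (fun z => z + u z) (ContinuousLinearMap.id ℝ (ℂ × ℂ) + fderiv ℝ u z) z :=
      (hasFDerivAt_id z).add (hu.contDiffAt.differentiableAt (by simp)).hasFDerivAt
    exact h1
  exact ⟨⟨e.toEquiv, hsm.contMDiff, (e.contDiff_symm hd hsm).contMDiff⟩, he⟩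

theorem exists_isotopy_add {u : ℂ × ℂ → ℂ × ℂ} (hu : ContDiff ℝ ∞ u) (hc : HasCompactSupport u)
    {k : NNReal} (hk : LipschitzWith k u) (hk1 : k < 1) :
    ∃ Φ : CompactIsotopy, ∀ s ∈ Set.Icc (0 : ℝ) 1, ∀ z, Φ.φ s z = z + s • u z := by
  have h : ∀ s : ℝ, ∃ φ : Diffeo, s ∈ Set.Icc (0 : ℝ) 1 → ∀ z, φ z = z + s • u z := by
    intro s
    by_cases hs : s ∈ Set.Icc (0 : ℝ) 1
    · have hl : LipschitzWith k fun z => s • u z := by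
        have h1 := (lipschitzWith_smul (β := ℂ × ℂ) s).comp hk
        refine h1.weaken ?_
        have h2 : ‖s‖₊ ≤ 1 := by
          rw [← NNReal.coe_le_coe, coe_nnnorm, Real.norm_of_nonneg hs.1]
          exact hs.2
        exact mul_le_of_le_one_left zero_le h2
      obtain ⟨φ, hφ⟩ := exists_diffeo_id_add (hu.const_smul s) hl hk1
      exact ⟨φ, fun _ => hφ⟩
    -- Outside `[0, 1]` any diffeomorphism will do.
    · exact ⟨Diffeomorph.refl _ _ _, fun h => (hs h).elim⟩
  choose φ hφ using h
  refine ⟨⟨φ, ?_, fun z => by simp [hφ 0], tsupport u, hc, fun s hs z hz => ?_⟩, hφ⟩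
  · have : ContDiff ℝ ∞ fun q : ℝ × (ℂ × ℂ) => q.2 + q.1 • u q.2 :=
      contDiff_snd.add (contDiff_fst.fun_smul (hu.comp contDiff_snd))
    exact this.contDiffOn.congr fun q hq => hφ q.1 hq.1 q.2
  · rw [hφ s hs, image_eq_zero_of_notMem_tsupport hz, smul_zero, add_zero]

/-- Cut off dilations of the two factors are small perturbations of the identity. The bound `δ`
depends only on a bound for the initial radii, so the same `δ` serves for passing to a nearby torus
and back. -/
theorem exists_uniform_dilation (R : ℝ) : ∃ δ : ℝ, 0 < δ ∧ ∀ a b a' b' : ℝ,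
    0 < a → 0 < b → a ≤ R → b ≤ R → abs (a' / a - 1) < δ → abs (b' / b - 1) < δ → Realizes a b a' b' 1 := by
  let χ : ContDiffBump (0 : ℂ × ℂ) := ⟨abs R + 1, abs R + 2, by positivity, by linarith⟩
  have hχ : ContDiff ℝ ∞ χ := χ.contDiff
  have hχc : HasCompactSupport χ := χ.hasCompactSupport
  let u₁ : ℂ × ℂ → ℂ × ℂ := fun z => χ z • (z.1, 0)
  let u₂ : ℂ × ℂ → ℂ × ℂ := fun z => χ z • (0, z.2)
  have hu₁ : ContDiff ℝ ∞ u₁ := hχ.fun_smul (contDiff_fst.prodMk contDiff_const)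
  have hu₂ : ContDiff ℝ ∞ u₂ := hχ.fun_smul (contDiff_const.prodMk contDiff_snd)
  have hc₁ : HasCompactSupport u₁ := hχc.smul_right
  have hc₂ : HasCompactSupport u₂ := hχc.smul_right
  obtain ⟨k₁, hk₁⟩ := hu₁.lipschitzWith_of_hasCompactSupport hc₁ (by simp)
  obtain ⟨k₂, hk₂⟩ := hu₂.lipschitzWith_of_hasCompactSupport hc₂ (by simp)
  -- This makes the Lipschitz constant `|l| k₁ + |m| k₂` smaller than `1`; the summand `1` keeps the
  -- denominator positive.
  refine ⟨1 / ((k₁ : ℝ) + k₂ + 1), by positivity, fun a b a' b' ha hb haR hbR h₁ h₂ => ?_⟩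
  set l := a' / a - 1 with hl
  set m := b' / b - 1 with hm
  have hlip : LipschitzWith (‖l‖₊ * k₁ + ‖m‖₊ * k₂) fun z => l • u₁ z + m • u₂ z :=
    ((lipschitzWith_smul (β := ℂ × ℂ) l).comp hk₁).add
      ((lipschitzWith_smul (β := ℂ × ℂ) m).comp hk₂)
  have hlt : ‖l‖₊ * k₁ + ‖m‖₊ * k₂ < 1 := by
    rw [← NNReal.coe_lt_coe]
    push_cast
    rw [Real.norm_eq_abs, Real.norm_eq_abs]
    rw [lt_div_iff₀ (by positivity)] at h₁ h₂
    have e1 : 0 ≤ (k₁ : ℝ) := k₁.2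
    have e2 : 0 ≤ (k₂ : ℝ) := k₂.2
    have hM : max (abs l) (abs m) * (k₁ + k₂ + 1) < 1 := by
      rcases max_choice (abs l) (abs m) with h | h <;> rw [h] <;> assumption
    have f1 := le_max_left (abs l) (abs m)
    have f2 := le_max_right (abs l) (abs m)
    have f3 : 0 ≤ max (abs l) (abs m) := (abs_nonneg l).trans f1
    nlinarith [mul_le_mul_of_nonneg_right f1 e1, mul_le_mul_of_nonneg_right f2 e2]
  have hsm : ContDiff ℝ ∞ fun z => l • u₁ z + m • u₂ z :=
    (hu₁.const_smul l).add (hu₂.const_smul m)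
  have hcs : HasCompactSupport fun z => l • u₁ z + m • u₂ z :=
    (hc₁.smul_left (f := fun _ => l)).add (hc₂.smul_left (f := fun _ => m))
  obtain ⟨Φ, hΦ⟩ := exists_isotopy_add hsm hcs hlip hlt
  have hone : ∀ q, χ (angles a b q) = 1 := fun q => by
    apply χ.one_of_mem_closedBall
    rw [mem_closedBall_zero_iff, Prod.norm_def, (angles_mem ha hb q).1, (angles_mem ha hb q).2]
    have := le_abs_self R
    exact max_le (by change a ≤ abs R + 1; linarith) (by change b ≤ abs R + 1; linarith)
  have h : ∀ s ∈ Set.Icc (0 : ℝ) 1, ∀ q,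
      Φ.φ s (angles a b q) = angles (a * (1 + s * l)) (b * (1 + s * m)) q := fun s hs q => by
    rw [hΦ s hs]
    simp only [u₁, u₂, hone, one_smul]
    apply Prod.ext
    · simp [angles]; ring
    · simp [angles]; ring
  refine ⟨Φ, fun s hs => isLagrangian_image_cliffordTorus ha hb _ fun q => ?_, 0, fun q => ?_⟩
  · simp only [h s hs]
    exact ⟨_, _, hasDerivAt_angles_fst _ _ q, hasDerivAt_angles_snd _ _ q,
      by simp [omega, rot₁, rot₂]⟩
  · rw [h 1 (by simp), actAngles_one, add_zero, hl, hm]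
    congr 1 <;> field_simp <;> ring

/-- Nearby tori are connected, the relation is transitive, and the quadrant of radii is connected.
Symmetry is not available, so the local step is made in both directions. -/
theorem realizes_dilation {a b a' b' : ℝ} (ha : 0 < a) (hb : 0 < b) (ha' : 0 < a') (hb' : 0 < b') :
    Realizes a b a' b' 1 := by
  have hconn : _root_.IsPreconnected (Set.Ioi (0 : ℝ) ×ˢ Set.Ioi (0 : ℝ)) :=
    isPreconnected_Ioi.prod isPreconnected_Ioi
  refine hconn.induction₂' (fun x y => Realizes x.1 x.2 y.1 y.2 1) ?_ ?_
    (x := (a, b)) (y := (a', b')) ⟨ha, hb⟩ ⟨ha', hb'⟩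
  · rintro ⟨x, y⟩ ⟨hx : 0 < x, hy : 0 < y⟩
    -- The margin `1` lets the bound cover the radii near `(x, y)` too.
    obtain ⟨δ, hδ, h⟩ := exists_uniform_dilation (max x y + 1)
    have key : ∀ {c : ℝ}, 0 < c → ∀ {π : ℝ × ℝ → ℝ}, Continuous π → π (x, y) = c →
        ∀ᶠ z in nhds (x, y),
          0 < π z ∧ abs (π z / c - 1) < δ ∧ abs (c / π z - 1) < δ ∧ π z < c + 1 := by
      intro c hc π hπ hxy
      have h1 : Filter.Tendsto π (nhds (x, y)) (nhds c) := hxy ▸ hπ.tendsto _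
      have h2 : Filter.Tendsto (fun t : ℝ => abs (t / c - 1)) (nhds c) (nhds 0) := by
        have : ContinuousAt (fun t : ℝ => abs (t / c - 1)) c := by fun_prop
        simpa [ContinuousAt, hc.ne'] using this
      have h3 : Filter.Tendsto (fun t : ℝ => abs (c / t - 1)) (nhds c) (nhds 0) := by
        have : ContinuousAt (fun t : ℝ => abs (c / t - 1)) c := by
          have := hc.ne'
          fun_prop (disch := assumption)
        simpa [ContinuousAt, hc.ne'] using this
      filter_upwards [h1.eventually (lt_mem_nhds hc), (h2.comp h1).eventually (gt_mem_nhds hδ),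
        (h3.comp h1).eventually (gt_mem_nhds hδ),
        h1.eventually (gt_mem_nhds (show c < c + 1 by linarith))] with z e1 e2 e3 e4
      exact ⟨e1, e2, e3, e4⟩
    refine nhdsWithin_le_nhds ?_
    filter_upwards [key hx continuous_fst rfl, key hy continuous_snd rfl]
      with ⟨z, w⟩ ⟨p1, p2, p3, p4⟩ ⟨q1, q2, q3, q4⟩
    simp only at p1 p2 p3 p4 q1 q2 q3 q4
    have m1 := le_max_left x y
    have m2 := le_max_right x y
    exact ⟨h x y z w hx hy (by linarith) (by linarith) p2 q2,
      h z w x y p1 q1 (by linarith) (by linarith) p3 q3⟩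
  · rintro ⟨x, y⟩ ⟨z, w⟩ ⟨u, v⟩ ⟨hx, hy⟩ ⟨hz, hw⟩ - h1 h2
    simpa using Realizes.trans hx hy hz hw h1 h2

/-! ### Rotations around the circle `|z₁| = 2`, `z₂ = 0` -/

/-- The direction of the first coordinate. -/
noncomputable def unitVec (z : ℂ × ℂ) : ℂ := ((‖z.1‖⁻¹ : ℝ) : ℂ) * z.1

/-- The component in the plane of rotation of the second coordinate. -/
noncomputable def tubeHeight (z : ℂ × ℂ) : ℝ := (z.2 * unitVec z).im

/-- Rotation by the angle `θ` around the circle `|z₁| = 2`, `z₂ = 0`, in the normal planes spanned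
by the radial direction and one of the directions of `z₂`, which turns with `z₁`. -/
noncomputable def tubeRotation (θ : ℝ) (z : ℂ × ℂ) : ℂ × ℂ :=
  z + ((((Real.cos θ - 1) * (‖z.1‖ - 2) + Real.sin θ * tubeHeight z : ℝ) : ℂ) * unitVec z,
    (((Real.cos θ - 1) * tubeHeight z - Real.sin θ * (‖z.1‖ - 2) : ℝ) : ℂ) *
      (Complex.I * (starRingEnd ℂ) (unitVec z)))

theorem tubeRotation_zero (z : ℂ × ℂ) : tubeRotation 0 z = z := by
  simp [tubeRotation]

theorem mul_conj_of_norm_eq_one {e : ℂ} (he : ‖e‖ = 1) : e * (starRingEnd ℂ) e = 1 := by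
  rw [Complex.mul_conj, Complex.normSq_eq_norm_sq, he]
  simp

theorem norm_fst_polar {e : ℂ} (he : ‖e‖ = 1) {r : ℝ} (hr : 0 < r) : ‖(r : ℂ) * e‖ = r := by
  rw [norm_mul, he, mul_one, Complex.norm_real, Real.norm_of_nonneg hr.le]

theorem unitVec_polar {e : ℂ} (he : ‖e‖ = 1) {r : ℝ} (hr : 0 < r) (w : ℂ) :
    unitVec ((r : ℂ) * e, w) = e := by
  simp only [unitVec, norm_fst_polar he hr]
  rw [← mul_assoc, ← Complex.ofReal_mul, inv_mul_cancel₀ hr.ne', Complex.ofReal_one, one_mul]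

/-- In these coordinates `e` and `u` are fixed, and the plane of `r - 2` and `v` is turned by `θ`.
-/
theorem tubeRotation_polar (θ : ℝ) {e : ℂ} (he : ‖e‖ = 1) {r : ℝ} (hr : 0 < r) (u v : ℝ) :
    tubeRotation θ ((r : ℂ) * e, (⟨u, v⟩ : ℂ) * (starRingEnd ℂ) e) =
      (((2 + (Real.cos θ * (r - 2) + Real.sin θ * v) : ℝ) : ℂ) * e,
        (⟨u, Real.cos θ * v - Real.sin θ * (r - 2)⟩ : ℂ) * (starRingEnd ℂ) e) := by
  have h1 : tubeHeight ((r : ℂ) * e, (⟨u, v⟩ : ℂ) * (starRingEnd ℂ) e) = v := by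
    rw [tubeHeight, unitVec_polar he hr, mul_assoc, mul_comm _ e, mul_conj_of_norm_eq_one he,
      mul_one]
  rw [tubeRotation, h1, unitVec_polar he hr, norm_fst_polar he hr]
  apply Prod.ext
  · simp only [Prod.fst_add]
    push_cast
    ring
  · simp only [Prod.snd_add]
    rw [Complex.mk_eq_add_mul_I, Complex.mk_eq_add_mul_I]
    push_cast
    ring

/-- The square of the distance to the circle. -/
noncomputable def tubeSqDist (z : ℂ × ℂ) : ℝ := (‖z.1‖ - 2) ^ 2 + ‖z.2‖ ^ 2

theorem tubeSqDist_polar {e : ℂ} (he : ‖e‖ = 1) {r : ℝ} (hr : 0 < r) (u v : ℝ) :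
    tubeSqDist ((r : ℂ) * e, (⟨u, v⟩ : ℂ) * (starRingEnd ℂ) e) = (r - 2) ^ 2 + (u ^ 2 + v ^ 2) := by
  rw [tubeSqDist, norm_fst_polar he hr, norm_mul, RCLike.norm_conj, he, mul_one, Complex.sq_norm,
    Complex.normSq_mk]
  ring

theorem exists_polar {z : ℂ × ℂ} (hz : z.1 ≠ 0) : ∃ (e : ℂ) (r u v : ℝ), ‖e‖ = 1 ∧ 0 < r ∧
    z = ((r : ℂ) * e, (⟨u, v⟩ : ℂ) * (starRingEnd ℂ) e) := by
  have hr : 0 < ‖z.1‖ := norm_pos_iff.2 hz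
  have he : ‖unitVec z‖ = 1 := by
    rw [unitVec, norm_mul, Complex.norm_real, norm_inv, norm_norm, inv_mul_cancel₀ hr.ne']
  refine ⟨unitVec z, ‖z.1‖, (z.2 * unitVec z).re, (z.2 * unitVec z).im, he, hr, ?_⟩
  apply Prod.ext
  · simp only [unitVec]
    rw [← mul_assoc, ← Complex.ofReal_mul, mul_inv_cancel₀ hr.ne', Complex.ofReal_one, one_mul]
  · simp only [Complex.eta]
    rw [mul_assoc, mul_conj_of_norm_eq_one he, mul_one]

/-- The rotations around the circle, cut off outside of a tube. -/
noncomputable def tubeTwist (s : ℝ) (z : ℂ × ℂ) : ℂ × ℂ :=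
  tubeRotation (s * Real.pi * Real.smoothTransition (2 - tubeSqDist z)) z

theorem tubeTwist_of_ge (s : ℝ) {z : ℂ × ℂ} (hz : 2 ≤ tubeSqDist z) : tubeTwist s z = z := by
  rw [tubeTwist, Real.smoothTransition.zero_of_nonpos (by linarith), mul_zero, tubeRotation_zero]

theorem tubeTwist_of_le (s : ℝ) {z : ℂ × ℂ} (hz : tubeSqDist z ≤ 1) :
    tubeTwist s z = tubeRotation (s * Real.pi) z := by
  rw [tubeTwist, Real.smoothTransition.one_of_one_le (by linarith), mul_one]

/-- The rotation preserves the distance to the circle, on which the cutoff depends. -/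
theorem tubeTwist_neg_tubeTwist (s : ℝ) (z : ℂ × ℂ) : tubeTwist (-s) (tubeTwist s z) = z := by
  rcases le_or_gt 2 (tubeSqDist z) with h | h
  · rw [tubeTwist_of_ge s h, tubeTwist_of_ge (-s) h]
  have hz : z.1 ≠ 0 := by
    intro h0
    rw [tubeSqDist, h0, norm_zero] at h
    nlinarith [sq_nonneg ‖z.2‖]
  obtain ⟨e, r, u, v, he, hr, rfl⟩ := exists_polar hz
  rw [tubeSqDist_polar he hr] at h
  rw [tubeTwist, tubeTwist, tubeSqDist_polar he hr]
  set θ := s * Real.pi * Real.smoothTransition (2 - ((r - 2) ^ 2 + (u ^ 2 + v ^ 2))) with hθ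
  have hcs := Real.cos_sq_add_sin_sq θ
  rw [tubeRotation_polar θ he hr]
  have h1 : (Real.cos θ * (r - 2) + Real.sin θ * v) ^ 2 +
      (Real.cos θ * v - Real.sin θ * (r - 2)) ^ 2 = (r - 2) ^ 2 + v ^ 2 := by
    linear_combination ((r - 2) ^ 2 + v ^ 2) * hcs
  -- The new radial displacement has square less than `2`, so the point stays off `z₁ = 0` and polar
  -- coordinates remain valid.
  have hr' : 0 < 2 + (Real.cos θ * (r - 2) + Real.sin θ * v) := by
    nlinarith [sq_nonneg (Real.cos θ * v - Real.sin θ * (r - 2)), sq_nonneg u]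
  rw [tubeSqDist_polar he hr']
  have h2 : (2 + (Real.cos θ * (r - 2) + Real.sin θ * v) - 2) ^ 2 +
      (u ^ 2 + (Real.cos θ * v - Real.sin θ * (r - 2)) ^ 2) =
        (r - 2) ^ 2 + (u ^ 2 + v ^ 2) := by
    linear_combination h1
  rw [h2, neg_mul, neg_mul, ← hθ, tubeRotation_polar _ he hr', Real.cos_neg, Real.sin_neg]
  congr 2
  · norm_cast
    linear_combination (r - 2) * hcs
  · apply Complex.ext
    · rfl
    · linear_combination v * hcs

theorem contDiffAt_tubeTwist {q : ℝ × (ℂ × ℂ)} (hq : q.2.1 ≠ 0) :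
    ContDiffAt ℝ ∞ (fun q : ℝ × (ℂ × ℂ) => tubeTwist q.1 q.2) q := by
  have h1 : ContDiffAt ℝ ∞ (fun q : ℝ × (ℂ × ℂ) => q.2.1) q :=
    (contDiff_fst.comp contDiff_snd).contDiffAt
  have h2 : ContDiffAt ℝ ∞ (fun q : ℝ × (ℂ × ℂ) => q.2.2) q :=
    (contDiff_snd.comp contDiff_snd).contDiffAt
  have hn : ContDiffAt ℝ ∞ (fun q : ℝ × (ℂ × ℂ) => ‖q.2.1‖) q := h1.norm ℝ hq
  have hofReal : ∀ {f : ℝ × (ℂ × ℂ) → ℝ}, ContDiffAt ℝ ∞ f q →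
      ContDiffAt ℝ ∞ (fun q => (f q : ℂ)) q := fun hf =>
    Complex.ofRealCLM.contDiff.contDiffAt.comp q hf
  have he : ContDiffAt ℝ ∞ (fun q : ℝ × (ℂ × ℂ) => unitVec q.2) q :=
    (hofReal (hn.inv (norm_ne_zero_iff.2 hq))).mul h1
  have hc : ContDiffAt ℝ ∞ (fun q : ℝ × (ℂ × ℂ) => (starRingEnd ℂ) (unitVec q.2)) q :=
    Complex.conjCLE.contDiff.contDiffAt.comp q he
  have hh : ContDiffAt ℝ ∞ (fun q : ℝ × (ℂ × ℂ) => tubeHeight q.2) q :=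
    Complex.imCLM.contDiff.contDiffAt.comp q (h2.mul he)
  have hd : ContDiffAt ℝ ∞ (fun q : ℝ × (ℂ × ℂ) => tubeSqDist q.2) q :=
    ((hn.sub contDiffAt_const).pow 2).add ((h2.norm_sq ℝ))
  have hθ : ContDiffAt ℝ ∞ (fun q : ℝ × (ℂ × ℂ) =>
      q.1 * Real.pi * Real.smoothTransition (2 - tubeSqDist q.2)) q :=
    (contDiffAt_fst.mul contDiffAt_const).mul
      (Real.smoothTransition.contDiffAt.comp q (contDiffAt_const.sub hd))
  have hr := hn.sub (contDiffAt_const (c := (2 : ℝ)))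
  have hcos := hθ.cos.sub (contDiffAt_const (c := (1 : ℝ)))
  exact contDiffAt_snd.add
    (((hofReal ((hcos.mul hr).add (hθ.sin.mul hh))).mul he).prodMk
      ((hofReal ((hcos.mul hh).sub (hθ.sin.mul hr))).mul (contDiffAt_const.mul hc)))

/-- The norm and direction of `z₁` are singular only at `z₁ = 0`, where `tubeSqDist` is at least `4`
and the twist is the identity nearby. -/
theorem contDiff_tubeTwist : ContDiff ℝ ∞ fun q : ℝ × (ℂ × ℂ) => tubeTwist q.1 q.2 := by
  rw [contDiff_iff_contDiffAt]
  intro q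
  by_cases hq : q.2.1 = 0
  · have hcont : Continuous fun q : ℝ × (ℂ × ℂ) => tubeSqDist q.2 := by
      unfold tubeSqDist
      fun_prop
    have h4 : 2 < tubeSqDist q.2 := by
      rw [tubeSqDist, hq, norm_zero]
      nlinarith [sq_nonneg ‖q.2.2‖]
    refine contDiffAt_snd.congr_of_eventuallyEq ?_
    filter_upwards [hcont.tendsto q |>.eventually (lt_mem_nhds h4)] with p hp
    exact tubeTwist_of_ge _ hp.le
  · exact contDiffAt_tubeTwist hq

theorem two_le_tubeSqDist {z : ℂ × ℂ} (hz : z ∉ Metric.closedBall 0 4) : 2 ≤ tubeSqDist z := by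
  have h : 4 < ‖z‖ := by simpa using hz
  rw [Prod.norm_def, lt_max_iff] at h
  rw [tubeSqDist]
  rcases h with h | h <;> nlinarith [sq_nonneg (‖z.1‖ - 2), sq_nonneg ‖z.2‖]

/-- The isotopy of the cut off rotations around the circle. -/
noncomputable def tubeIsotopy : CompactIsotopy :=
  .ofFamily tubeTwist (fun s => tubeTwist (-s)) contDiff_tubeTwist
    (contDiff_tubeTwist.comp (f := fun q : ℝ × (ℂ × ℂ) => (-q.1, q.2))
      (contDiff_fst.neg.prodMk contDiff_snd))
    tubeTwist_neg_tubeTwist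
    (fun s z => by simpa only [neg_neg] using tubeTwist_neg_tubeTwist (-s) z)
    (fun z => by rw [tubeTwist, zero_mul, zero_mul, tubeRotation_zero])
    ⟨_, isCompact_closedBall _ _, fun s _ hz => tubeTwist_of_ge s (two_le_tubeSqDist hz)⟩

/-- Relative to the turning frame `conj e` the fibre angle is `q.1 + q.2`. The torus consists of
unit circles around the core, well inside the region of full rotation. -/
theorem angles_polar (q : ℝ × ℝ) : angles 2 1 q =
    (((2 : ℝ) : ℂ) * Complex.exp ((q.1 : ℂ) * Complex.I),
      (⟨Real.cos (q.1 + q.2), Real.sin (q.1 + q.2)⟩ : ℂ) *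
        (starRingEnd ℂ) (Complex.exp ((q.1 : ℂ) * Complex.I))) := by
  have h : (⟨Real.cos (q.1 + q.2), Real.sin (q.1 + q.2)⟩ : ℂ) =
      Complex.exp ((q.1 : ℂ) * Complex.I) * Complex.exp ((q.2 : ℂ) * Complex.I) := by
    rw [← Complex.exp_add, ← add_mul, ← Complex.ofReal_add, Complex.mk_eq_add_mul_I,
      Complex.ofReal_cos, Complex.ofReal_sin, Complex.exp_mul_I]
  rw [h, mul_right_comm, mul_conj_of_norm_eq_one (Complex.norm_exp_ofReal_mul_I _)]
  simp [angles]

theorem tubeIsotopy_angles (s : ℝ) (q : ℝ × ℝ) : tubeIsotopy.φ s (angles 2 1 q) =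
    (((2 + Real.sin (s * Real.pi) * Real.sin (q.1 + q.2) : ℝ) : ℂ) *
        Complex.exp ((q.1 : ℂ) * Complex.I),
      (⟨Real.cos (q.1 + q.2), Real.cos (s * Real.pi) * Real.sin (q.1 + q.2)⟩ : ℂ) *
        (starRingEnd ℂ) (Complex.exp ((q.1 : ℂ) * Complex.I))) := by
  have he : ‖Complex.exp ((q.1 : ℂ) * Complex.I)‖ = 1 := Complex.norm_exp_ofReal_mul_I _
  have h2 : (0 : ℝ) < 2 := two_pos
  rw [angles_polar]
  have hd : tubeSqDist (((2 : ℝ) : ℂ) * Complex.exp ((q.1 : ℂ) * Complex.I),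
      (⟨Real.cos (q.1 + q.2), Real.sin (q.1 + q.2)⟩ : ℂ) *
        (starRingEnd ℂ) (Complex.exp ((q.1 : ℂ) * Complex.I))) ≤ 1 := by
    rw [tubeSqDist_polar he h2, Real.cos_sq_add_sin_sq]
    norm_num
  rw [tubeIsotopy, CompactIsotopy.ofFamily_apply, tubeTwist_of_le s hd, tubeRotation_polar _ he h2]
  simp

/-- The complex structure `(z₁, z₂) ↦ (-i z̄₂, i z̄₁)`. -/
noncomputable def conjRotation : ℂ × ℂ →L[ℝ] ℂ × ℂ :=
  (-Complex.I • ((Complex.conjCLE : ℂ →L[ℝ] ℂ) ∘L (ContinuousLinearMap.snd ℝ ℂ ℂ))).prod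
    (Complex.I • ((Complex.conjCLE : ℂ →L[ℝ] ℂ) ∘L (ContinuousLinearMap.fst ℝ ℂ ℂ)))

theorem conjRotation_apply (z : ℂ × ℂ) : conjRotation z =
    (-Complex.I * (starRingEnd ℂ) z.2, Complex.I * (starRingEnd ℂ) z.1) := rfl

/-- The Lagrangian tori that connect `T_{2,1}` and `T_{1,2}`, for `x² + y² = 1`. -/
noncomputable def connectingTorus (x y : ℝ) (q : ℝ × ℝ) : ℂ × ℂ :=
  (((2 * x : ℝ) : ℂ) * Complex.exp ((q.1 : ℂ) * Complex.I) +
      -Complex.I * ((y : ℂ) * Complex.exp (((2 * q.1 + q.2 : ℝ) : ℂ) * Complex.I)),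
    Complex.I * (((2 * y : ℝ) : ℂ) * Complex.exp (((-q.1 : ℝ) : ℂ) * Complex.I)) +
      (x : ℂ) * Complex.exp ((q.2 : ℂ) * Complex.I))

/-- Here `x` and `y` are the cosine and sine of half the tube angle, whose own sine and cosine are
`2xy` and `x² - y²`. The half-angle rotation collapses the product to two exponentials in each
coordinate. -/
theorem rotate_tube {x y : ℝ} (h : x ^ 2 + y ^ 2 = 1) (q : ℝ × ℝ) {z : ℂ × ℂ}
    (hz : z = (((2 + 2 * x * y * Real.sin (q.1 + q.2) : ℝ) : ℂ) *
        Complex.exp ((q.1 : ℂ) * Complex.I),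
      (⟨Real.cos (q.1 + q.2), (x ^ 2 - y ^ 2) * Real.sin (q.1 + q.2)⟩ : ℂ) *
        (starRingEnd ℂ) (Complex.exp ((q.1 : ℂ) * Complex.I)))) :
    x • z + y • conjRotation z = connectingTorus x y q := by
  have hc : (starRingEnd ℂ) (Complex.exp ((q.1 : ℂ) * Complex.I)) =
      Complex.exp (((-q.1 : ℝ) : ℂ) * Complex.I) := by
    rw [← Complex.exp_conj]
    simp
  have hc' : (starRingEnd ℂ) (Complex.exp (((-q.1 : ℝ) : ℂ) * Complex.I)) =
      Complex.exp ((q.1 : ℂ) * Complex.I) := by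
    rw [← hc, Complex.conj_conj]
  have hg : Complex.exp (((q.1 + q.2 : ℝ) : ℂ) * Complex.I) =
      (Real.cos (q.1 + q.2) : ℂ) + Real.sin (q.1 + q.2) * Complex.I := by
    rw [Complex.exp_mul_I, Complex.ofReal_cos, Complex.ofReal_sin]
  have h1 : Complex.exp (((2 * q.1 + q.2 : ℝ) : ℂ) * Complex.I) =
      Complex.exp ((q.1 : ℂ) * Complex.I) * Complex.exp (((q.1 + q.2 : ℝ) : ℂ) * Complex.I) := by
    rw [← Complex.exp_add]; congr 1; push_cast; ring
  have h2 : Complex.exp ((q.2 : ℂ) * Complex.I) = Complex.exp (((-q.1 : ℝ) : ℂ) * Complex.I) *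
      Complex.exp (((q.1 + q.2 : ℝ) : ℂ) * Complex.I) := by
    rw [← Complex.exp_add]; congr 1; push_cast; ring
  have hxy : (x : ℂ) ^ 2 + (y : ℂ) ^ 2 = 1 := by exact_mod_cast h
  rw [hz, conjRotation_apply, connectingTorus, h1, h2, hg, Complex.mk_eq_add_mul_I]
  simp only [map_mul, map_add, Complex.conj_ofReal, Complex.conj_I, hc, hc']
  generalize Complex.exp ((q.1 : ℂ) * Complex.I) = e
  generalize Complex.exp (((-q.1 : ℝ) : ℂ) * Complex.I) = e'
  apply Prod.ext
  · simp only [Prod.fst_add, Prod.smul_fst, Complex.real_smul]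
    push_cast
    generalize Complex.cos ((q.1 : ℂ) + q.2) = C
    generalize Complex.sin ((q.1 : ℂ) + q.2) = S
    linear_combination e * y * S * hxy + e * y * S * (x ^ 2 - y ^ 2 + 1) * Complex.I_sq
  · simp only [Prod.snd_add, Prod.smul_snd, Complex.real_smul]
    push_cast
    generalize Complex.cos ((q.1 : ℂ) + q.2) = C
    generalize Complex.sin ((q.1 : ℂ) + q.2) = S
    linear_combination e' * x * S * Complex.I * hxy

/-- With `A = 2xy sin(q₁ + q₂)` the value is `5 + 4A`, and `|A| ≤ 1`. The later rotation thus acts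
without cutoff on a ball with bound `9`. -/
theorem sqNorm_connecting_tube {z : ℂ × ℂ} {x y : ℝ} (h : x ^ 2 + y ^ 2 = 1) (q : ℝ × ℝ)
    (hz : z = (((2 + 2 * x * y * Real.sin (q.1 + q.2) : ℝ) : ℂ) *
        Complex.exp ((q.1 : ℂ) * Complex.I),
      (⟨Real.cos (q.1 + q.2), (x ^ 2 - y ^ 2) * Real.sin (q.1 + q.2)⟩ : ℂ) *
        (starRingEnd ℂ) (Complex.exp ((q.1 : ℂ) * Complex.I)))) : sqNorm z ≤ 9 := by
  have h1 := Real.cos_sq_add_sin_sq (q.1 + q.2)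
  have h2 : (2 * x * y) ^ 2 + (x ^ 2 - y ^ 2) ^ 2 = 1 := by
    linear_combination (x ^ 2 + y ^ 2 + 1) * h
  have h3 : abs (2 * x * y * Real.sin (q.1 + q.2)) ≤ 1 := by
    rw [abs_mul]
    exact mul_le_one₀ (abs_le_one_iff_mul_self_le_one.2 (by nlinarith [sq_nonneg (x ^ 2 - y ^ 2)]))
      (abs_nonneg _) (Real.abs_sin_le_one _)
  rw [hz, sqNorm_eq, norm_mul, norm_mul, RCLike.norm_conj, Complex.norm_exp_ofReal_mul_I, mul_one,
    mul_one, Complex.norm_real, Real.norm_eq_abs, sq_abs, Complex.sq_norm, Complex.normSq_mk]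
  have h4 := (abs_le.1 h3).2
  have h5 : (2 * x * y * Real.sin (q.1 + q.2)) ^ 2 + ((x ^ 2 - y ^ 2) * Real.sin (q.1 + q.2)) ^ 2 =
      Real.sin (q.1 + q.2) ^ 2 := by linear_combination Real.sin (q.1 + q.2) ^ 2 * h2
  nlinarith

theorem hasDerivAt_exp_linear (k c x : ℝ) :
    HasDerivAt (fun t : ℝ => Complex.exp (((k * t + c : ℝ) : ℂ) * Complex.I))
      (k * Complex.I * Complex.exp (((k * x + c : ℝ) : ℂ) * Complex.I)) x := by
  have h : HasDerivAt (fun t : ℝ => k * t + c) k x := by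
    simpa using ((hasDerivAt_id x).const_mul k).add_const c
  have h1 := (h.ofReal_comp.mul_const Complex.I).cexp
  rwa [mul_comm] at h1

theorem hasDerivAt_connectingTorus_fst (x y : ℝ) (q : ℝ × ℝ) :
    HasDerivAt (fun t => connectingTorus x y (t, q.2))
      (((2 * x : ℝ) : ℂ) * (Complex.I * Complex.exp ((q.1 : ℂ) * Complex.I)) +
        ((2 * y : ℝ) : ℂ) * Complex.exp (((2 * q.1 + q.2 : ℝ) : ℂ) * Complex.I),
      ((2 * y : ℝ) : ℂ) * Complex.exp (((-q.1 : ℝ) : ℂ) * Complex.I)) q.1 := by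
  have h1 := (hasDerivAt_exp_linear 1 0 q.1).const_mul ((2 * x : ℝ) : ℂ)
  have h2 := ((hasDerivAt_exp_linear 2 q.2 q.1).const_mul (y : ℂ)).const_mul (-Complex.I)
  have h3 := ((hasDerivAt_exp_linear (-1) 0 q.1).const_mul ((2 * y : ℝ) : ℂ)).const_mul Complex.I
  have h := (h1.add h2).prodMk (h3.add_const ((x : ℂ) * Complex.exp ((q.2 : ℂ) * Complex.I)))
  simp only [one_mul, add_zero, neg_one_mul] at h
  convert! h using 1
  apply Prod.ext
  · simp only
    push_cast
    linear_combination (2 * y * Complex.exp ((2 * (q.1 : ℂ) + q.2) * Complex.I)) * Complex.I_sq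
  · simp only
    push_cast
    linear_combination (2 * y * Complex.exp (-(q.1 : ℂ) * Complex.I)) * Complex.I_sq

theorem hasDerivAt_connectingTorus_snd (x y : ℝ) (q : ℝ × ℝ) :
    HasDerivAt (fun t => connectingTorus x y (q.1, t))
      ((y : ℂ) * Complex.exp (((2 * q.1 + q.2 : ℝ) : ℂ) * Complex.I),
        (x : ℂ) * (Complex.I * Complex.exp ((q.2 : ℂ) * Complex.I))) q.2 := by
  have h1 := ((hasDerivAt_exp_linear 1 (2 * q.1) q.2).const_mul (y : ℂ)).const_mul (-Complex.I)
  have h2 := (hasDerivAt_exp_linear 1 0 q.2).const_mul (x : ℂ)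
  have h := (h1.const_add (((2 * x : ℝ) : ℂ) * Complex.exp ((q.1 : ℂ) * Complex.I))).prodMk
    (h2.const_add (Complex.I * (((2 * y : ℝ) : ℂ) *
      Complex.exp (((-q.1 : ℝ) : ℂ) * Complex.I))))
  simp only [one_mul, add_zero, add_comm _ (2 * q.1)] at h
  convert! h using 1
  apply Prod.ext
  · simp only
    push_cast
    linear_combination (y * Complex.exp ((2 * (q.1 : ℂ) + q.2) * Complex.I)) * Complex.I_sq
  · simp only
    push_cast
    ring

/-- Only the composite of the twist and the rotation is shown to be Lagrangian. The half turn of the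
fibres reverses `q.1 + q.2`, and the conjugate-linear rotation exchanges the factors; together they
produce `g_{-1}`. -/
theorem realizes_tube : Realizes 2 1 1 2 (gMat (-1)) := by
  obtain ⟨Ψ, hΨ⟩ := exists_rotation conjRotation
    (fun z => by
      apply Prod.ext <;> simp [conjRotation_apply] <;> rw [← mul_assoc, Complex.I_mul_I] <;> simp)
    (fun x y z => by
      simp only [conjRotation_apply, sqNorm, Prod.fst_add, Prod.snd_add, Prod.smul_fst,
        Prod.smul_snd, Complex.add_re, Complex.add_im, Complex.smul_re, Complex.smul_im,
        Complex.neg_re, Complex.neg_im, Complex.mul_re, Complex.mul_im, Complex.I_re,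
        Complex.I_im, Complex.conj_re, Complex.conj_im, smul_eq_mul]
      ring) 9
  have key : ∀ s q, (Ψ.comp tubeIsotopy).φ s (angles 2 1 q) =
      connectingTorus (Real.cos (s * (Real.pi / 2))) (Real.sin (s * (Real.pi / 2))) q := by
    intro s q
    have h1 := Real.cos_sq_add_sin_sq (s * (Real.pi / 2))
    have hd : s * Real.pi = 2 * (s * (Real.pi / 2)) := by ring
    have hz := tubeIsotopy_angles s q
    rw [hd, Real.sin_two_mul, Real.cos_two_mul', mul_right_comm 2 (Real.sin _)] at hz
    rw [CompactIsotopy.comp_apply, hΨ _ _ (sqNorm_connecting_tube h1 q hz), rotate_tube h1 q hz]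
  refine ⟨Ψ.comp tubeIsotopy, fun s _ => isLagrangian_image_cliffordTorus two_pos one_pos _
    fun q => ?_, (-(Real.pi / 2), Real.pi / 2), fun q => ?_⟩
  · simp only [key]
    -- The two complex coordinates contribute `-2xy cos(q₁ + q₂)` and `2xy cos(q₁ + q₂)` to `omega`.
    refine ⟨_, _, hasDerivAt_connectingTorus_fst _ _ q, hasDerivAt_connectingTorus_snd _ _ q, ?_⟩
    simp only [omega, Complex.add_re, Complex.add_im, Complex.ofReal_re,
      Complex.ofReal_im, Complex.mul_re, Complex.mul_im, Complex.I_re, Complex.I_im,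
      Complex.exp_ofReal_mul_I_re, Complex.exp_ofReal_mul_I_im]
    have e : (2 * q.1 + q.2) = q.1 + (q.1 + q.2) := by ring
    have h1 := Real.cos_sq_add_sin_sq q.1
    simp only [e, Real.cos_add, Real.sin_add, Real.cos_neg, Real.sin_neg]
    generalize Real.cos (s * (Real.pi / 2)) = x
    generalize Real.sin (s * (Real.pi / 2)) = y
    generalize Real.cos q.1 = c at *
    generalize Real.sin q.1 = d at *
    generalize Real.cos q.2 = c'
    generalize Real.sin q.2 = d'
    linear_combination (-2 * x * y * (c * c' - d * d')) * h1
  -- At `s = 1` the angles are `(2q₁ + q₂, -q₁)`, and the factors `-i` and `i` become the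
  -- translation by `(-π/2, π/2)`.
  · rw [key, one_mul, Real.cos_pi_div_two, Real.sin_pi_div_two, connectingTorus]
    have e1 : Complex.exp ((((2 * q.1 + q.2) + -(Real.pi / 2) : ℝ) : ℂ) * Complex.I) =
        -Complex.I * Complex.exp (((2 * q.1 + q.2 : ℝ) : ℂ) * Complex.I) := by
      rw [Complex.ofReal_add, add_mul, Complex.exp_add, Complex.ofReal_neg, neg_mul,
        Complex.exp_neg]
      push_cast
      rw [Complex.exp_pi_div_two_mul_I, Complex.inv_I, mul_comm]
    have e2 : Complex.exp (((-q.1 + Real.pi / 2 : ℝ) : ℂ) * Complex.I) =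
        Complex.I * Complex.exp (((-q.1 : ℝ) : ℂ) * Complex.I) := by
      rw [Complex.ofReal_add, add_mul, Complex.exp_add]
      push_cast
      rw [Complex.exp_pi_div_two_mul_I, mul_comm]
    have e3 : actAngles (gMat (-1)) q = (2 * q.1 + q.2, -q.1) := by
      simp [actAngles, gMat]
    rw [e3]
    simp only [angles, Prod.mk_add_mk, e1, e2]
    apply Prod.ext
    · simp
    · simp [mul_left_comm]

/-! ### Realization of all matrices -/

section

variable {a b : ℝ} (ha : 0 < a) (hb : 0 < b)
include ha hb

theorem realizes_fMat_one : Realizes a b a b (fMat 1) := by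
  simpa using (realizes_swap ha hb).trans ha hb hb ha (realizes_dilation hb ha ha hb)

/-- `f_2 = f_1 g_{-1}`: the swap brings `T_{1,2}` back to `T_{2,1}`, and dilations transport the
loop of tori to `T_{a,b}`. -/
theorem realizes_fMat_two : Realizes a b a b (fMat 2) := by
  have h : Realizes 2 1 2 1 (fMat 2) := by
    have := realizes_tube.trans two_pos one_pos one_pos two_pos (realizes_swap one_pos two_pos)
    rwa [fMat_mul_gMat] at this
  have h' := (realizes_dilation ha hb two_pos one_pos).trans ha hb two_pos one_pos h
  simpa using h'.trans ha hb two_pos one_pos (realizes_dilation two_pos one_pos ha hb)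

/-- `f_2 f_1 = g_1` and `f_1 f_2 = g_{-1}` supply the steps of the induction upwards and downwards.
-/
theorem realizes_gMat (n : ℤ) : Realizes a b a b (gMat n) := by
  have h1 := realizes_fMat_one ha hb
  have h2 := realizes_fMat_two ha hb
  induction n with
  | zero =>
    rw [gMat_zero]
    exact realizes_dilation ha hb ha hb
  | succ n ih =>
    have h := ih.trans ha hb ha hb (h1.trans ha hb ha hb h2)
    rwa [fMat_mul_fMat, gMat_mul_gMat, add_comm] at h
  | pred n ih =>
    have h := ih.trans ha hb ha hb (h2.trans ha hb ha hb h1)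
    rwa [fMat_mul_fMat, gMat_mul_gMat, show (1 - 2 : ℤ) + -n = -n - 1 by ring] at h

theorem realizes_of_mem {M : GL (Fin 2) ℤ} (hM : M ∈ Gmu) : Realizes a b a b M := by
  have h : M ∈ (Gmu : Set (GL (Fin 2) ℤ)) := hM
  rw [Gmu_eq_union] at h
  rcases h with ⟨n, rfl⟩ | ⟨n, rfl⟩
  · exact realizes_gMat ha hb n
  · have h' := (realizes_fMat_one ha hb).trans ha hb ha hb (realizes_gMat ha hb (n - 1))
    rwa [gMat_mul_fMat, sub_add_cancel] at h'

theorem lagrangianMonodromies_cliffordTorus : lagrangianMonodromies (cliffordTorus a b) =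
    (preserving (torusMaslov ha hb) : Set _) := by
  ext g
  refine ⟨fun h => mem_preserving_of_isotopy ha hb h, fun h => ?_⟩
  exact (realizes_of_mem ha hb ((mem_preserving_iff ha hb g).1 h)).mem_lagrangianMonodromies
    ha hb rfl

theorem autMatrix_image_lagrangianMonodromies :
    autMatrix (torusBasis ha hb) '' lagrangianMonodromies (cliffordTorus a b) =
      (Gmu : Set (GL (Fin 2) ℤ)) := by
  rw [lagrangianMonodromies_cliffordTorus ha hb]
  ext M
  constructor
  · rintro ⟨g, hg, rfl⟩
    exact (mem_preserving_iff ha hb g).1 hg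
  · intro hM
    obtain ⟨g, rfl⟩ := (autMatrix (torusBasis ha hb)).surjective M
    exact ⟨g, (mem_preserving_iff ha hb g).2 hM, rfl⟩

end

end LagMonodromy

theorem theorem1p1 (a b : ℝ) (ha : 0 < a) (hb : 0 < b) :
    -- the homology of the torus, its Maslov class, and the Lagrangian monodromy group
    (∃ (B : Module.Basis (Fin 2) ℤ (LagMonodromy.H1 (LagMonodromy.cliffordTorus a b)))
       (μ : LagMonodromy.H1 (LagMonodromy.cliffordTorus a b) →ₗ[ℤ] ℤ),
      B 0 = LagMonodromy.loopClass (LagMonodromy.torusLoop₁ a b ha hb) ∧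
      B 1 = LagMonodromy.loopClass (LagMonodromy.torusLoop₂ a b ha hb) ∧
      LagMonodromy.IsMaslovClass (LagMonodromy.cliffordTorus a b) μ ∧
      (∀ μ', LagMonodromy.IsMaslovClass (LagMonodromy.cliffordTorus a b) μ' → μ' = μ) ∧
      μ (B 0) = 2 ∧ μ (B 1) = 2 ∧
      LagMonodromy.lagrangianMonodromies (LagMonodromy.cliffordTorus a b) =
        (LagMonodromy.preserving μ : Set _) ∧
      LagMonodromy.autMatrix B ''
          LagMonodromy.lagrangianMonodromies (LagMonodromy.cliffordTorus a b) =
        (LagMonodromy.Gmu : Set (GL (Fin 2) ℤ))) ∧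
    -- the elements of determinant `1` and `-1`
    ({g | g ∈ LagMonodromy.Gmu ∧ (g : Matrix (Fin 2) (Fin 2) ℤ).det = 1} =
      Set.range LagMonodromy.gMat) ∧
    ({g | g ∈ LagMonodromy.Gmu ∧ (g : Matrix (Fin 2) (Fin 2) ℤ).det = -1} =
      Set.range LagMonodromy.fMat) ∧
    (LagMonodromy.Gmu : Set (GL (Fin 2) ℤ)) =
      Set.range LagMonodromy.gMat ∪ Set.range LagMonodromy.fMat ∧
    Disjoint (Set.range LagMonodromy.gMat) (Set.range LagMonodromy.fMat) ∧
    Function.Injective LagMonodromy.gMat ∧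
    Function.Injective LagMonodromy.fMat ∧
    -- relations
    (∀ n, orderOf (LagMonodromy.fMat n) = 2) ∧
    (∀ n, Matrix.mulVec (LagMonodromy.fMat n : Matrix (Fin 2) (Fin 2) ℤ) ![-1, 1] =
      -![-1, 1]) ∧
    (∀ n, LagMonodromy.gMat n = LagMonodromy.gMat 1 ^ n) ∧
    (∀ n : ℤ, (LagMonodromy.fMat 1 * LagMonodromy.fMat 0) ^ n = LagMonodromy.gMat n) ∧
    (∀ n : ℤ, (LagMonodromy.fMat 0 * LagMonodromy.fMat 1) ^ n = LagMonodromy.gMat (-n)) ∧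
    (∀ n, LagMonodromy.gMat (-n) = (LagMonodromy.gMat n)⁻¹) ∧
    (∀ n m, LagMonodromy.gMat n * LagMonodromy.fMat m = LagMonodromy.fMat (n + m)) ∧
    -- the presentation `⟨f₀, f₁ | f₀² = e = f₁²⟩`, and the infinite dihedral group
    (∃ e : PresentedGroup (Set.range fun i : Fin 2 => FreeGroup.of i ^ 2) ≃* LagMonodromy.Gmu,
      (e (PresentedGroup.of 0) : GL (Fin 2) ℤ) = LagMonodromy.fMat 0 ∧
      (e (PresentedGroup.of 1) : GL (Fin 2) ℤ) = LagMonodromy.fMat 1) ∧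
    Nonempty (LagMonodromy.Gmu ≃* DihedralGroup 0) := by
  open LagMonodromy in
  refine ⟨⟨torusBasis ha hb, torusMaslov ha hb, torusBasis_zero ha hb, torusBasis_one ha hb,
    isMaslovClass_torusMaslov ha hb, fun μ' h => h.eq_torusMaslov ha hb, ?_, ?_,
    lagrangianMonodromies_cliffordTorus ha hb, autMatrix_image_lagrangianMonodromies ha hb⟩,
    setOf_det_one, setOf_det_neg_one, Gmu_eq_union, disjoint_range, gMat_injective, fMat_injective,
    orderOf_fMat, fMat_mulVec, fun n => ?_, fun n => ?_, fun n => ?_, gMat_neg, gMat_mul_fMat,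
    ⟨TwoInvolutions.equivGmu, TwoInvolutions.toGmu_zero, TwoInvolutions.toGmu_one⟩,
    ⟨dihedralEquivGmu.symm⟩⟩
  · rw [torusBasis_zero, torusMaslov_apply, coords_torusLoop₁]; rfl
  · rw [torusBasis_one, torusMaslov_apply, coords_torusLoop₂]; rfl
  · rw [gMat_zpow, mul_one]
  · rw [fMat_mul_fMat, gMat_zpow, sub_zero, mul_one]
  · rw [fMat_mul_fMat, gMat_zpow, zero_sub, mul_neg_one]
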